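/- Let $\mathbb{B}$ be the Cayley tree (Bethe lattice) in which every vertex has exactly three neighbors, let $V:\mathbb{B}\to\mathbb{R}$ be a bounded potential, and let $H=H_0+V$ on $\ell^2(\mathbb{B})$, where $(H_0u)(x)=\sum_{y\sim x}u(y)$. Fix a vertex $O$, delete one of the three edges at $O$ together with the part of the tree stemming from it, and let $\mathbb{B}_O$ be the remaining rooted binary tree; let $H|_{\mathbb{B}_O}$ be the operator on $\ell^2(\mathbb{B}_O)$ given by the same formula on $\mathbb{B}_O$. Code the infinite self-avoiding paths $(x_n)_{n\ge 1}$ in $\mathbb{B}_O$ with $x_1=O$ by the binary expansions of the points $t\in[0,1]$, each binary digit saying to which of the two neighbors farther from $O$ the path moves next, and set $$\phi(t)=\sum_{n=1}^\infty V^2(x_n)\in[0,\infty],$$ where $(x_n)$ is the path representing $t$ (the choice of expansion for dyadic rationals is immaterial). Let $\sigma_O$ be the spectral measure of $H|_{\mathbb{B}_O}$ at the delta function $\delta_O$, a probability measure; for $V=0$ its density is $\tilde\sigma'(\lambda)=\frac{1}{4\pi}\sqrt{8-\lambda^2}$ on $[-2\sqrt2,2\sqrt2]$. Put $\rho_O=\sigma_O'/\tilde\sigma'$,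 where $\sigma_O'$ is the density of the absolutely continuous part of $\sigma_O$, let $dw(\lambda)=\frac{1}{4\pi}\sqrt{8-\lambda^2}\,d\lambda$ on $[-2\sqrt2,2\sqrt2]$, and $$s_O=\int_{-2\sqrt2}^{2\sqrt2}\ln\rho_O(\lambda)\,dw(\lambda)\in[-\infty,\infty).$$ Assume that $A\subseteq[0,1]$ is a measurable set of positive Lebesgue measure $|A|$ and that $\phi\in L^1(A)$. Then $$s_O\ \ge\ -\frac{1}{4|A|}\int_A\phi(t)\,dt+\ln|A| .$$ In particular, $[-2\sqrt2,2\sqrt2]\subseteq\sigma_{ac}(H|_{\mathbb{B}_O})$ and $[-2\sqrt2,2\sqrt2]\subseteq\sigma_{ac}(H)$. -/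

import Mathlib

open MeasureTheory Set
open scoped ENNReal

noncomputable section

/-! ### Schrödinger operators on graphs of bounded degree -/

section Operator

variable {W : Type*}

/-- The complex Hilbert space `ℓ²(W)`. -/
abbrev EllTwo (W : Type*) : Type _ := lp (fun _ : W => ℂ) 2

theorem summable_sq_neighbors (G : SimpleGraph W) [G.LocallyFinite] (d : ℕ)
    (hd : ∀ x, G.degree x ≤ d) (f : W → ℝ) (hf0 : ∀ x, 0 ≤ f x) (hf : Summable f) :
    Summable (fun x => ∑ y ∈ G.neighborFinset x, f y) ∧
      ∑' x, ∑ y ∈ G.neighborFinset x, f y ≤ d * ∑' x, f x := by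
  classical
  have key : ∑' x, ∑ y ∈ G.neighborFinset x, ENNReal.ofReal (f y)
      ≤ d * ∑' x, ENNReal.ofReal (f x) := by
    have h1 : ∀ x, ∑ y ∈ G.neighborFinset x, ENNReal.ofReal (f y)
        = ∑' y, if G.Adj x y then ENNReal.ofReal (f y) else 0 := by
      intro x
      rw [tsum_eq_sum (s := G.neighborFinset x) (by intro y hy; simp at hy; simp [hy])]
      refine Finset.sum_congr rfl fun y hy => ?_
      simp at hy
      simp [hy]
    simp_rw [h1]
    rw [ENNReal.tsum_comm, ← ENNReal.tsum_mul_left]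
    refine ENNReal.tsum_le_tsum fun y => ?_
    rw [tsum_eq_sum (s := G.neighborFinset y)
      (by intro x hx; simp at hx; simp [G.adj_comm x y, hx])]
    calc _ ≤ ∑ x ∈ G.neighborFinset y, ENNReal.ofReal (f y) := by
          refine Finset.sum_le_sum fun x _ => ?_
          split_ifs <;> simp
      _ = (G.degree y : ℝ≥0∞) * ENNReal.ofReal (f y) := by
          simp [SimpleGraph.card_neighborFinset_eq_degree]
      _ ≤ _ := by gcongr; exact hd y
  have hS : ∀ x, 0 ≤ ∑ y ∈ G.neighborFinset x, f y :=
    fun x => Finset.sum_nonneg fun y _ => hf0 y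
  have e1 : ∀ x, ∑ y ∈ G.neighborFinset x, ENNReal.ofReal (f y)
      = ENNReal.ofReal (∑ y ∈ G.neighborFinset x, f y) :=
    fun x => (ENNReal.ofReal_sum_of_nonneg fun y _ => hf0 y).symm
  simp_rw [e1] at key
  rw [← ENNReal.ofReal_tsum_of_nonneg hf0 hf] at key
  have hs : Summable (fun x => ∑ y ∈ G.neighborFinset x, f y) := by
    have hne : ∑' x, ENNReal.ofReal (∑ y ∈ G.neighborFinset x, f y) ≠ ⊤ :=
      ne_top_of_le_ne_top (by finiteness) key
    have := ENNReal.summable_toReal hne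
    simpa [ENNReal.toReal_ofReal (hS _)] using this
  refine ⟨hs, ?_⟩
  rw [← ENNReal.ofReal_tsum_of_nonneg hS hs, ← ENNReal.ofReal_natCast,
    ← ENNReal.ofReal_mul (by positivity)] at key
  exact (ENNReal.ofReal_le_ofReal_iff
    (mul_nonneg (by positivity) (tsum_nonneg hf0))).1 key

theorem summable_sq_schrodinger (G : SimpleGraph W) [G.LocallyFinite] (V : W → ℝ) (d : ℕ)
    (hd : ∀ x, G.degree x ≤ d) (C : ℝ) (hC : ∀ x, |V x| ≤ C) (u : EllTwo W) :
    Summable (fun x => ‖∑ y ∈ G.neighborFinset x, u y + (V x : ℂ) * u x‖ ^ 2) ∧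
      ∑' x, ‖∑ y ∈ G.neighborFinset x, u y + (V x : ℂ) * u x‖ ^ 2
        ≤ (2 * d ^ 2 + 2 * C ^ 2) * ‖u‖ ^ 2 := by
  have hu : Summable (fun x => ‖u x‖ ^ 2) := by
    simpa using (lp.memℓp u).summable (by simp)
  have hn : ‖u‖ ^ 2 = ∑' x, ‖u x‖ ^ 2 := by
    simpa using lp.norm_rpow_eq_tsum (p := 2) (by simp) u
  obtain ⟨h1, h2⟩ := summable_sq_neighbors G d hd (fun x => ‖u x‖ ^ 2) (fun x => by positivity) hu
  have hb : ∀ x, ‖∑ y ∈ G.neighborFinset x, u y + (V x : ℂ) * u x‖ ^ 2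
      ≤ 2 * d * (∑ y ∈ G.neighborFinset x, ‖u y‖ ^ 2) + 2 * C ^ 2 * ‖u x‖ ^ 2 := by
    intro x
    have a1 : ‖∑ y ∈ G.neighborFinset x, u y‖ ^ 2 ≤ d * ∑ y ∈ G.neighborFinset x, ‖u y‖ ^ 2 := by
      calc ‖∑ y ∈ G.neighborFinset x, u y‖ ^ 2 ≤ (∑ y ∈ G.neighborFinset x, ‖u y‖) ^ 2 := by
            gcongr; exact norm_sum_le _ _
        _ ≤ (G.neighborFinset x).card * ∑ y ∈ G.neighborFinset x, ‖u y‖ ^ 2 :=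
            sq_sum_le_card_mul_sum_sq
        _ ≤ _ := by
            gcongr
            rw [SimpleGraph.card_neighborFinset_eq_degree]
            exact hd x
    have a2 : ‖(V x : ℂ) * u x‖ ^ 2 ≤ C ^ 2 * ‖u x‖ ^ 2 := by
      rw [norm_mul, mul_pow]
      gcongr
      simpa using hC x
    have a3 := norm_add_le (∑ y ∈ G.neighborFinset x, u y) ((V x : ℂ) * u x)
    have a4 := norm_nonneg (∑ y ∈ G.neighborFinset x, u y + (V x : ℂ) * u x)
    nlinarith [sq_nonneg (‖∑ y ∈ G.neighborFinset x, u y‖ - ‖(V x : ℂ) * u x‖)]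
  have hR := (h1.mul_left (2 * (d : ℝ))).add (hu.mul_left (2 * C ^ 2))
  have hs := Summable.of_nonneg_of_le (fun x => by positivity) hb hR
  refine ⟨hs, (hs.tsum_le_tsum hb hR).trans ?_⟩
  rw [(h1.mul_left _).tsum_add (hu.mul_left _), tsum_mul_left, tsum_mul_left, hn]
  have : (0 : ℝ) ≤ 2 * d := by positivity
  nlinarith [mul_le_mul_of_nonneg_left h2 this]

/-- The Schrödinger operator `H = H₀ + V` on `ℓ²(W)`,
`(H u)(x) = ∑_{y ∼ x} u(y) + V(x) u(x)`, for a graph on `W` with bounded degrees and a bounded real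
potential `V`. -/
def schrodinger (G : SimpleGraph W) [G.LocallyFinite] (hG : ∃ d : ℕ, ∀ x, G.degree x ≤ d)
    (V : W → ℝ) (hV : ∃ C : ℝ, ∀ x, |V x| ≤ C) : EllTwo W →L[ℂ] EllTwo W :=
  LinearMap.mkContinuousOfExistsBound
    { toFun := fun u => ⟨fun x => ∑ y ∈ G.neighborFinset x, u y + (V x : ℂ) * u x, by
        obtain ⟨d, hd⟩ := hG
        obtain ⟨C, hC⟩ := hV
        refine memℓp_gen ?_
        simpa using (summable_sq_schrodinger G V d hd C hC u).1⟩
      map_add' := by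
        intro u v
        ext x
        change ∑ y ∈ G.neighborFinset x, (u y + v y) + (V x : ℂ) * (u x + v x) =
          (∑ y ∈ G.neighborFinset x, u y + (V x : ℂ) * u x) +
            (∑ y ∈ G.neighborFinset x, v y + (V x : ℂ) * v x)
        rw [Finset.sum_add_distrib]
        ring
      map_smul' := by
        intro c u
        ext x
        change ∑ y ∈ G.neighborFinset x, c * u y + (V x : ℂ) * (c * u x) =
          c * (∑ y ∈ G.neighborFinset x, u y + (V x : ℂ) * u x)
        rw [← Finset.mul_sum]
        ring }
    (by
      obtain ⟨d, hd⟩ := hG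
      obtain ⟨C, hC⟩ := hV
      refine ⟨√(2 * d ^ 2 + 2 * C ^ 2), fun u => ?_⟩
      have h := (summable_sq_schrodinger G V d hd C hC u).2
      refine (sq_le_sq₀ (norm_nonneg _) (by positivity)).1 ?_
      rw [mul_pow, Real.sq_sqrt (by positivity)]
      refine le_trans (le_of_eq ?_) h
      simpa using lp.norm_rpow_eq_tsum (p := 2) (by simp) _)

end Operator

/-! ### Spectral measures and the absolutely continuous spectrum -/

section Spectral

variable {E : Type*} [NormedAddCommGroup E] [InnerProductSpace ℂ E] [CompleteSpace E]

/-- The positive functional `f ↦ ⟨ψ, f(H) ψ⟩` on `C_c(ℝ)`, where `f(H)` is given by the continuous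
functional calculus of the bounded self-adjoint operator `H`. -/
def spectralFunctional (H : E →L[ℂ] E) (ψ : E) :
    CompactlySupportedContinuousMap ℝ ℝ →ₚ[ℝ] ℝ :=
  PositiveLinearMap.mk₀
    { toFun := fun f => (inner ℂ ψ ((cfc (f : ℝ → ℝ) H : E →L[ℂ] E) ψ)).re
      map_add' := by
        intro f g
        have h : cfc (fun x => f x + g x) H = cfc (f : ℝ → ℝ) H + cfc (g : ℝ → ℝ) H :=
          cfc_add (a := H) (f : ℝ → ℝ) g f.continuous.continuousOn g.continuous.continuousOn
        change (inner ℂ ψ ((cfc (fun x => f x + g x) H) ψ)).re = _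
        rw [h]
        simp
      map_smul' := by
        intro c f
        have h : cfc (fun x => c • f x) H = c • cfc (f : ℝ → ℝ) H :=
          cfc_smul (a := H) c (f : ℝ → ℝ) f.continuous.continuousOn
        change (inner ℂ ψ ((cfc (fun x => c • f x) H) ψ)).re = _
        rw [h]
        simp [inner_smul_right_eq_smul] }
    (by
      intro f hf
      have h : 0 ≤ cfc (f : ℝ → ℝ) H := cfc_nonneg fun x _ => hf x
      have h2 := ((ContinuousLinearMap.nonneg_iff_isPositive _).1 h).re_inner_nonneg_right ψ
      simpa using h2)

/-- The spectral measure `μ_ψ` of the bounded self-adjoint operator `H` at the vector `ψ`: the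
regular Borel measure on `ℝ` with `∫ f dμ_ψ = ⟨ψ, f(H) ψ⟩` for all `f ∈ C_c(ℝ)`. -/
def spectralMeasure (H : E →L[ℂ] E) (ψ : E) : Measure ℝ :=
  RealRMK.rieszMeasure (spectralFunctional H ψ)

/-- The absolutely continuous part, with respect to Lebesgue measure, of a measure on `ℝ`. -/
def acPart (μ : Measure ℝ) : Measure ℝ := volume.withDensity (μ.rnDeriv volume)

/-- The absolutely continuous spectrum of the bounded self-adjoint operator `H`: the smallest closed
set that carries the absolutely continuous parts of all spectral measures of `H`. -/
def acSpectrum (H : E →L[ℂ] E) : Set ℝ :=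
  closure (⋃ ψ : E, (acPart (spectralMeasure H ψ)).support)

end Spectral

/-! ### The Cayley tree of degree 3 -/

/-- The rooted binary tree `𝔹_O`: its vertices are finite words in the letters `0, 1`, stored with the
last letter first, the root `O` is the empty word, and the neighbors of `x` farther from `O` are
`0 :: x` and `1 :: x`. -/
def binaryTree : SimpleGraph (List (Fin 2)) where
  Adj x y := (∃ i, y = i :: x) ∨ ∃ i, x = i :: y
  symm := ⟨fun _ _ h => h.symm⟩
  loopless := ⟨fun x h => by
    rcases h with ⟨i, h⟩ | ⟨i, h⟩ <;> simpa using congrArg List.length h⟩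

/-- Vertices of the Cayley tree `𝔹`. -/
abbrev CayleyVertex : Type := List (Fin 2) ⊕ List (Fin 2)

/-- The Cayley tree (Bethe lattice) `𝔹` in which every vertex has degree 3. It is presented as two
copies of `𝔹_O` with an edge joining their roots; the vertex `O` is the root of the first copy.
Deleting that edge and the second copy leaves `𝔹_O`. -/
def cayleyTree : SimpleGraph CayleyVertex :=
  (binaryTree ⊕g binaryTree) ⊔ SimpleGraph.edge (Sum.inl []) (Sum.inr [])

theorem binaryTree_neighborSet_subset (x : List (Fin 2)) :
    binaryTree.neighborSet x ⊆ (({0 :: x, 1 :: x, x.tail} : Finset (List (Fin 2))) : Set _) := by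
  intro y hy
  rcases hy with ⟨i, rfl⟩ | ⟨i, rfl⟩
  · fin_cases i <;> simp
  · simp

instance binaryTree_locallyFinite : binaryTree.LocallyFinite := fun x =>
  ((Finset.finite_toSet _).subset (binaryTree_neighborSet_subset x)).fintype

theorem binaryTree_degree_le : ∃ d : ℕ, ∀ x, binaryTree.degree x ≤ d := by
  refine ⟨3, fun x => ?_⟩
  rw [← SimpleGraph.card_neighborFinset_eq_degree]
  refine (Finset.card_le_card (t := {0 :: x, 1 :: x, x.tail}) fun y hy => ?_).trans
    Finset.card_le_three
  exact_mod_cast binaryTree_neighborSet_subset x (by simpa using hy)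

/-- The three neighbors of a vertex of the Cayley tree. -/
def cayleyNeighbors : CayleyVertex → Finset CayleyVertex
  | Sum.inl x => {Sum.inl (0 :: x), Sum.inl (1 :: x), if x = [] then Sum.inr [] else Sum.inl x.tail}
  | Sum.inr x => {Sum.inr (0 :: x), Sum.inr (1 :: x), if x = [] then Sum.inl [] else Sum.inr x.tail}

theorem binaryTree_adj_iff (x y : List (Fin 2)) :
    binaryTree.Adj x y ↔ y = 0 :: x ∨ y = 1 :: x ∨ x ≠ [] ∧ y = x.tail := by
  change ((∃ i, y = i :: x) ∨ ∃ i, x = i :: y) ↔ _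
  rw [Fin.exists_fin_two, or_assoc]
  refine or_congr_right (or_congr_right ⟨?_, ?_⟩)
  · rintro ⟨i, rfl⟩
    simp
  · rintro ⟨h, rfl⟩
    exact ⟨x.head h, (List.cons_head_tail h).symm⟩

theorem mem_cayleyNeighbors (x y : CayleyVertex) :
    y ∈ cayleyNeighbors x ↔ cayleyTree.Adj x y := by
  rcases x with x | x <;> rcases y with y | y <;> by_cases hx : x = [] <;>
    simp [cayleyNeighbors, cayleyTree, binaryTree_adj_iff, SimpleGraph.edge_adj, hx]

theorem card_cayleyNeighbors (x : CayleyVertex) : (cayleyNeighbors x).card = 3 := by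
  rcases x with x | x <;> refine Finset.card_eq_three.2 ⟨_, _, _, ?_, ?_, ?_, rfl⟩ <;> cases x <;>
    simp <;> intro h <;> have := congrArg List.length h <;> simp at this <;> omega

instance cayleyTree_locallyFinite : cayleyTree.LocallyFinite := fun x =>
  ((Finset.finite_toSet (cayleyNeighbors x)).subset
    fun y hy => (mem_cayleyNeighbors x y).2 hy).fintype

theorem cayleyTree_degree (x : CayleyVertex) : cayleyTree.degree x = 3 := by
  rw [← SimpleGraph.card_neighborFinset_eq_degree, ← card_cayleyNeighbors x]
  congr 1
  ext y
  simp [mem_cayleyNeighbors]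

/-- The Schrödinger operator `H = H₀ + V` on the Cayley tree `𝔹`. -/
def treeOperator (V : CayleyVertex → ℝ) (hV : ∃ C : ℝ, ∀ x, |V x| ≤ C) :
    EllTwo CayleyVertex →L[ℂ] EllTwo CayleyVertex :=
  schrodinger cayleyTree ⟨3, fun x => (cayleyTree_degree x).le⟩ V hV

/-- The Schrödinger operator `H|_{𝔹_O} = H₀ + V` on `𝔹_O`. -/
def rootedOperator (V : List (Fin 2) → ℝ) (hV : ∃ C : ℝ, ∀ x, |V x| ≤ C) :
    EllTwo (List (Fin 2)) →L[ℂ] EllTwo (List (Fin 2)) :=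
  schrodinger binaryTree binaryTree_degree_le V hV

/-! ### The entropy `s_O` -/

/-- The spectral measure `σ_O` of `H|_{𝔹_O}` at the delta function of the root `O`. -/
def rootMeasure (V : List (Fin 2) → ℝ) (hV : ∃ C : ℝ, ∀ x, |V x| ≤ C) : Measure ℝ :=
  spectralMeasure (rootedOperator V hV) (lp.single 2 [] (1 : ℂ))

/-- The density `(4π)⁻¹ (8 - λ²)^{1/2}` on `[-2√2, 2√2]` (and `0` elsewhere). It is both the density
of the probability measure `w` and the density of the spectral measure at `O` when `V = 0`. -/
def freeDensity (l : ℝ) : ℝ := (4 * Real.pi)⁻¹ * √(8 - l ^ 2)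

/-- The probability measure `dw(λ) = (4π)⁻¹ (8 - λ²)^{1/2} dλ` on `[-2√2, 2√2]`. -/
def freeMeasure : Measure ℝ :=
  (volume.restrict (Icc (-(2 * √2)) (2 * √2))).withDensity fun l => ENNReal.ofReal (freeDensity l)

/-- The relative density `ρ_O(λ)`: the Lebesgue density of (the absolutely continuous part of) `σ_O`
divided by its value for `V = 0`. -/
def relDensity (V : List (Fin 2) → ℝ) (hV : ∃ C : ℝ, ∀ x, |V x| ≤ C) (l : ℝ) : ℝ≥0∞ :=
  (rootMeasure V hV).rnDeriv volume l / ENNReal.ofReal (freeDensity l)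

/-- The entropy `s_O = ∫ ln ρ_O dw ∈ [-∞, ∞)`, as the integral of the positive part minus the
integral of the negative part, with `ln 0 = -∞`. The positive part has a finite integral because
`∫ ρ_O dw ≤ 1`. -/
def entropyAtRoot (V : List (Fin 2) → ℝ) (hV : ∃ C : ℝ, ∀ x, |V x| ≤ C) : EReal :=
  ((∫⁻ l, (ENNReal.log (relDensity V hV l)).toENNReal ∂freeMeasure : ℝ≥0∞) : EReal) -
    ((∫⁻ l, (-ENNReal.log (relDensity V hV l)).toENNReal ∂freeMeasure : ℝ≥0∞) : EReal)

/-! ### Coding of paths by real numbers -/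

/-- The binary digits of `t ∈ [0,1]`; as is customary `1 = 0.111…`, and every other dyadic rational
gets its terminating expansion. -/
def binaryDigit (t : ℝ) (n : ℕ) : Fin 2 := if t = 1 then 1 else Real.digits t 2 n

/-- The vertices of the path from `O` to infinity that represents `t ∈ [0,1]`: `pathVertex t 0 = O`
and `pathVertex t n` is the vertex at distance `n` from `O` given by the first `n` digits of `t`. -/
def pathVertex (t : ℝ) : ℕ → List (Fin 2)
  | 0 => []
  | n + 1 => binaryDigit t n :: pathVertex t n

/-- The function `φ(t) ∈ [0, ∞]`, the sum of `V²` over all vertices of the path representing `t`,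
the starting point `O` included. -/
def pathSum (V : List (Fin 2) → ℝ) (t : ℝ) : ℝ≥0∞ :=
  ∑' n : ℕ, ENNReal.ofReal (V (pathVertex t n) ^ 2)

end

/-! Write the spectral parameter as z = -√2(ζ + ζ⁻¹) with ζ in the upper half disc, and normalize
the Green's function at the root to M(ζ) = √2⟨δ_O, (H - z)⁻¹δ_O⟩, so that M(ζ) = ζ when V = 0.
Removing the root gives M = (ζ⁻¹ + ζ + V(O)/√2 - S)⁻¹, where S is the average of the functions M of
the two subtrees. On the half circle ζ = exp(iθ) the measure w becomes (2/π) sin²θ dθ, and for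
finitely supported V the relative density is Im M / sin θ; its entropy is `arcEntropy`.

Two inequalities drive the induction over the tree. First, a sum rule: on the circle ζ⁻¹ + ζ is
real, so Im M = |M|² Im S, and Cauchy's theorem for (log M - iw)·2 sin²w with ζ = exp(iw) bounds the
integral of log|M| below through the ζ²-coefficient of log(M/ζ). The real segment of the half disc,
where the energies outside the free spectrum live, contributes with a favorable sign because 0 ≤ arg
M ≤ π. Hence the entropy of M is at least that of S minus V(O)²/4
(`HerglotzFamily.arcEntropy_schurStep_ge`). Second, concavity of the logarithm: log((a + b)/2) ≥ p
log(a/(2p)) + q log(b/(2q)) for p + q = 1 (`log_average_ge`). Taking for p and q the fractions of A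
in the two halves of [0,1] and iterating, each V² is weighted by the fraction of A in its binary
cylinder, which adds up to the average of φ over A, while the terms -p log(2p) - q log(2q) telescope
to ln|A| (`treeGreen_entropy_bound`).

This is carried out for V cut off at finite depth. The cutoff is removed by upper semicontinuity of
the entropy in the form s + ∫ log f dw ≤ ∫ f dσ - 1 for positive continuous f: each such inequality
survives weak convergence of the spectral measures, and f close to 1/ρ recovers s ≤ ∫ ln ρ dw. A
finite negative part of the entropy forces ρ > 0 almost everywhere, which gives the spectral
inclusion. The full tree differs by one more branch at O: its imaginary part only helps, and it
costs the constant 1/2 (`cayley_entropy_bound`).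

The damping ε, subtracted as iε in every denominator, makes M continuous with positive imaginary
part up to the real segment, so that Cauchy's theorem applies on a closed rectangle; ε tends to 0 on
the circle only. -/

noncomputable section HerglotzFamilies

open Complex Filter Topology

/-! ### Functions of Herglotz type on the upper half disc and the continued fraction step. -/

/-- The closed upper half of the unit disc, without the origin. -/
def halfDisc : Set ℂ := {ζ | ζ ≠ 0 ∧ ‖ζ‖ ≤ 1 ∧ 0 ≤ ζ.im}

/-- The open upper half of the unit disc. -/
def openHalfDisc : Set ℂ := {ζ | ‖ζ‖ < 1 ∧ 0 < ζ.im}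

/-- A family of functions on the upper half disc with values in the closed upper half plane, indexed
by a damping parameter `ε ∈ [0, 1]`, which is `k ζ` to first order at the origin and whose boundary
values on the unit circle are controlled by powers of the sine. -/
structure HerglotzFamily (k : ℝ) (S : ℝ → ℂ → ℂ) : Prop where
  im_nonneg : ∀ ε ∈ Ioc (0 : ℝ) 1, ∀ ζ ∈ halfDisc, 0 ≤ (S ε ζ).im
  continuousOn : ∀ ε ∈ Ioc (0 : ℝ) 1, ContinuousOn (S ε) halfDisc
  differentiableOn : ∀ ε ∈ Ioc (0 : ℝ) 1, DifferentiableOn ℂ (S ε) openHalfDisc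
  near_zero : ∃ C r : ℝ, 0 ≤ C ∧ 0 < r ∧ ∀ ε ∈ Icc (0 : ℝ) 1, ∀ ζ : ℂ, ζ ≠ 0 → ‖ζ‖ ≤ r →
    ‖S ε ζ - k * ζ‖ ≤ C * ‖ζ‖ ^ 2
  tendsto_arc : ∀ θ ∈ Ioo 0 Real.pi,
    Tendsto (fun ε => S ε (exp (θ * I))) (𝓝[>] 0) (𝓝 (S 0 (exp (θ * I))))
  arc_bounds : ∃ c C : ℝ, ∃ K : ℕ, 0 < c ∧ 0 ≤ C ∧ ∀ ε ∈ Icc (0 : ℝ) 1, ∀ θ ∈ Ioo 0 Real.pi,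
    c * Real.sin θ ^ K ≤ (S ε (exp (θ * I))).im ∧
      ‖S ε (exp (θ * I))‖ * Real.sin θ ^ K ≤ C
  continuousAt_arc : ∀ θ ∈ Ioo 0 Real.pi, ContinuousAt (S 0) (exp (θ * I))

/-- One step of the continued fraction expansion, with self energy `S`, potential `v` and damping. -/
def schurStep (v : ℝ) (S : ℝ → ℂ → ℂ) (ε : ℝ) (ζ : ℂ) : ℂ :=
  (ζ⁻¹ + ζ + v - ε * I - S ε ζ)⁻¹

/-- Im(ζ⁻¹ + ζ) = Im ζ · (1 - |ζ|⁻²). Equality occurs on the circle and on the real segment, so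
strict negativity of denominators must come from elsewhere. -/
theorem im_inv_add_self_nonpos {ζ : ℂ} (h : ζ ∈ halfDisc) : (ζ⁻¹ + ζ).im ≤ 0 := by
  obtain ⟨h0, h1, h2⟩ := h
  have hn : 0 < normSq ζ := normSq_pos.2 h0
  have hn1 : normSq ζ ≤ 1 := by
    rw [normSq_eq_norm_sq]; nlinarith [norm_nonneg ζ]
  rw [add_im, inv_im]
  have : ζ.im ≤ ζ.im / normSq ζ := by
    rw [le_div_iff₀ hn]; nlinarith
  rw [neg_div]; linarith

theorem exp_arc_mem {θ : ℝ} (h : θ ∈ Ioo 0 Real.pi) : exp (θ * I) ∈ halfDisc := by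
  refine ⟨exp_ne_zero _, (norm_exp_ofReal_mul_I θ).le, ?_⟩
  rw [exp_ofReal_mul_I_im]
  exact (Real.sin_pos_of_mem_Ioo h).le

theorem inv_add_self_arc (θ : ℝ) :
    (exp (θ * I))⁻¹ + exp (θ * I) = ((2 * Real.cos θ : ℝ) : ℂ) := by
  rw [← exp_neg, ← neg_mul, add_comm]
  push_cast
  rw [two_cos]

theorem inv_im_pos {w : ℂ} (h : w.im < 0) : 0 < (w⁻¹).im := by
  rw [inv_im]
  have : 0 < normSq w := normSq_pos.2 (fun h0 => by simp [h0] at h)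
  exact div_pos (by linarith) this

theorem HerglotzFamily.id : HerglotzFamily 1 (fun _ ζ => ζ) where
  im_nonneg _ _ ζ h := h.2.2
  continuousOn _ _ := continuousOn_id
  differentiableOn _ _ := differentiableOn_id
  near_zero := ⟨0, 1, le_rfl, one_pos, fun _ _ ζ _ _ => by simp⟩
  tendsto_arc θ _ := tendsto_const_nhds
  arc_bounds := ⟨1, 1, 1, one_pos, zero_le_one, fun ε _ θ _ => by
    rw [exp_ofReal_mul_I_im, norm_exp_ofReal_mul_I]
    simpa using Real.sin_le_one θ⟩
  continuousAt_arc _ _ := continuousAt_id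

theorem HerglotzFamily.add {k l : ℝ} {S T : ℝ → ℂ → ℂ} (hS : HerglotzFamily k S)
    (hT : HerglotzFamily l T) : HerglotzFamily (k + l) (fun ε ζ => S ε ζ + T ε ζ) where
  im_nonneg ε hε ζ h := by
    rw [add_im]; exact add_nonneg (hS.im_nonneg ε hε ζ h) (hT.im_nonneg ε hε ζ h)
  continuousOn ε hε := (hS.continuousOn ε hε).add (hT.continuousOn ε hε)
  differentiableOn ε hε := (hS.differentiableOn ε hε).add (hT.differentiableOn ε hε)
  near_zero := by
    obtain ⟨C, r, hC, hr, h⟩ := hS.near_zero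
    obtain ⟨C', r', hC', hr', h'⟩ := hT.near_zero
    refine ⟨C + C', min r r', by positivity, by positivity, fun ε hε ζ h0 hζ => ?_⟩
    have a := h ε hε ζ h0 (hζ.trans (min_le_left _ _))
    have b := h' ε hε ζ h0 (hζ.trans (min_le_right _ _))
    calc _ = ‖(S ε ζ - k * ζ) + (T ε ζ - l * ζ)‖ := by congr 1; push_cast; ring
      _ ≤ _ := norm_add_le _ _
      _ ≤ _ := by linarith
  tendsto_arc θ h := (hS.tendsto_arc θ h).add (hT.tendsto_arc θ h)
  arc_bounds := by
    obtain ⟨c, C, K, hc, hC, h⟩ := hS.arc_bounds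
    obtain ⟨c', C', K', hc', hC', h'⟩ := hT.arc_bounds
    refine ⟨c, C + C', K + K', hc, by positivity, fun ε hε θ hθ => ?_⟩
    have s0 := Real.sin_pos_of_mem_Ioo hθ
    have s1 := Real.sin_le_one θ
    obtain ⟨a, b⟩ := h ε hε θ hθ
    obtain ⟨a', b'⟩ := h' ε hε θ hθ
    have p1 : Real.sin θ ^ K ≤ 1 := pow_le_one₀ s0.le s1
    have p1' : Real.sin θ ^ K' ≤ 1 := pow_le_one₀ s0.le s1
    have p0 : 0 < Real.sin θ ^ K := pow_pos s0 _
    have p0' : 0 < Real.sin θ ^ K' := pow_pos s0 _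
    rw [add_im, pow_add]
    constructor
    · have : c * (Real.sin θ ^ K * Real.sin θ ^ K') ≤ c * Real.sin θ ^ K := by
        gcongr; exact mul_le_of_le_one_right p0.le p1'
      have : 0 ≤ c' * Real.sin θ ^ K' := by positivity
      linarith
    · calc _ ≤ (‖S ε (exp (θ * I))‖ + ‖T ε (exp (θ * I))‖) *
            (Real.sin θ ^ K * Real.sin θ ^ K') := by gcongr; exact norm_add_le _ _
        _ = ‖S ε (exp (θ * I))‖ * Real.sin θ ^ K * Real.sin θ ^ K' +
            ‖T ε (exp (θ * I))‖ * Real.sin θ ^ K' * Real.sin θ ^ K := by ring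
        _ ≤ C * 1 + C' * 1 := by gcongr
        _ = _ := by ring
  continuousAt_arc θ h := (hS.continuousAt_arc θ h).add (hT.continuousAt_arc θ h)

theorem HerglotzFamily.half {k : ℝ} {S : ℝ → ℂ → ℂ} (hS : HerglotzFamily k S) :
    HerglotzFamily (k / 2) (fun ε ζ => S ε ζ / 2) where
  im_nonneg ε hε ζ h := by
    have := hS.im_nonneg ε hε ζ h
    rw [div_ofNat_im]; linarith
  continuousOn ε hε := (hS.continuousOn ε hε).div_const _
  differentiableOn ε hε := (hS.differentiableOn ε hε).div_const _
  near_zero := by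
    obtain ⟨C, r, hC, hr, h⟩ := hS.near_zero
    refine ⟨C, r, hC, hr, fun ε hε ζ h0 hζ => ?_⟩
    have a := h ε hε ζ h0 hζ
    have : S ε ζ / 2 - ((k / 2 : ℝ) : ℂ) * ζ = (S ε ζ - k * ζ) / 2 := by push_cast; ring
    rw [this, norm_div, RCLike.norm_ofNat]
    have := norm_nonneg (S ε ζ - k * ζ)
    linarith
  tendsto_arc θ h := (hS.tendsto_arc θ h).div_const _
  arc_bounds := by
    obtain ⟨c, C, K, hc, hC, h⟩ := hS.arc_bounds
    refine ⟨c / 2, C, K, by positivity, hC, fun ε hε θ hθ => ?_⟩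
    obtain ⟨a, b⟩ := h ε hε θ hθ
    have s0 := Real.sin_pos_of_mem_Ioo hθ
    rw [div_ofNat_im, norm_div, RCLike.norm_ofNat]
    have : 0 ≤ ‖S ε (exp (θ * I))‖ * Real.sin θ ^ K := by positivity
    constructor <;> linarith
  continuousAt_arc θ h := (hS.continuousAt_arc θ h).div_const _

section Step

variable {k : ℝ} {S : ℝ → ℂ → ℂ} (v : ℝ)

theorem schurStep_denominator_im {ε : ℝ} {ζ : ℂ} :
    (ζ⁻¹ + ζ + v - ε * I - S ε ζ).im = (ζ⁻¹ + ζ).im - ε - (S ε ζ).im := by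
  simp

/-- The damping alone makes the sign strict; on the real segment both other terms may vanish. -/
theorem HerglotzFamily.denominator_im_neg (hS : HerglotzFamily k S) {ε : ℝ} (hε : ε ∈ Ioc (0 : ℝ) 1)
    {ζ : ℂ} (h : ζ ∈ halfDisc) : (ζ⁻¹ + ζ + v - ε * I - S ε ζ).im < 0 := by
  rw [schurStep_denominator_im]
  have := im_inv_add_self_nonpos h
  have := hS.im_nonneg ε hε ζ h
  linarith [hε.1]

theorem HerglotzFamily.im_schurStep_pos (hS : HerglotzFamily k S) {ε : ℝ}
    (hε : ε ∈ Ioc (0 : ℝ) 1) {ζ : ℂ} (h : ζ ∈ halfDisc) : 0 < (schurStep v S ε ζ).im :=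
  inv_im_pos (hS.denominator_im_neg v hε h)

theorem HerglotzFamily.im_arc_pos (hS : HerglotzFamily k S) {ε : ℝ} (hε : ε ∈ Icc (0 : ℝ) 1)
    {θ : ℝ} (hθ : θ ∈ Ioo 0 Real.pi) : 0 < (S ε (exp (θ * I))).im := by
  obtain ⟨c, C, K, hc, hC, h⟩ := hS.arc_bounds
  have s0 := Real.sin_pos_of_mem_Ioo hθ
  exact lt_of_lt_of_le (by positivity) (h ε hε θ hθ).1

/-- Inside the arc no damping is needed, since Im S is strictly positive there by `arc_bounds`. -/
theorem HerglotzFamily.denominator_arc_im_neg (hS : HerglotzFamily k S) {ε : ℝ}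
    (hε : ε ∈ Icc (0 : ℝ) 1) {θ : ℝ} (hθ : θ ∈ Ioo 0 Real.pi) :
    ((exp (θ * I))⁻¹ + exp (θ * I) + v - ε * I - S ε (exp (θ * I))).im < 0 := by
  rw [schurStep_denominator_im, inv_add_self_arc, ofReal_im]
  linarith [hS.im_arc_pos hε hθ, hε.1]

/-- The deviation from `1` of `ζ / schurStep v S ε ζ`. -/
def schurCorrection (v : ℝ) (S : ℝ → ℂ → ℂ) (ε : ℝ) (ζ : ℂ) : ℂ :=
  (v - ε * I) * ζ + ζ ^ 2 - ζ * S ε ζ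

theorem schurStep_eq_div (ε : ℝ) {ζ : ℂ} (h : ζ ≠ 0) :
    schurStep v S ε ζ = ζ * (1 + schurCorrection v S ε ζ)⁻¹ := by
  have : 1 + schurCorrection v S ε ζ = ζ * (ζ⁻¹ + ζ + v - ε * I - S ε ζ) := by
    rw [schurCorrection]; field_simp; ring
  rw [this, mul_inv, ← mul_assoc, mul_inv_cancel₀ h, one_mul, schurStep]

/-- The error is -ζ(S - kζ), one order better than `near_zero`. Second order is what the sum rule
needs, since it reads off the ζ²-coefficient of log(M/ζ). -/
theorem HerglotzFamily.norm_schurCorrection_sub_le (hS : HerglotzFamily k S) :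
    ∃ C r : ℝ, 0 ≤ C ∧ 0 < r ∧ ∀ ε ∈ Icc (0 : ℝ) 1, ∀ ζ : ℂ, ζ ≠ 0 → ‖ζ‖ ≤ r →
      ‖schurCorrection v S ε ζ - ((v - ε * I) * ζ + (1 - k) * ζ ^ 2)‖ ≤ C * ‖ζ‖ ^ 3 := by
  obtain ⟨C, r, hC, hr, h⟩ := hS.near_zero
  refine ⟨C, r, hC, hr, fun ε hε ζ h0 hζ => ?_⟩
  have : schurCorrection v S ε ζ - ((v - ε * I) * ζ + (1 - k) * ζ ^ 2) =
      -(ζ * (S ε ζ - k * ζ)) := by rw [schurCorrection]; ring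
  rw [this, norm_neg, norm_mul]
  calc _ ≤ ‖ζ‖ * (C * ‖ζ‖ ^ 2) := by gcongr; exact h ε hε ζ h0 hζ
    _ = _ := by ring

theorem HerglotzFamily.norm_schurCorrection_le (hS : HerglotzFamily k S) :
    ∃ C r : ℝ, 0 ≤ C ∧ 0 < r ∧ ∀ ε ∈ Icc (0 : ℝ) 1, ∀ ζ : ℂ, ζ ≠ 0 → ‖ζ‖ ≤ r →
      ‖schurCorrection v S ε ζ‖ ≤ C * ‖ζ‖ := by
  obtain ⟨C, r, hC, hr, h⟩ := hS.norm_schurCorrection_sub_le v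
  refine ⟨C + (|v| + 1) + |1 - k|, min r 1, by positivity, by positivity, fun ε hε ζ h0 hζ => ?_⟩
  have h1 := h ε hε ζ h0 (hζ.trans (min_le_left _ _))
  have z1 : ‖ζ‖ ≤ 1 := hζ.trans (min_le_right _ _)
  have z0 := norm_nonneg ζ
  have e1 : ‖(v - ε * I : ℂ)‖ ≤ |v| + 1 := by
    refine (norm_sub_le _ _).trans ?_
    simp [abs_of_nonneg hε.1, hε.2]
  have e2 : ‖(v - ε * I : ℂ) * ζ‖ ≤ (|v| + 1) * ‖ζ‖ := by rw [norm_mul]; gcongr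
  have e3 : ‖((1 : ℂ) - k) * ζ ^ 2‖ ≤ |1 - k| * ‖ζ‖ := by
    rw [norm_mul, norm_pow]
    have : ‖(1 : ℂ) - k‖ = |1 - k| := by rw [← ofReal_one, ← ofReal_sub, norm_real, Real.norm_eq_abs]
    rw [this]; gcongr; nlinarith
  have e4 : C * ‖ζ‖ ^ 3 ≤ C * ‖ζ‖ := by
    gcongr
    exact pow_le_of_le_one z0 z1 (by norm_num)
  calc _ = ‖(schurCorrection v S ε ζ - ((v - ε * I) * ζ + (1 - k) * ζ ^ 2)) +
        ((v - ε * I) * ζ + (1 - k) * ζ ^ 2)‖ := by rw [sub_add_cancel]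
    _ ≤ _ := (norm_add_le _ _).trans (add_le_add h1 (norm_add_le _ _))
    _ ≤ _ := by linarith

theorem norm_inv_one_add_sub_one_le {w : ℂ} (h : ‖w‖ ≤ 1 / 2) : ‖(1 + w)⁻¹ - 1‖ ≤ 2 * ‖w‖ := by
  have h1 : 1 / 2 ≤ ‖1 + w‖ := by
    have := norm_sub_norm_le (1 : ℂ) (-w)
    simp at this; linarith
  have h0 : (1 : ℂ) + w ≠ 0 := norm_pos_iff.1 (by linarith)
  have : (1 + w)⁻¹ - 1 = -(w / (1 + w)) := by field_simp; ring
  rw [this, norm_neg, norm_div, div_le_iff₀ (by linarith)]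
  nlinarith [norm_nonneg w]

/-- Near the origin ζ⁻¹ dominates the denominator, so the slope of the result is 1 whatever the
slope k of S. This makes the step iterable. -/
theorem HerglotzFamily.schurStep (hS : HerglotzFamily k S) : HerglotzFamily 1 (schurStep v S) where
  im_nonneg ε hε ζ h := (hS.im_schurStep_pos v hε h).le
  continuousOn ε hε := by
    refine ContinuousOn.inv₀ ?_ fun ζ h h0 => ?_
    · refine ((((continuousOn_inv₀.mono fun ζ h => h.1).add continuousOn_id).add
        continuousOn_const).sub continuousOn_const).sub (hS.continuousOn ε hε)
    · have := hS.denominator_im_neg v hε h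
      rw [h0] at this; simp at this
  differentiableOn ε hε := by
    have hne : ∀ ζ ∈ openHalfDisc, ζ ≠ 0 := fun ζ h h0 => by
      have := h.2; rw [h0] at this; simp at this
    refine DifferentiableOn.inv ?_ fun ζ h h0 => ?_
    · refine ((((differentiableOn_inv.mono fun ζ h => hne ζ h).add differentiableOn_id).add
        (differentiableOn_const _)).sub (differentiableOn_const _)).sub (hS.differentiableOn ε hε)
    · have := hS.denominator_im_neg v hε (ζ := ζ) ⟨hne ζ h, h.1.le, h.2.le⟩
      rw [h0] at this; simp at this
  near_zero := by
    obtain ⟨C, r, hC, hr, h⟩ := hS.norm_schurCorrection_le v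
    -- The second radius keeps the correction below 1/2, as `norm_inv_one_add_sub_one_le` requires.
    refine ⟨2 * C, min r (1 / (2 * (C + 1))), by positivity, by positivity, fun ε hε ζ h0 hζ => ?_⟩
    have h1 := h ε hε ζ h0 (hζ.trans (min_le_left _ _))
    have h2 : ‖ζ‖ ≤ 1 / (2 * (C + 1)) := hζ.trans (min_le_right _ _)
    rw [le_div_iff₀ (by positivity)] at h2
    have z0 := norm_nonneg ζ
    have h3 := norm_inv_one_add_sub_one_le (w := schurCorrection v S ε ζ) (by nlinarith)
    rw [schurStep_eq_div v ε h0, ofReal_one, one_mul]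
    calc _ = ‖ζ * ((1 + schurCorrection v S ε ζ)⁻¹ - 1)‖ := by rw [mul_sub, mul_one]
      _ ≤ ‖ζ‖ * (2 * (C * ‖ζ‖)) := by rw [norm_mul]; gcongr; linarith
      _ = _ := by ring
  tendsto_arc θ hθ := by
    have h0 : (0 : ℝ) ∈ Icc (0 : ℝ) 1 := ⟨le_rfl, zero_le_one⟩
    refine Tendsto.inv₀ ?_ fun h => ?_
    · refine Tendsto.sub (tendsto_const_nhds.sub ?_) (hS.tendsto_arc θ hθ)
      exact ((continuous_ofReal.tendsto 0).mono_left nhdsWithin_le_nhds).mul tendsto_const_nhds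
    · have := hS.denominator_arc_im_neg v h0 hθ
      rw [h] at this; simp at this
  arc_bounds := by
    obtain ⟨c, C, K, hc, hC, h⟩ := hS.arc_bounds
    -- With s = sin^K θ the denominator D satisfies -Im D ≥ c s and |D| s ≤ 3 + |v| + C, where 3
    -- bounds |2 cos θ| + ε. Then Im D⁻¹ = -Im D/|D|² is at least a multiple of s³, whence the
    -- exponent 3K.
    refine ⟨c / (3 + |v| + C) ^ 2, 1 / c, 3 * K, by positivity, by positivity,
      fun ε hε θ hθ => ?_⟩
    obtain ⟨a, b⟩ := h ε hε θ hθ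
    have hneg := hS.denominator_arc_im_neg v hε hθ
    have s0 := Real.sin_pos_of_mem_Ioo hθ
    have s1 := Real.sin_le_one θ
    set s := Real.sin θ ^ K with hs
    have hs0 : 0 < s := pow_pos s0 _
    have hs1 : s ≤ 1 := pow_le_one₀ s0.le s1
    have h3 : Real.sin θ ^ (3 * K) = s ^ 3 := by rw [hs, ← pow_mul, mul_comm]
    rw [h3, _root_.schurStep]
    set D := (exp (θ * I))⁻¹ + exp (θ * I) + v - ε * I - S ε (exp (θ * I)) with hD
    have hDim : c * s ≤ -D.im := by
      rw [hD, schurStep_denominator_im, inv_add_self_arc, ofReal_im]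
      linarith [hε.1]
    have hDn : ‖D‖ * s ≤ 3 + |v| + C := by
      have e : ‖D‖ ≤ 3 + |v| + ‖S ε (exp (θ * I))‖ := by
        rw [hD, inv_add_self_arc]
        refine (norm_sub_le _ _).trans (add_le_add_left ((norm_sub_le _ _).trans ?_) _)
        have e1 : ‖((2 * Real.cos θ : ℝ) : ℂ) + v‖ ≤ 2 + |v| := by
          refine (norm_add_le _ _).trans ?_
          rw [norm_real, norm_real, Real.norm_eq_abs, Real.norm_eq_abs, abs_mul]
          have := Real.abs_cos_le_one θ
          norm_num; linarith
        have e2 : ‖(ε : ℂ) * I‖ ≤ 1 := by simp [abs_of_nonneg hε.1, hε.2]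
        linarith
      calc _ ≤ (3 + |v| + ‖S ε (exp (θ * I))‖) * s := by gcongr
        _ = (3 + |v|) * s + ‖S ε (exp (θ * I))‖ * s := by ring
        _ ≤ (3 + |v|) * 1 + C := by gcongr
        _ = _ := by ring
    have hDp : 0 < ‖D‖ := norm_pos_iff.2 fun h0 => by rw [h0] at hneg; simp at hneg
    have hDl : c * s ≤ ‖D‖ := hDim.trans ((neg_le_abs _).trans (abs_im_le_norm D))
    have hDi : 0 ≤ -D.im := by linarith
    constructor
    · rw [inv_im, normSq_eq_norm_sq, le_div_iff₀ (by positivity), div_mul_eq_mul_div,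
        div_mul_eq_mul_div, div_le_iff₀ (by positivity)]
      calc c * s ^ 3 * ‖D‖ ^ 2 = (c * s) * (‖D‖ * s) ^ 2 := by ring
        _ ≤ -D.im * (3 + |v| + C) ^ 2 := by gcongr
    · rw [norm_inv, inv_mul_le_iff₀ hDp, mul_one_div, le_div_iff₀ hc]
      calc s ^ 3 * c = s ^ 2 * (c * s) := by ring
        _ ≤ 1 * ‖D‖ := by gcongr; exact pow_le_one₀ hs0.le hs1
        _ = _ := one_mul _
  continuousAt_arc θ hθ := by
    have h0 : (0 : ℝ) ∈ Icc (0 : ℝ) 1 := ⟨le_rfl, zero_le_one⟩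
    refine ContinuousAt.inv₀ ?_ fun h => ?_
    · exact ((((continuousAt_inv₀ (exp_ne_zero _)).add continuousAt_id).add
        continuousAt_const).sub continuousAt_const).sub (hS.continuousAt_arc θ hθ)
    · have := hS.denominator_arc_im_neg v h0 hθ
      simp only [ofReal_zero] at this h
      rw [h] at this; simp at this

end Step

end HerglotzFamilies

/-! ### The contour integral behind the sum rule. -/

noncomputable section EntropyStep

open Complex Filter Topology

variable {k : ℝ} {S : ℝ → ℂ → ℂ} (v : ℝ)

/-- The integrand of the contour integral, in the coordinate `w` with `ζ = exp (i w)`. -/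
def contourIntegrand (v : ℝ) (S : ℝ → ℂ → ℂ) (ε : ℝ) (w : ℂ) : ℂ :=
  (log (schurStep v S ε (exp (w * I))) - w * I) * (2 * sin w ^ 2)

theorem norm_exp_mul_I (w : ℂ) : ‖exp (w * I)‖ = Real.exp (-w.im) := by
  simp [norm_exp]

theorem im_exp_mul_I (w : ℂ) : (exp (w * I)).im = Real.exp (-w.im) * Real.sin w.re := by
  simp [exp_im]

theorem exp_mul_I_mem_halfDisc {w : ℂ} (h : w ∈ Icc 0 Real.pi ×ℂ Ici 0) :
    exp (w * I) ∈ halfDisc := by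
  obtain ⟨h1, h2⟩ := h
  refine ⟨exp_ne_zero _, ?_, ?_⟩
  · rw [norm_exp_mul_I]
    exact Real.exp_le_one_iff.2 (by simpa using h2)
  · rw [im_exp_mul_I]
    exact mul_nonneg (Real.exp_pos _).le (Real.sin_nonneg_of_mem_Icc h1)

theorem exp_mul_I_mem_openHalfDisc {w : ℂ} (h : w ∈ Ioo 0 Real.pi ×ℂ Ioi 0) :
    exp (w * I) ∈ openHalfDisc := by
  obtain ⟨h1, h2⟩ := h
  refine ⟨?_, ?_⟩
  · rw [norm_exp_mul_I]
    exact Real.exp_lt_one_iff.2 (by simpa using h2)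
  · rw [im_exp_mul_I]
    exact mul_pos (Real.exp_pos _) (Real.sin_pos_of_mem_Ioo h1)

theorem HerglotzFamily.continuousOn_contourIntegrand (hS : HerglotzFamily k S) {ε : ℝ}
    (hε : ε ∈ Ioc (0 : ℝ) 1) :
    ContinuousOn (contourIntegrand v S ε) (Icc 0 Real.pi ×ℂ Ici 0) := by
  have h1 : Continuous fun w : ℂ => exp (w * I) := by fun_prop
  have h2 : ContinuousOn (fun w : ℂ => _root_.schurStep v S ε (exp (w * I)))
      (Icc 0 Real.pi ×ℂ Ici 0) :=
    ((hS.schurStep v).continuousOn ε hε).comp h1.continuousOn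
      fun w hw => exp_mul_I_mem_halfDisc hw
  refine ((h2.clog fun w hw => ?_).sub (by fun_prop)).mul (by fun_prop)
  exact Or.inr (hS.im_schurStep_pos v hε (exp_mul_I_mem_halfDisc hw)).ne'

theorem HerglotzFamily.differentiableOn_contourIntegrand (hS : HerglotzFamily k S) {ε : ℝ}
    (hε : ε ∈ Ioc (0 : ℝ) 1) :
    DifferentiableOn ℂ (contourIntegrand v S ε) (Ioo 0 Real.pi ×ℂ Ioi 0) := by
  have h1 : Differentiable ℂ fun w : ℂ => exp (w * I) := by fun_prop
  have h2 : DifferentiableOn ℂ (fun w : ℂ => _root_.schurStep v S ε (exp (w * I)))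
      (Ioo 0 Real.pi ×ℂ Ioi 0) :=
    ((hS.schurStep v).differentiableOn ε hε).comp h1.differentiableOn
      fun w hw => exp_mul_I_mem_openHalfDisc hw
  refine ((h2.clog fun w hw => ?_).sub (by fun_prop)).mul (by fun_prop)
  refine Or.inr (hS.im_schurStep_pos v hε (exp_mul_I_mem_halfDisc ?_)).ne'
  exact ⟨Ioo_subset_Icc_self hw.1, mem_preimage.2 (Ioi_subset_Ici_self hw.2)⟩

/-- Cauchy's theorem on [0, π] × [0, T]. On the vertical sides sin²w = -sinh²y is real and
nonpositive, and Im(log M - iw) = arg M - Re w is nonnegative on the left and nonpositive on the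
right because arg M lies in [0, π]. Both sides therefore push in the same direction. On the bottom,
iw is purely imaginary, which leaves log|M|. -/
theorem HerglotzFamily.integral_top_le_bottom (hS : HerglotzFamily k S) {ε : ℝ}
    (hε : ε ∈ Ioc (0 : ℝ) 1) {T : ℝ} (hT : 0 ≤ T) :
    ∫ x in (0 : ℝ)..Real.pi, (contourIntegrand v S ε (x + T * I)).re ≤
      ∫ x in (0 : ℝ)..Real.pi, Real.log ‖_root_.schurStep v S ε (exp (x * I))‖ *
        (2 * Real.sin x ^ 2) := by
  set f := contourIntegrand v S ε with hf
  have hc := hS.continuousOn_contourIntegrand v hε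
  have hd := hS.differentiableOn_contourIntegrand v hε
  have hpi := Real.pi_pos.le
  have key := integral_boundary_rect_eq_zero_of_continuousOn_of_differentiableOn f 0
    (Real.pi + T * I) (hc.mono ?_) (hd.mono ?_)
  rotate_left
  · simp only [zero_re, add_re, ofReal_re, mul_re, I_re, mul_zero, ofReal_im, I_im, mul_one, sub_self,
      add_zero, zero_im, add_im, mul_im, zero_add, uIcc_of_le hpi, uIcc_of_le hT]
    exact fun w hw => ⟨hw.1, hw.2.1⟩
  · simp only [zero_re, add_re, ofReal_re, mul_re, I_re, mul_zero, ofReal_im, I_im, mul_one, sub_self,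
      add_zero, zero_im, add_im, mul_im, zero_add, min_eq_left hpi, max_eq_right hpi,
      min_eq_left hT]
    exact fun w hw => ⟨hw.1, hw.2.1⟩
  simp only [zero_re, add_re, ofReal_re, mul_re, I_re, mul_zero, ofReal_im, I_im, mul_one, sub_self,
      add_zero, zero_im, add_im, mul_im, zero_add, ofReal_zero, zero_mul, smul_eq_mul] at key
  have i1 : IntervalIntegrable (fun x : ℝ => f x) volume 0 Real.pi := by
    refine ContinuousOn.intervalIntegrable (hc.comp (by fun_prop) fun x hx => ?_)
    rw [uIcc_of_le hpi] at hx
    exact ⟨by simpa using hx, by simp⟩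
  have i2 : IntervalIntegrable (fun x : ℝ => f (x + T * I)) volume 0 Real.pi := by
    refine ContinuousOn.intervalIntegrable (hc.comp (by fun_prop) fun x hx => ?_)
    rw [uIcc_of_le hpi] at hx
    exact ⟨by simpa using hx, by simpa using hT⟩
  have i3 : IntervalIntegrable (fun y : ℝ => f (Real.pi + y * I)) volume 0 T := by
    refine ContinuousOn.intervalIntegrable (hc.comp (by fun_prop) fun x hx => ?_)
    rw [uIcc_of_le hT] at hx
    exact ⟨by simpa using hpi, by simpa using hx.1⟩
  have i4 : IntervalIntegrable (fun y : ℝ => f (y * I)) volume 0 T := by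
    refine ContinuousOn.intervalIntegrable (hc.comp (by fun_prop) fun x hx => ?_)
    rw [uIcc_of_le hT] at hx
    exact ⟨by simpa using hpi, by simpa using hx.1⟩
  have key2 := congrArg re key
  simp only [sub_re, add_re, mul_re, I_re, zero_mul, I_im, one_mul, zero_sub, zero_re] at key2
  have r1 := reCLM.intervalIntegral_comp_comm i1
  have r2 := reCLM.intervalIntegral_comp_comm i2
  have r3 := imCLM.intervalIntegral_comp_comm i3
  have r4 := imCLM.intervalIntegral_comp_comm i4
  simp only [reCLM_apply, imCLM_apply] at r1 r2 r3 r4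
  rw [← r1, ← r2, ← r3, ← r4] at key2
  have s3 : 0 ≤ ∫ y in (0 : ℝ)..T, (f (Real.pi + y * I)).im := by
    refine intervalIntegral.integral_nonneg hT fun y hy => ?_
    have hm : exp (((Real.pi : ℂ) + y * I) * I) ∈ halfDisc :=
      exp_mul_I_mem_halfDisc ⟨by simpa using hpi, by simpa using hy.1⟩
    have e : sin ((Real.pi : ℂ) + y * I) ^ 2 = ((-(Real.sinh y ^ 2) : ℝ) : ℂ) := by
      rw [add_comm, sin_add_pi, sin_mul_I]; push_cast; ring_nf; rw [I_sq]; ring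
    rw [hf, contourIntegrand, e]
    have e2 : (2 : ℂ) * ((-(Real.sinh y ^ 2) : ℝ) : ℂ) = ((-(2 * Real.sinh y ^ 2) : ℝ) : ℂ) := by
      push_cast; ring
    rw [e2, im_mul_ofReal, sub_im, log_im]
    have := arg_le_pi (_root_.schurStep v S ε (exp (((Real.pi : ℂ) + y * I) * I)))
    have e3 : (((Real.pi : ℂ) + y * I) * I).im = Real.pi := by simp
    rw [e3]
    nlinarith [sq_nonneg (Real.sinh y)]
  have s4 : ∫ y in (0 : ℝ)..T, (f (y * I)).im ≤ 0 := by
    rw [← neg_nonneg, ← intervalIntegral.integral_neg]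
    refine intervalIntegral.integral_nonneg hT fun y hy => ?_
    have hm : exp (((y : ℂ) * I) * I) ∈ halfDisc :=
      exp_mul_I_mem_halfDisc ⟨by simpa using hpi, by simpa using hy.1⟩
    have e : sin ((y : ℂ) * I) ^ 2 = ((-(Real.sinh y ^ 2) : ℝ) : ℂ) := by
      rw [sin_mul_I]; push_cast; ring_nf; rw [I_sq]; ring
    rw [hf, contourIntegrand, e]
    have e2 : (2 : ℂ) * ((-(Real.sinh y ^ 2) : ℝ) : ℂ) = ((-(2 * Real.sinh y ^ 2) : ℝ) : ℂ) := by
      push_cast; ring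
    rw [e2, im_mul_ofReal, sub_im, log_im]
    have := arg_nonneg_iff.2 (hS.im_schurStep_pos v hε hm).le
    have e3 : (((y : ℂ) * I) * I).im = 0 := by simp
    rw [e3]
    nlinarith [sq_nonneg (Real.sinh y)]
  have s1 : ∫ x in (0 : ℝ)..Real.pi, (f x).re =
      ∫ x in (0 : ℝ)..Real.pi, Real.log ‖_root_.schurStep v S ε (exp (x * I))‖ *
        (2 * Real.sin x ^ 2) := by
    refine intervalIntegral.integral_congr fun x _ => ?_
    have e2 : (2 : ℂ) * sin (x : ℂ) ^ 2 = ((2 * Real.sin x ^ 2 : ℝ) : ℂ) := by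
      push_cast; ring
    rw [hf, contourIntegrand, e2, re_mul_ofReal, sub_re, log_re]
    simp
  rw [← s1]
  linarith

/-- Exponentiating, the two sides can differ only by 2πin. Since arg M and Re w lie in [0, π] and
|arg(1 + q)| < π/2, the discrepancy is below 3π/2 in absolute value, so n = 0. -/
theorem HerglotzFamily.log_schurStep (hS : HerglotzFamily k S) {ε : ℝ}
    (hε : ε ∈ Ioc (0 : ℝ) 1) {w : ℂ} (hw : w ∈ Icc 0 Real.pi ×ℂ Ici 0)
    (hq : ‖schurCorrection v S ε (exp (w * I))‖ < 1) :
    log (_root_.schurStep v S ε (exp (w * I))) - w * I =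
      -log (1 + schurCorrection v S ε (exp (w * I))) := by
  set q := schurCorrection v S ε (exp (w * I)) with hqdef
  have hm := exp_mul_I_mem_halfDisc hw
  have hM := hS.im_schurStep_pos v hε hm
  have hMe := schurStep_eq_div v (S := S) ε (exp_ne_zero (w * I))
  rw [← hqdef] at hMe
  set M := _root_.schurStep v S ε (exp (w * I)) with hMdef
  have hre : 0 < (1 + q).re := by
    rw [add_re, one_re]
    have := (abs_le.1 (abs_re_le_norm q)).1
    linarith
  have hq0 : 1 + q ≠ 0 := fun h => by rw [h] at hre; simp at hre
  have hM0 : M ≠ 0 := fun h => by rw [h] at hM; simp at hM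
  have hexp : exp (log M) = exp (w * I - log (1 + q)) := by
    rw [exp_log hM0, exp_sub, exp_log hq0, hMe, div_eq_mul_inv]
  obtain ⟨n, hn⟩ := exp_eq_exp_iff_exists_int.1 hexp
  have him := congrArg im hn
  have e1 : (w * I).im = w.re := by simp
  have e2 : ((n : ℂ) * (2 * Real.pi * I)).im = n * (2 * Real.pi) := by simp
  rw [add_im, sub_im, log_im, log_im, e1, e2] at him
  have a1 := arg_le_pi M
  have a2 := arg_nonneg_iff.2 hM.le
  have a3 := abs_lt.1 (abs_arg_lt_pi_div_two_iff.2 (Or.inl hre))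
  have a4 : 0 ≤ w.re := hw.1.1
  have a5 : w.re ≤ Real.pi := hw.1.2
  have hpi := Real.pi_pos
  have n1 : (n : ℝ) < 1 := by nlinarith [a3.1, a3.2]
  have n2 : (-1 : ℝ) < n := by nlinarith [a3.1, a3.2]
  have n0 : n = 0 := by
    have h1 : n < 1 := by exact_mod_cast n1
    have h2 : -1 < n := by exact_mod_cast n2
    omega
  rw [hn, n0]; push_cast; ring

/-- Insert q = cζ + (1 - k)ζ² + O(ζ³), with c = v - iε, into -log(1 + q) = -q + q²/2 + O(q³). -/
theorem HerglotzFamily.norm_log_correction_le (hS : HerglotzFamily k S) :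
    ∃ C r : ℝ, 0 ≤ C ∧ 0 < r ∧ r ≤ 1 ∧ ∀ ε ∈ Icc (0 : ℝ) 1, ∀ ζ : ℂ, ζ ≠ 0 → ‖ζ‖ ≤ r →
      ‖schurCorrection v S ε ζ‖ < 1 ∧
      ‖-log (1 + schurCorrection v S ε ζ) -
        (-(v - ε * I) * ζ + ((v - ε * I) ^ 2 / 2 + k - 1) * ζ ^ 2)‖ ≤ C * ‖ζ‖ ^ 3 := by
  obtain ⟨C₁, r₁, hC₁, hr₁, h₁⟩ := hS.norm_schurCorrection_sub_le v
  obtain ⟨C₂, r₂, hC₂, hr₂, h₂⟩ := hS.norm_schurCorrection_le v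
  -- The three summands bound the error in q, the Taylor remainder |q|³, and q² - (cζ)² = (q - cζ)(q
  -- + cζ).
  refine ⟨C₁ + C₂ ^ 3 + (|1 - k| + C₁) * (C₂ + (|v| + 1)), min (min r₁ r₂) (1 / (2 * (C₂ + 1))),
    by positivity, by positivity, ?_, fun ε hε ζ h0 hζ => ?_⟩
  · refine (min_le_right _ _).trans ((div_le_one (by positivity)).2 (by linarith))
  have q1 := h₁ ε hε ζ h0 (hζ.trans ((min_le_left _ _).trans (min_le_left _ _)))
  have q2 := h₂ ε hε ζ h0 (hζ.trans ((min_le_left _ _).trans (min_le_right _ _)))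
  have z2 : ‖ζ‖ ≤ 1 / (2 * (C₂ + 1)) := hζ.trans (min_le_right _ _)
  rw [le_div_iff₀ (by positivity)] at z2
  have z0 := norm_nonneg ζ
  have z1 : ‖ζ‖ ≤ 1 := by nlinarith
  set q := schurCorrection v S ε ζ
  set c : ℂ := v - ε * I with hc
  have qh : ‖q‖ ≤ 1 / 2 := by nlinarith
  have c1 : ‖c‖ ≤ |v| + 1 := by
    refine (norm_sub_le _ _).trans ?_
    simp [abs_of_nonneg hε.1, hε.2]
  refine ⟨by linarith, ?_⟩
  have t := norm_log_sub_logTaylor_le 2 (z := q) (by linarith)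
  have t2 : ‖log (1 + q) - (q - q ^ 2 / 2)‖ ≤ ‖q‖ ^ 3 := by
    have e : logTaylor (2 + 1) q = q - q ^ 2 / 2 := by
      simp [logTaylor_succ, logTaylor_zero]; ring
    rw [e] at t
    refine t.trans ?_
    have : (1 - ‖q‖)⁻¹ ≤ 2 := by
      rw [inv_le_comm₀ (by linarith) (by norm_num)]; linarith
    have p : 0 ≤ ‖q‖ ^ 3 := by positivity
    norm_num
    nlinarith
  have t3 : ‖q ^ 2 - (c * ζ) ^ 2‖ ≤ (|1 - k| + C₁) * (C₂ + (|v| + 1)) * ‖ζ‖ ^ 3 := by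
    have e1 : ‖q - c * ζ‖ ≤ (|1 - k| + C₁) * ‖ζ‖ ^ 2 := by
      have : ‖(1 : ℂ) - k‖ = |1 - k| := by
        rw [← ofReal_one, ← ofReal_sub, norm_real, Real.norm_eq_abs]
      calc ‖q - c * ζ‖ = ‖(q - (c * ζ + (1 - k) * ζ ^ 2)) + (1 - k) * ζ ^ 2‖ := by congr 1; ring
        _ ≤ C₁ * ‖ζ‖ ^ 3 + |1 - k| * ‖ζ‖ ^ 2 := by
            refine (norm_add_le _ _).trans (add_le_add q1 ?_)
            rw [norm_mul, norm_pow, this]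
        _ ≤ C₁ * ‖ζ‖ ^ 2 + |1 - k| * ‖ζ‖ ^ 2 := by
            have : ‖ζ‖ ^ 3 ≤ ‖ζ‖ ^ 2 := pow_le_pow_of_le_one z0 z1 (by norm_num)
            gcongr
        _ = _ := by ring
    have e2 : ‖q + c * ζ‖ ≤ (C₂ + (|v| + 1)) * ‖ζ‖ := by
      refine (norm_add_le _ _).trans ?_
      rw [norm_mul, add_mul]
      gcongr
    calc ‖q ^ 2 - (c * ζ) ^ 2‖ = ‖q - c * ζ‖ * ‖q + c * ζ‖ := by rw [← norm_mul]; congr 1; ring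
      _ ≤ ((|1 - k| + C₁) * ‖ζ‖ ^ 2) * ((C₂ + (|v| + 1)) * ‖ζ‖) := by gcongr
      _ = _ := by ring
  have t4 : ‖q‖ ^ 3 ≤ C₂ ^ 3 * ‖ζ‖ ^ 3 := by rw [← mul_pow]; gcongr
  calc _ = ‖-(log (1 + q) - (q - q ^ 2 / 2)) + (-(q - (c * ζ + (1 - k) * ζ ^ 2)) +
        (q ^ 2 - (c * ζ) ^ 2) / 2)‖ := by congr 1; ring
    _ ≤ ‖q‖ ^ 3 + (C₁ * ‖ζ‖ ^ 3 + (|1 - k| + C₁) * (C₂ + (|v| + 1)) * ‖ζ‖ ^ 3) := by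
        refine (norm_add_le _ _).trans (add_le_add (by rwa [norm_neg])
          ((norm_add_le _ _).trans (add_le_add (by rwa [norm_neg]) ?_)))
        rw [norm_div, RCLike.norm_ofNat]
        have := norm_nonneg (q ^ 2 - (c * ζ) ^ 2)
        linarith
    _ ≤ _ := by linarith

/-- In the variable ζ the weight has the term -ζ⁻²/2, which extracts the ζ²-coefficient of log(M/ζ)
on a small circle. -/
theorem two_sin_sq_eq (w : ℂ) :
    2 * sin w ^ 2 = 1 - exp (w * I) ^ 2 / 2 - (exp (w * I))⁻¹ ^ 2 / 2 := by
  have h : exp (w * I) * (exp (w * I))⁻¹ = 1 := mul_inv_cancel₀ (exp_ne_zero _)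
  rw [sin, neg_mul, exp_neg]
  have : (I : ℂ) ^ 2 = -1 := I_sq
  linear_combination ((exp (w * I))⁻¹ - exp (w * I)) ^ 2 / 2 * this + h

/-- With r = exp(-T) = |ζ|, the product of -cζ + bζ² and -ζ⁻²/2 is cζ⁻¹/2 - b/2; everything else is
O(r). The singular term v cos θ/(2r) is kept because it integrates to zero over [0, π], and ε/(2r)
disappears when ε → 0 at fixed r. -/
theorem HerglotzFamily.re_contourIntegrand_ge (hS : HerglotzFamily k S) :
    ∃ C r₀ : ℝ, 0 ≤ C ∧ 0 < r₀ ∧ r₀ ≤ 1 ∧ ∀ ε ∈ Ioc (0 : ℝ) 1, ∀ T : ℝ, Real.exp (-T) ≤ r₀ →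
      ∀ θ ∈ Icc 0 Real.pi,
        -(v ^ 2 / 2 + k - 1) / 2 + v * Real.cos θ / (2 * Real.exp (-T)) -
          ε / (2 * Real.exp (-T)) - C * Real.exp (-T) ≤
        (contourIntegrand v S ε (θ + T * I)).re := by
  obtain ⟨C, r₀, hC, hr, hr1, h⟩ := hS.norm_log_correction_le v
  set B : ℝ := (|v| + 1) ^ 2 / 2 + |k - 1| with hB
  refine ⟨2 * C + 2 * (|v| + 1 + B), r₀, by positivity, hr, hr1, fun ε hε T hT θ hθ => ?_⟩
  set w : ℂ := θ + T * I with hw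
  have hT0 : 0 ≤ T := by
    have := hT.trans hr1
    simpa using Real.exp_le_one_iff.1 this
  have hwm : w ∈ Icc 0 Real.pi ×ℂ Ici 0 := ⟨by simpa [hw] using hθ, by simpa [hw] using hT0⟩
  have hwim : w.im = T := by simp [hw]
  have hwre : w.re = θ := by simp [hw]
  have hn : ‖exp (w * I)‖ = Real.exp (-T) := by rw [norm_exp_mul_I, hwim]
  obtain ⟨hq, hL⟩ := h ε (Ioc_subset_Icc_self hε) _ (exp_ne_zero (w * I)) (hn.trans_le hT)
  rw [contourIntegrand, hS.log_schurStep v hε hwm hq, two_sin_sq_eq]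
  have hζ0 := exp_ne_zero (w * I)
  have hinv : ((exp (w * I))⁻¹).re = Real.cos θ / Real.exp (-T) ∧
      ((exp (w * I))⁻¹).im = -Real.sin θ / Real.exp (-T) := by
    rw [← exp_neg, exp_re, exp_im]
    simp [hwim, hwre, Real.exp_neg]
    constructor <;> ring
  set ζ := exp (w * I)
  set r := Real.exp (-T) with hrdef
  have r0 : 0 < r := Real.exp_pos _
  have r1 : r ≤ 1 := hT.trans hr1
  set c : ℂ := v - ε * I with hc
  set L := -log (1 + schurCorrection v S ε ζ)
  set b : ℂ := c ^ 2 / 2 + k - 1 with hb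
  set E := L - (-c * ζ + b * ζ ^ 2) with hE
  have c1 : ‖c‖ ≤ |v| + 1 := by
    refine (norm_sub_le _ _).trans ?_
    simp [abs_of_nonneg hε.1.le, hε.2]
  have b1 : ‖b‖ ≤ B := by
    have : b = c ^ 2 / 2 + ((k - 1 : ℝ) : ℂ) := by rw [hb]; push_cast; ring
    rw [this]
    refine (norm_add_le _ _).trans ?_
    rw [norm_div, norm_pow, RCLike.norm_ofNat, norm_real, Real.norm_eq_abs, hB]
    gcongr
  have split : L * (1 - ζ ^ 2 / 2 - ζ⁻¹ ^ 2 / 2) = c * ζ⁻¹ / 2 - b / 2 +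
      (E * (1 - ζ ^ 2 / 2 - ζ⁻¹ ^ 2 / 2) + (-c * ζ + b * ζ ^ 2) * (1 - ζ ^ 2 / 2)) := by
    have : L = E + (-c * ζ + b * ζ ^ 2) := by rw [hE]; ring
    rw [this]; field_simp; ring
  have hR : ‖E * (1 - ζ ^ 2 / 2 - ζ⁻¹ ^ 2 / 2) + (-c * ζ + b * ζ ^ 2) * (1 - ζ ^ 2 / 2)‖ ≤
      (2 * C + 2 * (|v| + 1 + B)) * r := by
    have e1 : ‖(1 : ℂ) - ζ ^ 2 / 2‖ ≤ 3 / 2 := by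
      refine (norm_sub_le _ _).trans ?_
      rw [norm_one, norm_div, norm_pow, RCLike.norm_ofNat, hn]
      have : r ^ 2 ≤ 1 := pow_le_one₀ r0.le r1
      linarith
    have e2 : ‖ζ⁻¹ ^ 2 / 2‖ = 1 / (2 * r ^ 2) := by
      rw [norm_div, norm_pow, norm_inv, hn, RCLike.norm_ofNat]; field_simp
    have e3 : ‖(1 : ℂ) - ζ ^ 2 / 2 - ζ⁻¹ ^ 2 / 2‖ ≤ 2 / r ^ 2 := by
      refine (norm_sub_le _ _).trans ?_
      rw [e2]
      have : 3 / 2 ≤ 3 / (2 * r ^ 2) := by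
        gcongr; nlinarith [pow_le_one₀ r0.le r1 (n := 2)]
      have : 3 / (2 * r ^ 2) + 1 / (2 * r ^ 2) = 2 / r ^ 2 := by field_simp; norm_num
      linarith
    have e4 : ‖-c * ζ + b * ζ ^ 2‖ ≤ (|v| + 1 + B) * r := by
      refine (norm_add_le _ _).trans ?_
      rw [norm_mul, norm_neg, norm_mul, norm_pow, hn]
      have : r ^ 2 ≤ r := pow_le_of_le_one r0.le r1 (by norm_num)
      have B0 : 0 ≤ B := by positivity
      calc _ ≤ (|v| + 1) * r + B * r := by gcongr
        _ = _ := by ring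
    rw [hn] at hL
    calc _ ≤ (C * r ^ 3) * (2 / r ^ 2) + ((|v| + 1 + B) * r) * (3 / 2) := by
          refine (norm_add_le _ _).trans ?_
          rw [norm_mul, norm_mul]
          gcongr
      _ ≤ _ := by
          have : (C * r ^ 3) * (2 / r ^ 2) = 2 * C * r := by field_simp
          have B0 : 0 ≤ (|v| + 1 + B) * r := by positivity
          rw [this]; linarith
  rw [split, add_re]
  -- The ε² contained in Re b enters with a favorable sign and is dropped at the end.
  have hR2 := (abs_le.1 ((abs_re_le_norm _).trans hR)).1
  have m1 : (c * ζ⁻¹ / 2 - b / 2).re =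
      v * Real.cos θ / (2 * r) - ε * Real.sin θ / (2 * r) - ((v ^ 2 - ε ^ 2) / 2 + k - 1) / 2 := by
    have cre : c.re = v := by simp [hc]
    have cim : c.im = -ε := by simp [hc]
    have bre : b.re = (v ^ 2 - ε ^ 2) / 2 + k - 1 := by
      rw [hb, sub_re, add_re, div_ofNat_re, sq, mul_re, cre, cim]; simp; ring
    rw [sub_re, div_ofNat_re, div_ofNat_re, mul_re, hinv.1, hinv.2, cre, cim, bre]
    field_simp
  rw [m1]
  have s1 : ε * Real.sin θ / (2 * r) ≤ ε / (2 * r) := by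
    gcongr; exact mul_le_of_le_one_right hε.1.le (Real.sin_le_one θ)
  nlinarith [sq_nonneg ε]

end EntropyStep

/-! ### Entropy on the half circle: the sum rule and concavity. -/

noncomputable section ArcEntropy

open Complex Filter Topology

variable {k : ℝ} {S : ℝ → ℂ → ℂ} (v : ℝ)

/-- Power bounds on a cost at most K|log s|, and the weight s² absorbs this because -log s ≤ s⁻¹.
This gives the integrable majorants, uniform in ε, for the limits on the arc. -/
theorem abs_log_mul_sq_le {a c C s : ℝ} {K : ℕ} (hc : 0 < c) (hs0 : 0 < s) (hs1 : s ≤ 1)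
    (h1 : c * s ^ K ≤ a) (h2 : a * s ^ K ≤ C) :
    |Real.log a| * s ^ 2 ≤ |Real.log c| + |Real.log C| + K := by
  have hsK : 0 < s ^ K := pow_pos hs0 _
  have ha : 0 < a := lt_of_lt_of_le (by positivity) h1
  have hC : 0 < C := lt_of_lt_of_le (by positivity) h2
  have l1 := Real.log_le_log (by positivity) h1
  have l2 := Real.log_le_log (by positivity) h2
  rw [Real.log_mul hc.ne' hsK.ne', Real.log_pow] at l1
  rw [Real.log_mul ha.ne' hsK.ne', Real.log_pow] at l2
  have hls : -Real.log s ≤ s⁻¹ := by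
    have := Real.log_le_sub_one_of_pos (inv_pos.2 hs0)
    rw [Real.log_inv] at this; linarith
  have s2 : s ^ 2 ≤ 1 := pow_le_one₀ hs0.le hs1
  have hss : -Real.log s * s ^ 2 ≤ 1 := by
    calc -Real.log s * s ^ 2 ≤ s⁻¹ * s ^ 2 := by gcongr
      _ = s := by field_simp
      _ ≤ 1 := hs1
  have b : |Real.log a| ≤ |Real.log c| + |Real.log C| + K * -Real.log s := by
    have hls0 : Real.log s ≤ 0 := Real.log_nonpos hs0.le hs1
    have hk : (0 : ℝ) ≤ K * -Real.log s := mul_nonneg (Nat.cast_nonneg _) (by linarith)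
    rw [abs_le]
    constructor
    · linarith [neg_abs_le (Real.log c), abs_nonneg (Real.log C)]
    · linarith [le_abs_self (Real.log C), abs_nonneg (Real.log c)]
  calc _ ≤ (|Real.log c| + |Real.log C| + K * -Real.log s) * s ^ 2 := by gcongr
    _ = (|Real.log c| + |Real.log C|) * s ^ 2 + K * (-Real.log s * s ^ 2) := by ring
    _ ≤ (|Real.log c| + |Real.log C|) * 1 + K * 1 := by gcongr
    _ = _ := by ring

theorem HerglotzFamily.exists_log_bound (hS : HerglotzFamily k S) :
    ∃ B : ℝ, ∀ ε ∈ Icc (0 : ℝ) 1, ∀ θ ∈ Ioo 0 Real.pi,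
      |Real.log ‖S ε (exp (θ * I))‖| * Real.sin θ ^ 2 ≤ B ∧
      |Real.log (S ε (exp (θ * I))).im| * Real.sin θ ^ 2 ≤ B := by
  obtain ⟨c, C, K, hc, hC, h⟩ := hS.arc_bounds
  refine ⟨|Real.log c| + |Real.log C| + K, fun ε hε θ hθ => ?_⟩
  obtain ⟨h1, h2⟩ := h ε hε θ hθ
  have s0 := Real.sin_pos_of_mem_Ioo hθ
  have s1 := Real.sin_le_one θ
  have him : (S ε (exp (θ * I))).im ≤ ‖S ε (exp (θ * I))‖ := (le_abs_self _).trans (abs_im_le_norm _)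
  refine ⟨abs_log_mul_sq_le hc s0 s1 (h1.trans him) h2,
    abs_log_mul_sq_le hc s0 s1 h1 (le_trans ?_ h2)⟩
  gcongr

theorem intervalIntegrable_of_continuousOn_bounded {f : ℝ → ℝ} {B : ℝ}
    (hf : ContinuousOn f (Ioo 0 Real.pi)) (hB : ∀ θ ∈ Ioo 0 Real.pi, |f θ| ≤ B) :
    IntervalIntegrable f volume 0 Real.pi := by
  rw [intervalIntegrable_iff_integrableOn_Ioo_of_le Real.pi_pos.le]
  exact IntegrableOn.of_bound (by simp) (hf.aestronglyMeasurable measurableSet_Ioo) B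
    ((ae_restrict_mem measurableSet_Ioo).mono fun θ h => hB θ h)

theorem HerglotzFamily.continuousOn_arc (hS : HerglotzFamily k S) :
    ContinuousOn (fun θ : ℝ => S 0 (exp (θ * I))) (Ioo 0 Real.pi) := fun θ hθ =>
  (ContinuousAt.comp (f := fun θ : ℝ => exp (θ * I)) (hS.continuousAt_arc θ hθ)
    (by fun_prop)).continuousWithinAt

theorem zero_mem_Icc_zero_one : (0 : ℝ) ∈ Icc (0 : ℝ) 1 := ⟨le_rfl, zero_le_one⟩

theorem HerglotzFamily.arc_ne_zero (hS : HerglotzFamily k S) {ε : ℝ} (hε : ε ∈ Icc (0 : ℝ) 1)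
    {θ : ℝ} (hθ : θ ∈ Ioo 0 Real.pi) : S ε (exp (θ * I)) ≠ 0 := fun h => by
  have := hS.im_arc_pos hε hθ
  rw [h] at this; simp at this

theorem HerglotzFamily.intervalIntegrable_log_norm (hS : HerglotzFamily k S) :
    IntervalIntegrable (fun θ => Real.log ‖S 0 (exp (θ * I))‖ * (2 * Real.sin θ ^ 2))
      volume 0 Real.pi := by
  obtain ⟨B, hB⟩ := hS.exists_log_bound
  refine intervalIntegrable_of_continuousOn_bounded (B := 2 * B)
    ((hS.continuousOn_arc.norm.log fun θ hθ => ?_).mul (by fun_prop)) fun θ hθ => ?_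
  · exact norm_ne_zero_iff.2 (hS.arc_ne_zero zero_mem_Icc_zero_one hθ)
  · have := (hB 0 zero_mem_Icc_zero_one θ hθ).1
    rw [abs_mul, abs_of_nonneg (a := 2 * Real.sin θ ^ 2) (by positivity)]
    linarith

theorem HerglotzFamily.intervalIntegrable_log_im (hS : HerglotzFamily k S) :
    IntervalIntegrable (fun θ => Real.log ((S 0 (exp (θ * I))).im / Real.sin θ) * Real.sin θ ^ 2)
      volume 0 Real.pi := by
  obtain ⟨B, hB⟩ := hS.exists_log_bound
  obtain ⟨B', hB'⟩ := HerglotzFamily.id.exists_log_bound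
  refine intervalIntegrable_of_continuousOn_bounded (B := B + B')
    ((((continuous_im.comp_continuousOn hS.continuousOn_arc).div (by fun_prop) fun θ hθ => ?_).log
      fun θ hθ => ?_).mul (by fun_prop)) fun θ hθ => ?_
  · exact (Real.sin_pos_of_mem_Ioo hθ).ne'
  · exact (div_pos (hS.im_arc_pos zero_mem_Icc_zero_one hθ) (Real.sin_pos_of_mem_Ioo hθ)).ne'
  · have b := (hB 0 zero_mem_Icc_zero_one θ hθ).2
    have b' := (hB' 0 zero_mem_Icc_zero_one θ hθ).2
    rw [exp_ofReal_mul_I_im] at b'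
    rw [Real.log_div (hS.im_arc_pos zero_mem_Icc_zero_one hθ).ne' (Real.sin_pos_of_mem_Ioo hθ).ne',
      abs_mul, abs_of_nonneg (a := Real.sin θ ^ 2) (by positivity)]
    calc _ ≤ (|Real.log (S 0 (exp (θ * I))).im| + |Real.log (Real.sin θ)|) * Real.sin θ ^ 2 := by
          gcongr; exact abs_sub _ _
      _ ≤ _ := by linarith

/-- The step-by-step sum rule, as an inequality. -/
theorem HerglotzFamily.integral_log_norm_schurStep_ge (hS : HerglotzFamily k S) :
    -(Real.pi / 2 * (v ^ 2 / 2 + k - 1)) ≤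
      ∫ x in (0 : ℝ)..Real.pi, Real.log ‖_root_.schurStep v S 0 (exp (x * I))‖ *
        (2 * Real.sin x ^ 2) := by
  have hM := hS.schurStep v
  obtain ⟨B, hB⟩ := hM.exists_log_bound
  have hpi := Real.pi_pos
  have lim : Tendsto (fun ε : ℝ => ∫ x in (0 : ℝ)..Real.pi,
      Real.log ‖_root_.schurStep v S ε (exp (x * I))‖ * (2 * Real.sin x ^ 2)) (𝓝[>] 0)
      (𝓝 (∫ x in (0 : ℝ)..Real.pi, Real.log ‖_root_.schurStep v S 0 (exp (x * I))‖ *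
        (2 * Real.sin x ^ 2))) := by
    simp_rw [intervalIntegral.integral_of_le hpi.le, integral_Ioc_eq_integral_Ioo]
    have hev : ∀ᶠ ε : ℝ in 𝓝[>] 0, ε ∈ Ioc (0 : ℝ) 1 := Ioc_mem_nhdsGT one_pos
    refine tendsto_integral_filter_of_dominated_convergence (fun _ => 2 * B) ?_ ?_ (integrable_const _) ?_
    · filter_upwards [hev] with ε hε
      refine ContinuousOn.aestronglyMeasurable ?_ measurableSet_Ioo
      refine ContinuousOn.mul (ContinuousOn.log (ContinuousOn.norm ?_) fun θ hθ => ?_) (by fun_prop)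
      · exact (hM.continuousOn ε hε).comp (by fun_prop) fun θ hθ => exp_arc_mem hθ
      · exact norm_ne_zero_iff.2 (hM.arc_ne_zero (Ioc_subset_Icc_self hε) hθ)
    · filter_upwards [hev] with ε hε
      refine (ae_restrict_mem measurableSet_Ioo).mono fun θ hθ => ?_
      have := (hB ε (Ioc_subset_Icc_self hε) θ hθ).1
      rw [Real.norm_eq_abs, abs_mul, abs_of_nonneg (a := 2 * Real.sin θ ^ 2) (by positivity)]
      linarith
    · refine (ae_restrict_mem measurableSet_Ioo).mono fun θ hθ => ?_
      refine Tendsto.mul_const _ (Tendsto.log (hM.tendsto_arc θ hθ).norm ?_)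
      exact norm_ne_zero_iff.2 (hM.arc_ne_zero zero_mem_Icc_zero_one hθ)
  obtain ⟨C, r₀, hC, hr0, hr1, h⟩ := hS.re_contourIntegrand_ge v
  have bound : ∀ r ∈ Ioc 0 r₀, ∀ ε ∈ Ioc (0 : ℝ) 1,
      Real.pi * (-(v ^ 2 / 2 + k - 1) / 2 - ε / (2 * r) - C * r) ≤
      ∫ x in (0 : ℝ)..Real.pi, Real.log ‖_root_.schurStep v S ε (exp (x * I))‖ *
        (2 * Real.sin x ^ 2) := by
    intro r hr ε hε
    -- The height T = -log r places the top side on the circle |ζ| = r.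
    have hrT : Real.exp (-(-Real.log r)) = r := by rw [neg_neg, Real.exp_log hr.1]
    have hT0 : 0 ≤ -Real.log r := by
      have := Real.log_nonpos hr.1.le (hr.2.trans hr1); linarith
    refine le_trans ?_ (hS.integral_top_le_bottom v hε hT0)
    have hlow := h ε hε (-Real.log r) (hrT.le.trans hr.2)
    rw [hrT] at hlow
    have e : Real.pi * (-(v ^ 2 / 2 + k - 1) / 2 - ε / (2 * r) - C * r) =
        ∫ θ in (0 : ℝ)..Real.pi, (-(v ^ 2 / 2 + k - 1) / 2 + v * Real.cos θ / (2 * r) -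
          ε / (2 * r) - C * r) := by
      have : (fun θ => -(v ^ 2 / 2 + k - 1) / 2 + v * Real.cos θ / (2 * r) -
          ε / (2 * r) - C * r) = fun θ => (-(v ^ 2 / 2 + k - 1) / 2 - ε / (2 * r) - C * r) +
          v / (2 * r) * Real.cos θ := by ext θ; ring
      rw [this, intervalIntegral.integral_add (by simp)
        (Continuous.intervalIntegrable (by fun_prop) _ _),
        intervalIntegral.integral_const_mul, integral_cos]
      simp
      ring
    rw [e]
    refine intervalIntegral.integral_mono_on hpi.le
      (Continuous.intervalIntegrable (by fun_prop) _ _) ?_ hlow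
    refine ContinuousOn.intervalIntegrable (continuous_re.comp_continuousOn
      ((hS.continuousOn_contourIntegrand v hε).comp (by fun_prop) fun x hx => ?_))
    rw [uIcc_of_le hpi.le] at hx
    exact ⟨by simpa using hx, by simpa using hT0⟩
  -- The order of limits matters: ε → 0 at fixed r removes ε/(2r), and only then r → 0.
  have bound2 : ∀ r ∈ Ioc 0 r₀, Real.pi * (-(v ^ 2 / 2 + k - 1) / 2 - C * r) ≤
      ∫ x in (0 : ℝ)..Real.pi, Real.log ‖_root_.schurStep v S 0 (exp (x * I))‖ *
        (2 * Real.sin x ^ 2) := by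
    intro r hr
    have l2 : Tendsto (fun ε : ℝ => Real.pi * (-(v ^ 2 / 2 + k - 1) / 2 - ε / (2 * r) - C * r))
        (𝓝[>] 0) (𝓝 (Real.pi * (-(v ^ 2 / 2 + k - 1) / 2 - 0 / (2 * r) - C * r))) := by
      refine Tendsto.mono_left (Continuous.tendsto ?_ 0) nhdsWithin_le_nhds
      fun_prop
    rw [zero_div, sub_zero] at l2
    refine le_of_tendsto_of_tendsto l2 lim ?_
    filter_upwards [Ioc_mem_nhdsGT (one_pos (α := ℝ))] with ε hε using bound r hr ε hε
  have l3 : Tendsto (fun r : ℝ => Real.pi * (-(v ^ 2 / 2 + k - 1) / 2 - C * r))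
      (𝓝[>] 0) (𝓝 (Real.pi * (-(v ^ 2 / 2 + k - 1) / 2 - C * 0))) := by
    refine Tendsto.mono_left (Continuous.tendsto ?_ 0) nhdsWithin_le_nhds
    fun_prop
  have := le_of_tendsto l3 (by filter_upwards [Ioc_mem_nhdsGT hr0] with r hr using bound2 r hr)
  refine le_trans (le_of_eq ?_) this
  ring

/-- The entropy of the boundary values of a function on the upper half disc, relative to those of
the identity, with respect to the probability measure `(2/π) sin² θ dθ` on the upper half circle. -/
def arcEntropy (f : ℂ → ℂ) : ℝ :=
  2 / Real.pi * ∫ θ in (0 : ℝ)..Real.pi,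
    Real.log ((f (exp (θ * I))).im / Real.sin θ) * Real.sin θ ^ 2

theorem arcEntropy_id : arcEntropy (fun ζ => ζ) = 0 := by
  simp [arcEntropy]

theorem two_div_pi_mul_integral_sin_sq :
    2 / Real.pi * ∫ θ in (0 : ℝ)..Real.pi, Real.sin θ ^ 2 = 1 := by
  rw [integral_sin_sq]
  have := Real.pi_pos.ne'
  simp

/-- On the unit circle ζ⁻¹ + ζ + v is real, so without damping the imaginary part of the denominator
is exactly -Im S. -/
theorem im_schurStep_arc (S : ℝ → ℂ → ℂ) (θ : ℝ) :
    (_root_.schurStep v S 0 (exp (θ * I))).im =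
      ‖_root_.schurStep v S 0 (exp (θ * I))‖ ^ 2 * (S 0 (exp (θ * I))).im := by
  rw [_root_.schurStep, inv_im, schurStep_denominator_im, inv_add_self_arc, ofReal_im, norm_inv,
    normSq_eq_norm_sq]
  ring

/-- The logarithm of Im M = |M|² Im S splits the entropy of M into that of S and the integral of 2
log|M| bounded by the sum rule. -/
theorem HerglotzFamily.arcEntropy_schurStep_ge (hS : HerglotzFamily k S) :
    -(v ^ 2 / 2 + k - 1) + arcEntropy (S 0) ≤ arcEntropy (_root_.schurStep v S 0) := by
  have hM := hS.schurStep v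
  have hpi := Real.pi_pos
  have e : arcEntropy (_root_.schurStep v S 0) = 2 / Real.pi *
      (∫ x in (0 : ℝ)..Real.pi, Real.log ‖_root_.schurStep v S 0 (exp (x * I))‖ *
        (2 * Real.sin x ^ 2)) + arcEntropy (S 0) := by
    rw [arcEntropy, arcEntropy, ← mul_add, ← intervalIntegral.integral_add
      hM.intervalIntegrable_log_norm hS.intervalIntegrable_log_im]
    congr 1
    simp_rw [intervalIntegral.integral_of_le hpi.le, integral_Ioc_eq_integral_Ioo]
    refine setIntegral_congr_fun measurableSet_Ioo fun θ hθ => ?_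
    have n0 := norm_ne_zero_iff.2 (hM.arc_ne_zero zero_mem_Icc_zero_one hθ)
    have i0 := (hS.im_arc_pos zero_mem_Icc_zero_one hθ)
    have s0 := Real.sin_pos_of_mem_Ioo hθ
    rw [im_schurStep_arc v S θ, mul_div_assoc,
      Real.log_mul (pow_ne_zero _ n0) (div_pos i0 s0).ne', Real.log_pow]
    push_cast; ring
  rw [e]
  have h := hS.integral_log_norm_schurStep_ge v
  have : 2 / Real.pi * -(Real.pi / 2 * (v ^ 2 / 2 + k - 1)) = -(v ^ 2 / 2 + k - 1) := by
    field_simp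
  rw [← this]
  gcongr

/-- Jensen's inequality at the points a/(2p) and b/(2q) with weights p and q, whose mean is (a +
b)/2. A vanishing weight has to be treated apart: then one branch is simply discarded from the
average. -/
theorem log_average_ge {a b p q : ℝ} (ha : 0 < a) (hb : 0 < b) (hp : 0 ≤ p) (hq : 0 ≤ q)
    (hpq : p + q = 1) :
    p * (Real.log a - Real.log (2 * p)) + q * (Real.log b - Real.log (2 * q)) ≤
      Real.log ((a + b) / 2) := by
  rcases hp.eq_or_lt with rfl | hp
  · have : q = 1 := by linarith
    subst this
    rw [← Real.log_div hb.ne' (by norm_num)]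
    simp only [zero_mul, zero_add, one_mul, mul_one]
    exact Real.log_le_log (by positivity) (by linarith)
  rcases hq.eq_or_lt with rfl | hq
  · have : p = 1 := by linarith
    subst this
    rw [← Real.log_div ha.ne' (by norm_num)]
    simp only [zero_mul, add_zero, one_mul, mul_one]
    exact Real.log_le_log (by positivity) (by linarith)
  rw [← Real.log_div ha.ne' (by positivity), ← Real.log_div hb.ne' (by positivity)]
  have := strictConcaveOn_log_Ioi.concaveOn.2 (x := a / (2 * p)) (y := b / (2 * q))
    (mem_Ioi.2 (show 0 < a / (2 * p) by positivity))
    (mem_Ioi.2 (show 0 < b / (2 * q) by positivity)) hp.le hq.le hpq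
  simp only [smul_eq_mul] at this
  refine this.trans (le_of_eq ?_)
  congr 1
  field_simp

/-- `log_average_ge` integrated against the probability measure (2/π) sin²θ dθ. Only an inequality
between imaginary parts is assumed, so that S may contain further branches, as happens at O in the
full tree. -/
theorem HerglotzFamily.arcEntropy_average_ge {k₀ k₁ : ℝ} {S₀ S₁ : ℝ → ℂ → ℂ}
    (hS : HerglotzFamily k S) (h₀ : HerglotzFamily k₀ S₀) (h₁ : HerglotzFamily k₁ S₁)
    (h : ∀ θ ∈ Ioo 0 Real.pi,
      ((S₀ 0 (exp (θ * I))).im + (S₁ 0 (exp (θ * I))).im) / 2 ≤ (S 0 (exp (θ * I))).im)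
    {p q : ℝ} (hp : 0 ≤ p) (hq : 0 ≤ q) (hpq : p + q = 1) :
    p * (arcEntropy (S₀ 0) - Real.log (2 * p)) + q * (arcEntropy (S₁ 0) - Real.log (2 * q)) ≤
      arcEntropy (S 0) := by
  have hpi := Real.pi_pos
  have i0 := h₀.intervalIntegrable_log_im
  have i1 := h₁.intervalIntegrable_log_im
  have i2 : IntervalIntegrable (fun θ => Real.sin θ ^ 2) volume 0 Real.pi :=
    Continuous.intervalIntegrable (by fun_prop) _ _
  have e : p * (arcEntropy (S₀ 0) - Real.log (2 * p)) +
      q * (arcEntropy (S₁ 0) - Real.log (2 * q)) = 2 / Real.pi * ∫ θ in (0 : ℝ)..Real.pi,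
      ((p * (Real.log ((S₀ 0 (exp (θ * I))).im / Real.sin θ) * Real.sin θ ^ 2) +
        q * (Real.log ((S₁ 0 (exp (θ * I))).im / Real.sin θ) * Real.sin θ ^ 2)) -
        (p * Real.log (2 * p) + q * Real.log (2 * q)) * Real.sin θ ^ 2) := by
    rw [intervalIntegral.integral_sub ((i0.const_mul p).add (i1.const_mul q)) (i2.const_mul _),
      intervalIntegral.integral_add (i0.const_mul p) (i1.const_mul q)]
    simp_rw [intervalIntegral.integral_const_mul]
    rw [arcEntropy, arcEntropy]
    linear_combination -(p * Real.log (2 * p) + q * Real.log (2 * q)) *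
      two_div_pi_mul_integral_sin_sq.symm
  rw [e, arcEntropy]
  gcongr
  refine intervalIntegral.integral_mono_on_of_le_Ioo hpi.le
    (((i0.const_mul p).add (i1.const_mul q)).sub (i2.const_mul _))
    hS.intervalIntegrable_log_im fun θ hθ => ?_
  have s0 := Real.sin_pos_of_mem_Ioo hθ
  have a := h₀.im_arc_pos zero_mem_Icc_zero_one hθ
  have b := h₁.im_arc_pos zero_mem_Icc_zero_one hθ
  have key := log_average_ge (div_pos a s0) (div_pos b s0) hp hq hpq
  have mono : Real.log (((S₀ 0 (exp (θ * I))).im / Real.sin θ +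
      (S₁ 0 (exp (θ * I))).im / Real.sin θ) / 2) ≤
      Real.log ((S 0 (exp (θ * I))).im / Real.sin θ) := by
    refine Real.log_le_log (by positivity) ?_
    have := h θ hθ
    rw [← add_div, div_right_comm]
    gcongr
  calc _ = (p * (Real.log ((S₀ 0 (exp (θ * I))).im / Real.sin θ) - Real.log (2 * p)) +
        q * (Real.log ((S₁ 0 (exp (θ * I))).im / Real.sin θ) - Real.log (2 * q))) *
        Real.sin θ ^ 2 := by ring
    _ ≤ _ := by gcongr; exact key.trans mono

end ArcEntropy

/-! ### Entropy bounds along the tree for potentials cut off at finite depth. -/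

noncomputable section TreeEntropy

open Complex Filter Topology

/-- The restriction of a potential on the rooted tree to the subtree at the `i`-th child of the
root. -/
def childFunction (V : List (Fin 2) → ℝ) (i : Fin 2) (x : List (Fin 2)) : ℝ := V (x ++ [i])

/-- The damped and normalized diagonal Green's function at the root of the rooted tree, with the
potential `V` replaced by `0` at distance at least `n` from the root. -/
def treeGreen : ℕ → (List (Fin 2) → ℝ) → ℝ → ℂ → ℂ
  | 0, _ => fun _ ζ => ζ
  | n + 1, V => schurStep (V [] / √2)
      (fun ε ζ => (treeGreen n (childFunction V 0) ε ζ + treeGreen n (childFunction V 1) ε ζ) / 2)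

theorem herglotzFamily_average {S T : ℝ → ℂ → ℂ} (hS : HerglotzFamily 1 S)
    (hT : HerglotzFamily 1 T) : HerglotzFamily 1 (fun ε ζ => (S ε ζ + T ε ζ) / 2) := by
  have := (hS.add hT).half
  norm_num at this
  exact this

theorem herglotzFamily_treeGreen (n : ℕ) (V : List (Fin 2) → ℝ) :
    HerglotzFamily 1 (treeGreen n V) := by
  induction n generalizing V with
  | zero => exact HerglotzFamily.id
  | succ n ih => exact (herglotzFamily_average (ih _) (ih _)).schurStep _

/-- The sum of `V² μ` over the words of length less than `n`. -/
def weightedSquares : ℕ → (List (Fin 2) → ℝ) → (List (Fin 2) → ℝ) → ℝ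
  | 0, _, _ => 0
  | n + 1, V, μ => V [] ^ 2 * μ [] +
      (weightedSquares n (childFunction V 0) (childFunction μ 0) +
        weightedSquares n (childFunction V 1) (childFunction μ 1))

theorem weightedSquares_nonneg (n : ℕ) (V μ : List (Fin 2) → ℝ) (hμ : ∀ x, 0 ≤ μ x) :
    0 ≤ weightedSquares n V μ := by
  induction n generalizing V μ with
  | zero => exact le_rfl
  | succ n ih =>
    exact add_nonneg (mul_nonneg (sq_nonneg _) (hμ _))
      (add_nonneg (ih _ _ fun x => hμ _) (ih _ _ fun x => hμ _))

theorem weightedSquares_const_mul (n : ℕ) (V μ : List (Fin 2) → ℝ) (c : ℝ) :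
    weightedSquares n V (fun x => c * μ x) = c * weightedSquares n V μ := by
  induction n generalizing V μ with
  | zero => simp [weightedSquares]
  | succ n ih =>
    have h := fun i => ih (childFunction V i) (childFunction μ i)
    have e : ∀ i, childFunction (fun x => c * μ x) i = fun x => c * childFunction μ i x :=
      fun i => rfl
    rw [weightedSquares, weightedSquares, e, e, h, h]
    ring

/-- A weight on words that could be the Lebesgue measure of the part of a subset of the unit interval
that lies in a binary cylinder. -/
structure IsCylinderWeight (μ : List (Fin 2) → ℝ) : Prop where
  nonneg : ∀ x, 0 ≤ μ x
  add_children : ∀ x, μ x = μ (0 :: x) + μ (1 :: x)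
  le_pow : ∀ x, μ x ≤ (1 / 2) ^ x.length

/-- The factor 2 rescales a half of the unit interval to full length, so that the induction
reproduces itself. -/
theorem IsCylinderWeight.child {μ : List (Fin 2) → ℝ} (h : IsCylinderWeight μ) (i : Fin 2) :
    IsCylinderWeight (fun x => 2 * childFunction μ i x) where
  nonneg x := mul_nonneg zero_le_two (h.nonneg _)
  add_children x := by
    have := h.add_children (x ++ [i])
    simp only [childFunction, List.cons_append]
    linarith
  le_pow x := by
    have := h.le_pow (x ++ [i])
    rw [List.length_append, List.length_singleton, pow_succ] at this
    simp only [childFunction]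
    linarith

/-- One term of the weighted average in the recursive lower bound for the entropy. -/
theorem weighted_child_bound {E W m m₀ : ℝ} (hm : 0 < m) (hm₀ : 0 ≤ m₀) (hW : 0 ≤ W)
    (h : 0 < 2 * m₀ → -(1 / (4 * (2 * m₀))) * (2 * W) + Real.log (2 * m₀) ≤ E) :
    -- If m₀ = 0, nothing is known about E, but E is multiplied by 0. Otherwise log(2m₀) cancels and
    -- the share m₀/m of log m remains.
    -(1 / (4 * m)) * W + m₀ / m * Real.log m ≤ m₀ / m * (E - Real.log (2 * (m₀ / m))) := by
  rcases hm₀.eq_or_lt with rfl | hpos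
  · simp only [zero_div, zero_mul, add_zero]
    have : 0 ≤ 1 / (4 * m) * W := by positivity
    linarith
  have h1 := h (by positivity)
  rw [← mul_div_assoc, Real.log_div (by positivity) hm.ne']
  have e : -(1 / (4 * m)) * W + m₀ / m * Real.log m =
      m₀ / m * (-(1 / (4 * (2 * m₀))) * (2 * W) + Real.log (2 * m₀) -
        (Real.log (2 * m₀) - Real.log m)) := by
    field_simp; ring
  rw [e]
  gcongr

/-- The lower bound for the average of the entropies over the two subtrees at the root. -/
theorem average_entropy_bound {S : ℝ → ℂ → ℂ} {k : ℝ} (hS : HerglotzFamily k S) (n : ℕ)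
    (V : List (Fin 2) → ℝ)
    (hle : ∀ θ ∈ Ioo 0 Real.pi, ((treeGreen n (childFunction V 0) 0 (exp (θ * I))).im +
      (treeGreen n (childFunction V 1) 0 (exp (θ * I))).im) / 2 ≤ (S 0 (exp (θ * I))).im)
    {μ : List (Fin 2) → ℝ} (hμ : IsCylinderWeight μ) (h0 : 0 < μ [])
    (ih : ∀ i, 0 < 2 * childFunction μ i [] →
      -(1 / (4 * (2 * childFunction μ i []))) *
        weightedSquares n (childFunction V i) (fun x => 2 * childFunction μ i x) +
        Real.log (2 * childFunction μ i []) ≤ arcEntropy (treeGreen n (childFunction V i) 0)) :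
    -(1 / (4 * μ [])) * (weightedSquares n (childFunction V 0) (childFunction μ 0) +
      weightedSquares n (childFunction V 1) (childFunction μ 1)) + Real.log (μ []) ≤
      arcEntropy (S 0) := by
  have hsum : childFunction μ 0 [] + childFunction μ 1 [] = μ [] := (hμ.add_children []).symm
  have hnn : ∀ i, 0 ≤ childFunction μ i [] := fun i => hμ.nonneg _
  have key := hS.arcEntropy_average_ge
    (herglotzFamily_treeGreen n (childFunction V 0)) (herglotzFamily_treeGreen n (childFunction V 1))
    hle (p := childFunction μ 0 [] / μ []) (q := childFunction μ 1 [] / μ [])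
    (div_nonneg (hnn _) h0.le) (div_nonneg (hnn _) h0.le)
    (by rw [← add_div, hsum, div_self h0.ne'])
  have b : ∀ i, _ := fun i => weighted_child_bound h0 (hnn i)
    (weightedSquares_nonneg n (childFunction V i) (childFunction μ i) fun x => hμ.nonneg _)
    (fun h => (by
      have := ih i h
      rwa [weightedSquares_const_mul] at this) :
      0 < 2 * childFunction μ i [] → -(1 / (4 * (2 * childFunction μ i []))) *
        (2 * weightedSquares n (childFunction V i) (childFunction μ i)) +
        Real.log (2 * childFunction μ i []) ≤ arcEntropy (treeGreen n (childFunction V i) 0))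
  refine le_trans ?_ key
  have b0 := b 0
  have b1 := b 1
  -- The shares of log m from the two subtrees add up to log m because the weight is additive.
  have e : childFunction μ 0 [] / μ [] * Real.log (μ []) +
      childFunction μ 1 [] / μ [] * Real.log (μ []) = Real.log (μ []) := by
    rw [← add_mul, ← add_div, hsum, div_self h0.ne', one_mul]
  linarith

/-- Each level applies the sum rule at the root and then concavity over the two subtrees with
weights proportional to μ. At depth 0 the entropy is that of the free tree, namely 0, and log μ ≤ 0
because μ ≤ 1. -/
theorem treeGreen_entropy_bound {n : ℕ} {V : List (Fin 2) → ℝ}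
    {μ : List (Fin 2) → ℝ} (hμ : IsCylinderWeight μ) (h0 : 0 < μ []) :
    -(1 / (4 * μ [])) * weightedSquares n V μ + Real.log (μ []) ≤ arcEntropy (treeGreen n V 0) := by
  induction n generalizing V μ with
  | zero =>
    have := hμ.le_pow []
    rw [List.length_nil, pow_zero] at this
    have e : arcEntropy (treeGreen 0 V 0) = 0 := arcEntropy_id
    rw [e, weightedSquares, mul_zero, zero_add]
    exact Real.log_nonpos h0.le this
  | succ n ih =>
    have hav := herglotzFamily_average (herglotzFamily_treeGreen n (childFunction V 0))
      (herglotzFamily_treeGreen n (childFunction V 1))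
    have step := hav.arcEntropy_schurStep_ge (V [] / √2)
    have av := average_entropy_bound hav n V (fun θ _ => by simp) hμ h0
      (fun i hi => ih (hμ.child i) hi)
    -- The loss V²/4 at the root, written as the root term of the weighted sum. The slope k is 1
    -- here and contributes nothing.
    have e : (V [] / √2) ^ 2 / 2 + 1 - 1 = 1 / (4 * μ []) * (V [] ^ 2 * μ []) := by
      rw [div_pow, Real.sq_sqrt zero_le_two]; field_simp; norm_num
    rw [e] at step
    rw [weightedSquares]
    refine le_trans ?_ step
    rw [mul_add, neg_mul]
    linarith

/-- The normalized diagonal Green's function at the vertex `O` of the Cayley tree, with the potential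
cut off at distance `n + 1` from `O` and its counterpart. -/
def cayleyGreen (n : ℕ) (V : CayleyVertex → ℝ) : ℝ → ℂ → ℂ :=
  schurStep (V (Sum.inl []) / √2) (fun ε ζ =>
    (treeGreen n (childFunction (fun x => V (Sum.inl x)) 0) ε ζ +
      treeGreen n (childFunction (fun x => V (Sum.inl x)) 1) ε ζ) / 2 +
    treeGreen (n + 1) (fun x => V (Sum.inr x)) ε ζ / 2)

theorem herglotzFamily_cayleyGreen (n : ℕ) (V : CayleyVertex → ℝ) :
    HerglotzFamily 1 (cayleyGreen n V) :=
  ((herglotzFamily_average (herglotzFamily_treeGreen _ _) (herglotzFamily_treeGreen _ _)).add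
    (herglotzFamily_treeGreen _ _).half).schurStep _

/-- The branch across the deleted edge adds a nonnegative imaginary part, which is thrown away, and
raises the slope of S from 1 to 3/2, which costs 1/2 in the sum rule. -/
theorem cayley_entropy_bound (n : ℕ) (V : CayleyVertex → ℝ)
    {μ : List (Fin 2) → ℝ} (hμ : IsCylinderWeight μ) (h0 : 0 < μ []) :
    -(1 / (4 * μ [])) * weightedSquares (n + 1) (fun x => V (Sum.inl x)) μ + Real.log (μ []) - 1 / 2
      ≤ arcEntropy (cayleyGreen n V 0) := by
  set VL := fun x => V (Sum.inl x) with hVL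
  have hR := (herglotzFamily_treeGreen (n + 1) (fun x => V (Sum.inr x))).half
  have hav := (herglotzFamily_average (herglotzFamily_treeGreen n (childFunction VL 0))
      (herglotzFamily_treeGreen n (childFunction VL 1))).add hR
  have step := hav.arcEntropy_schurStep_ge (VL [] / √2)
  have av := average_entropy_bound hav n VL (fun θ hθ => by
      have := hR.im_arc_pos zero_mem_Icc_zero_one hθ
      rw [add_im, div_ofNat_im, add_im]
      linarith) hμ h0
    (fun i hi => treeGreen_entropy_bound (hμ.child i) hi)
  have e : (VL [] / √2) ^ 2 / 2 + (1 + 1 / 2) - 1 =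
      1 / (4 * μ []) * (VL [] ^ 2 * μ []) + 1 / 2 := by
    rw [div_pow, Real.sq_sqrt zero_le_two]; field_simp; ring
  rw [e] at step
  rw [weightedSquares]
  refine le_trans ?_ step
  rw [mul_add, neg_mul]
  linarith

end TreeEntropy

/-! ### The continued fractions as Green's functions of cut-off operators. -/

noncomputable section GreenVectors

open Complex Filter Topology

/-! ### Schrödinger operators: symmetry, norm bounds, strong convergence -/

section Schrodinger

variable {W : Type*}

theorem schrodinger_apply (G : SimpleGraph W) [G.LocallyFinite] (hG : ∃ d : ℕ, ∀ x, G.degree x ≤ d)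
    (V : W → ℝ) (hV : ∃ C : ℝ, ∀ x, |V x| ≤ C) (u : EllTwo W) (x : W) :
    schrodinger G hG V hV u x = ∑ y ∈ G.neighborFinset x, u y + (V x : ℂ) * u x := rfl

theorem inner_single_one [DecidableEq W] (x : W) (u : EllTwo W) :
    inner ℂ (lp.single 2 x (1 : ℂ)) u = u x := by
  rw [lp.inner_single_left]; simp

theorem inner_schrodinger_single [DecidableEq W] (G : SimpleGraph W) [G.LocallyFinite]
    (hG : ∃ d : ℕ, ∀ x, G.degree x ≤ d) (V : W → ℝ) (hV : ∃ C : ℝ, ∀ x, |V x| ≤ C)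
    (u : EllTwo W) (x : W) :
    inner ℂ (schrodinger G hG V hV (lp.single 2 x (1 : ℂ))) u = schrodinger G hG V hV u x := by
  have e : schrodinger G hG V hV (lp.single 2 x (1 : ℂ)) =
      ∑ y ∈ G.neighborFinset x, lp.single 2 y (1 : ℂ) + (V x : ℂ) • lp.single 2 x (1 : ℂ) := by
    ext y
    rw [schrodinger_apply, lp.coeFn_add, Pi.add_apply, lp.coeFn_sum, Finset.sum_apply,
      lp.coeFn_smul, Pi.smul_apply, smul_eq_mul]
    simp only [lp.single_apply, Pi.single_apply]
    congr 1
    · have h : x ∈ G.neighborFinset y ↔ y ∈ G.neighborFinset x := by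
        rw [SimpleGraph.mem_neighborFinset, SimpleGraph.mem_neighborFinset, G.adj_comm]
      simp only [Finset.sum_ite_eq', Finset.sum_ite_eq, h]
    · split_ifs with h
      · rw [h]
      · simp
  rw [e, inner_add_left, sum_inner, inner_smul_left, schrodinger_apply]
  simp only [inner_single_one, conj_ofReal]

theorem isSelfAdjoint_schrodinger (G : SimpleGraph W) [G.LocallyFinite]
    (hG : ∃ d : ℕ, ∀ x, G.degree x ≤ d) (V : W → ℝ) (hV : ∃ C : ℝ, ∀ x, |V x| ≤ C) :
    IsSelfAdjoint (schrodinger G hG V hV) := by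
  classical
  rw [ContinuousLinearMap.isSelfAdjoint_iff']
  ext u x
  rw [← inner_single_one x, ContinuousLinearMap.adjoint_inner_right, inner_schrodinger_single]

theorem norm_schrodinger_le (G : SimpleGraph W) [G.LocallyFinite]
    (hG : ∃ d : ℕ, ∀ x, G.degree x ≤ d) (V : W → ℝ) (hV : ∃ C : ℝ, ∀ x, |V x| ≤ C)
    {d : ℕ} (hd : ∀ x, G.degree x ≤ d) {C : ℝ} (hC : ∀ x, |V x| ≤ C) :
    ‖schrodinger G hG V hV‖ ≤ √(2 * d ^ 2 + 2 * C ^ 2) := by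
  refine ContinuousLinearMap.opNorm_le_bound _ (Real.sqrt_nonneg _) fun u => ?_
  have h := (summable_sq_schrodinger G V d hd C hC u).2
  refine (sq_le_sq₀ (norm_nonneg _) (by positivity)).1 ?_
  rw [mul_pow, Real.sq_sqrt (by positivity)]
  refine le_trans (le_of_eq ?_) h
  have e := lp.norm_rpow_eq_tsum (p := 2) (by simp) (schrodinger G hG V hV u)
  simp only [ENNReal.toReal_ofNat, Real.rpow_ofNat] at e
  exact e

/-- The difference is multiplication by Vn - V, so dominated convergence applies with majorant
C²|u|². Convergence is only strong, not in norm. -/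
theorem tendsto_schrodinger (G : SimpleGraph W) [G.LocallyFinite]
    (hG : ∃ d : ℕ, ∀ x, G.degree x ≤ d) (V : W → ℝ) (hV : ∃ C : ℝ, ∀ x, |V x| ≤ C)
    (Vn : ℕ → W → ℝ) (hVn : ∀ n, ∃ C : ℝ, ∀ x, |Vn n x| ≤ C) {C : ℝ}
    (hC : ∀ n x, |Vn n x - V x| ≤ C) (hlim : ∀ x, Tendsto (fun n => Vn n x) atTop (𝓝 (V x)))
    (u : EllTwo W) :
    Tendsto (fun n => schrodinger G hG (Vn n) (hVn n) u) atTop (𝓝 (schrodinger G hG V hV u)) := by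
  rw [tendsto_iff_norm_sub_tendsto_zero]
  have hu : Summable (fun x => ‖u x‖ ^ 2) := by
    simpa using (lp.memℓp u).summable (by simp)
  have e : ∀ n, ‖schrodinger G hG (Vn n) (hVn n) u - schrodinger G hG V hV u‖ ^ 2 =
      ∑' x, (Vn n x - V x) ^ 2 * ‖u x‖ ^ 2 := by
    intro n
    have h := lp.norm_rpow_eq_tsum (p := 2) (by simp)
      (schrodinger G hG (Vn n) (hVn n) u - schrodinger G hG V hV u)
    simp only [ENNReal.toReal_ofNat, Real.rpow_ofNat] at h
    rw [h]
    refine tsum_congr fun x => ?_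
    rw [lp.coeFn_sub, Pi.sub_apply, schrodinger_apply, schrodinger_apply, add_sub_add_left_eq_sub,
      ← sub_mul, norm_mul, mul_pow, ← ofReal_sub, norm_real, Real.norm_eq_abs, sq_abs]
  have lim : Tendsto (fun n => ‖schrodinger G hG (Vn n) (hVn n) u - schrodinger G hG V hV u‖ ^ 2)
      atTop (𝓝 0) := by
    simp_rw [e]
    have := tendsto_tsum_of_dominated_convergence (𝓕 := atTop)
      (f := fun n x => (Vn n x - V x) ^ 2 * ‖u x‖ ^ 2) (g := fun _ => (0 : ℝ))
      (hu.mul_left (C ^ 2)) (fun x => ?_) (Eventually.of_forall fun n x => ?_)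
    · simpa using this
    · have h := ((hlim x).sub_const (V x)).pow 2
      simpa using h.mul_const (‖u x‖ ^ 2)
    · rw [norm_mul, norm_pow, norm_pow, norm_norm, Real.norm_eq_abs]
      have := hC n x
      gcongr
  have := lim.sqrt
  simpa using this

end Schrodinger

/-! ### Green's functions of potentials of finite support -/

theorem im_inv_add_self_neg {ζ : ℂ} (h : ζ ∈ openHalfDisc) : (ζ⁻¹ + ζ).im < 0 := by
  obtain ⟨h1, h2⟩ := h
  have h0 : ζ ≠ 0 := fun h => by simp [h] at h2
  have hn : 0 < normSq ζ := normSq_pos.2 h0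
  have hn1 : normSq ζ < 1 := by
    rw [normSq_eq_norm_sq]; nlinarith [norm_nonneg ζ]
  rw [add_im, inv_im]
  have : ζ.im < ζ.im / normSq ζ := by
    rw [lt_div_iff₀ hn]; nlinarith
  rw [neg_div]; linarith

/-- In the open half disc Im(ζ⁻¹ + ζ) is strictly negative and replaces the damping;
`HerglotzFamily.im_nonneg` says nothing at ε = 0. -/
theorem treeGreen_im_pos (n : ℕ) (V : List (Fin 2) → ℝ) {ζ : ℂ} (h : ζ ∈ openHalfDisc) :
    0 < (treeGreen n V 0 ζ).im := by
  induction n generalizing V with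
  | zero => exact h.2
  | succ n ih =>
    refine inv_im_pos ?_
    rw [schurStep_denominator_im (S := fun ε ζ =>
      (treeGreen n (childFunction V 0) ε ζ + treeGreen n (childFunction V 1) ε ζ) / 2),
      div_ofNat_im, add_im]
    have := im_inv_add_self_neg h
    rw [add_im] at this
    simp only [add_im]
    linarith [ih (childFunction V 0), ih (childFunction V 1)]

/-- The spectral parameter that corresponds to the point `ζ` of the unit disc. -/
def spectralParameter (ζ : ℂ) : ℂ := -(√2 : ℂ) * (ζ + ζ⁻¹)

theorem sq_ofReal_sqrt_two : ((√2 : ℝ) : ℂ) ^ 2 = 2 := by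
  rw [← ofReal_pow, Real.sq_sqrt zero_le_two, ofReal_ofNat]

theorem ofReal_sqrt_two_ne_zero : ((√2 : ℝ) : ℂ) ≠ 0 := by
  rw [ofReal_ne_zero]; positivity

/-- A square summable solution of `(H - z) u = δ_O` on the rooted tree. -/
structure IsTreeSolution (V : List (Fin 2) → ℝ) (z : ℂ) (u : List (Fin 2) → ℂ) : Prop where
  memℓp : Memℓp u 2
  root : u [0] + u [1] + (V [] - z) * u [] = 1
  interior : ∀ i x, u (0 :: i :: x) + u (1 :: i :: x) + u x + (V (i :: x) - z) * u (i :: x) = 0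

theorem summable_of_injective_cover {α β γ : Type*} {f : β → ℝ} (hf : ∀ x, 0 ≤ f x)
    {e₁ : α → β} {e₂ : γ → β} (h₁ : Function.Injective e₁) (h₂ : Function.Injective e₂)
    (hc : ∀ x, x ∈ range e₁ ∨ x ∈ range e₂) (s₁ : Summable (fun a => f (e₁ a)))
    (s₂ : Summable (fun a => f (e₂ a))) : Summable f := by
  have t₁ : Summable (indicator (range e₁) f) := by
    refine (h₁.summable_iff fun x hx => indicator_of_notMem hx f).1 (s₁.congr fun a => ?_)
    simp
  have t₂ : Summable (indicator (range e₂) f) := by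
    refine (h₂.summable_iff fun x hx => indicator_of_notMem hx f).1 (s₂.congr fun a => ?_)
    simp
  refine Summable.of_nonneg_of_le hf (fun x => ?_) (t₁.add t₂)
  have n₁ := indicator_nonneg (s := range e₁) (fun y _ => hf y) x
  have n₂ := indicator_nonneg (s := range e₂) (fun y _ => hf y) x
  rcases hc x with h | h
  · rw [indicator_of_mem h] at *; linarith
  · rw [indicator_of_mem h] at *; linarith

theorem memℓp_two_iff {W : Type*} (u : W → ℂ) : Memℓp u 2 ↔ Summable fun x => ‖u x‖ ^ 2 := by
  rw [memℓp_gen_iff (by simp)]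
  simp

/-- A radial geometric ansatz reduces all equations to the quadratic relation `quad`. The 2ⁿ
vertices at depth n compensate the factors 2⁻ⁿ in the squared values, leaving the summable |ζ|²ⁿ. -/
theorem isTreeSolution_zero {ζ : ℂ} (h : ζ ∈ openHalfDisc) :
    IsTreeSolution (fun _ => 0) (spectralParameter ζ)
      (fun x => ζ / √2 * (-(ζ / √2)) ^ x.length) := by
  have h0 : ζ ≠ 0 := fun h' => by have := h.2; simp [h'] at this
  have s2 := sq_ofReal_sqrt_two
  have s0 := ofReal_sqrt_two_ne_zero
  have quad : 2 * (ζ / √2) ^ 2 + spectralParameter ζ * (ζ / √2) + 1 = 0 := by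
    rw [spectralParameter, div_pow, s2]; field_simp; ring
  refine ⟨?_, ?_, fun i x => ?_⟩
  · rw [memℓp_two_iff, ← (Equiv.sigmaFiberEquiv (List.length (α := Fin 2))).summable_iff]
    refine (summable_sigma_of_nonneg fun x => ?_).2 ?_
    · exact sq_nonneg _
    have hfin : ∀ n, Fintype { x : List (Fin 2) // x.length = n } := fun n =>
      inferInstanceAs (Fintype (List.Vector (Fin 2) n))
    have hcard : ∀ n, Fintype.card { x : List (Fin 2) // x.length = n } = 2 ^ n := fun n => by
      have := card_vector (α := Fin 2) n
      rw [Fintype.card_fin] at this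
      rw [← this]
      exact Fintype.card_congr (Equiv.refl _)
    refine ⟨fun n => Summable.of_finite, ?_⟩
    have hz1 : ‖ζ‖ ^ 2 < 1 := by have := h.1; nlinarith [norm_nonneg ζ]
    have hs := (summable_geometric_of_lt_one (sq_nonneg ‖ζ‖) hz1).mul_left (‖ζ / (√2 : ℂ)‖ ^ 2)
    refine hs.congr fun n => ?_
    have e : ∀ y : { x : List (Fin 2) // x.length = n },
        ‖(fun x : List (Fin 2) => ζ / √2 * (-(ζ / √2)) ^ x.length)
          (Equiv.sigmaFiberEquiv (List.length (α := Fin 2)) ⟨n, y⟩)‖ ^ 2 =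
          ‖ζ / (√2 : ℂ)‖ ^ 2 * (‖ζ‖ ^ 2 / 2) ^ n := by
      intro y
      have : (Equiv.sigmaFiberEquiv (List.length (α := Fin 2)) ⟨n, y⟩) = y.1 := rfl
      simp only [this, y.2]
      rw [norm_mul, mul_pow, norm_pow, norm_neg, ← pow_mul, mul_comm n 2, pow_mul]
      congr 2
      rw [norm_div, div_pow, norm_real, Real.norm_eq_abs, sq_abs, Real.sq_sqrt zero_le_two]
    simp only [Function.comp_apply] at *
    rw [tsum_congr e, tsum_fintype, Finset.sum_const, Finset.card_univ, hcard, nsmul_eq_mul]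
    push_cast
    rw [div_pow]; field_simp
  · simp only [List.length_singleton, List.length_nil, pow_one, pow_zero, ofReal_zero]
    linear_combination -quad
  · simp only [List.length_cons, ofReal_zero]
    linear_combination (ζ / √2 * (-(ζ / √2)) ^ x.length) * quad

/-- The function on the rooted tree with value `c` at the root and `-c u i` on the subtree at the
`i`-th child. -/
def glueSubtrees (c : ℂ) (u : Fin 2 → List (Fin 2) → ℂ) (x : List (Fin 2)) : ℂ :=
  match x.getLast? with
  | none => c
  | some i => -c * u i x.dropLast

theorem glueSubtrees_nil (c : ℂ) (u : Fin 2 → List (Fin 2) → ℂ) : glueSubtrees c u [] = c := rfl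

theorem glueSubtrees_append (c : ℂ) (u : Fin 2 → List (Fin 2) → ℂ) (x : List (Fin 2)) (i : Fin 2) :
    glueSubtrees c u (x ++ [i]) = -c * u i x := by
  simp [glueSubtrees]

theorem memℓp_glueSubtrees (c : ℂ) {u : Fin 2 → List (Fin 2) → ℂ} (h : ∀ i, Memℓp (u i) 2) :
    Memℓp (glueSubtrees c u) 2 := by
  rw [memℓp_two_iff]
  refine summable_of_injective_cover (fun _ => by positivity)
    (e₁ := fun p : Fin 2 × List (Fin 2) => p.2 ++ [p.1]) (e₂ := fun _ : Unit => []) ?_ ?_ ?_ ?_ ?_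
  · rintro ⟨i, x⟩ ⟨j, y⟩ h
    have := List.append_inj' h rfl
    simp_all
  · exact Function.injective_of_subsingleton _
  · intro x
    rcases List.eq_nil_or_concat x with rfl | ⟨y, i, rfl⟩
    · exact Or.inr ⟨(), rfl⟩
    · exact Or.inl ⟨(i, y), by simp⟩
  · rw [summable_prod_of_nonneg (fun _ => by positivity)]
    refine ⟨fun i => ?_, Summable.of_finite⟩
    simp only [glueSubtrees_append, norm_mul, mul_pow]
    exact ((memℓp_two_iff _).1 (h i)).mul_left _
  · exact Summable.of_finite

/-- The value c at the root acts on each subtree as a source -c at its own root, so the solution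
there is -c u i. The remaining equation at the root is `hc`. -/
theorem isTreeSolution_glueSubtrees {V : List (Fin 2) → ℝ} {z c : ℂ}
    {u : Fin 2 → List (Fin 2) → ℂ} (h : ∀ i, IsTreeSolution (childFunction V i) z (u i))
    (hc : c * (V [] - z - (u 0 [] + u 1 [])) = 1) : IsTreeSolution V z (glueSubtrees c u) := by
  refine ⟨memℓp_glueSubtrees c fun i => (h i).memℓp, ?_, fun i x => ?_⟩
  · have e : ∀ i, glueSubtrees c u [i] = -c * u i [] := fun i => glueSubtrees_append c u [] i
    rw [e, e, glueSubtrees_nil]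
    linear_combination hc
  · rcases List.eq_nil_or_concat x with rfl | ⟨y, j, rfl⟩
    · have e0 : ∀ k, glueSubtrees c u [k, i] = -c * u i [k] := fun k =>
        glueSubtrees_append c u [k] i
      have e1 : glueSubtrees c u [i] = -c * u i [] := glueSubtrees_append c u [] i
      rw [e0, e0, e1, glueSubtrees_nil]
      have := (h i).root
      have hv : childFunction V i [] = V [i] := rfl
      rw [hv] at this
      linear_combination -c * this
    · rw [List.concat_eq_append]
      have e : ∀ w : List (Fin 2), glueSubtrees c u (w ++ [j]) = -c * u j w := fun w =>
        glueSubtrees_append c u w j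
      have e2 := fun k => e (k :: i :: y)
      have e1 := e (i :: y)
      simp only [List.cons_append] at e2 e1
      rw [e2, e2, e1, e]
      have := (h j).interior i y
      have hv : childFunction V j (i :: y) = V (i :: (y ++ [j])) := rfl
      rw [hv] at this
      linear_combination -c * this

/-- The potential `V`, set to `0` at distance at least `n` from the root. -/
def truncatePotential (n : ℕ) (V : List (Fin 2) → ℝ) (x : List (Fin 2)) : ℝ :=
  if x.length < n then V x else 0

theorem childFunction_truncatePotential (n : ℕ) (V : List (Fin 2) → ℝ) (i : Fin 2) :
    childFunction (truncatePotential (n + 1) V) i = truncatePotential n (childFunction V i) := by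
  ext x
  simp [childFunction, truncatePotential]

theorem treeGreen_mul_denominator (n : ℕ) (V : List (Fin 2) → ℝ) {ζ : ℂ} (h : ζ ∈ openHalfDisc) :
    treeGreen (n + 1) V 0 ζ * (ζ⁻¹ + ζ + V [] / √2 -
      (treeGreen n (childFunction V 0) 0 ζ + treeGreen n (childFunction V 1) 0 ζ) / 2) = 1 := by
  have hp := treeGreen_im_pos (n + 1) V h
  have e : treeGreen (n + 1) V 0 ζ = (ζ⁻¹ + ζ + V [] / √2 -
      (treeGreen n (childFunction V 0) 0 ζ + treeGreen n (childFunction V 1) 0 ζ) / 2)⁻¹ := by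
    simp [treeGreen, schurStep]
  rw [e] at hp ⊢
  refine inv_mul_cancel₀ fun h0 => ?_
  rw [h0] at hp; simp at hp

theorem exists_isTreeSolution (n : ℕ) (V : List (Fin 2) → ℝ) {ζ : ℂ} (h : ζ ∈ openHalfDisc) :
    ∃ u, IsTreeSolution (truncatePotential n V) (spectralParameter ζ) u ∧
      u [] = treeGreen n V 0 ζ / √2 := by
  induction n generalizing V with
  | zero =>
    have e : truncatePotential 0 V = fun _ => 0 := by ext x; simp [truncatePotential]
    rw [e]
    exact ⟨_, isTreeSolution_zero h, by simp [treeGreen]⟩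
  | succ n ih =>
    choose u hu hu0 using fun i => ih (childFunction V i)
    refine ⟨glueSubtrees (treeGreen (n + 1) V 0 ζ / √2) u, isTreeSolution_glueSubtrees
      (fun i => ?_) ?_, rfl⟩
    · rw [childFunction_truncatePotential]; exact hu i
    · have key := treeGreen_mul_denominator n V h
      have hv : truncatePotential (n + 1) V [] = V [] := by simp [truncatePotential]
      have s2 := sq_ofReal_sqrt_two
      have s0 := ofReal_sqrt_two_ne_zero
      have h0 : ζ ≠ 0 := fun h' => by have := h.2; simp [h'] at this
      rw [hu0, hu0, hv, spectralParameter, ← key]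
      field_simp
      linear_combination (treeGreen (n + 1) V 0 ζ * ζ * (treeGreen n (childFunction V 0) 0 ζ +
        treeGreen n (childFunction V 1) 0 ζ)) * s2

theorem sum_binaryTree_nil (u : List (Fin 2) → ℂ) :
    ∑ y ∈ binaryTree.neighborFinset [], u y = u [0] + u [1] := by
  have : binaryTree.neighborFinset [] = {[0], [1]} := by
    ext y
    rw [SimpleGraph.mem_neighborFinset, binaryTree_adj_iff]
    simp
  rw [this, Finset.sum_pair (by simp)]

theorem sum_binaryTree_cons (u : List (Fin 2) → ℂ) (i : Fin 2) (x : List (Fin 2)) :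
    ∑ y ∈ binaryTree.neighborFinset (i :: x), u y = u (0 :: i :: x) + u (1 :: i :: x) + u x := by
  have : binaryTree.neighborFinset (i :: x) = {0 :: i :: x, 1 :: i :: x, x} := by
    ext y
    rw [SimpleGraph.mem_neighborFinset, binaryTree_adj_iff]
    simp
  have ne : ∀ k : Fin 2, k :: i :: x ≠ x := fun k h => by
    have := congrArg List.length h
    simp only [List.length_cons] at this
    omega
  rw [this, Finset.sum_insert, Finset.sum_pair (ne 1), add_assoc]
  simp [ne 0]

theorem IsTreeSolution.rootedOperator_eq {V : List (Fin 2) → ℝ} {z : ℂ} {u : List (Fin 2) → ℂ}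
    (h : IsTreeSolution V z u) (hV : ∃ C : ℝ, ∀ x, |V x| ≤ C) :
    rootedOperator V hV ⟨u, h.memℓp⟩ - z • (⟨u, h.memℓp⟩ : EllTwo (List (Fin 2))) =
      lp.single 2 [] (1 : ℂ) := by
  ext x
  rw [lp.coeFn_sub, Pi.sub_apply, lp.coeFn_smul, Pi.smul_apply, smul_eq_mul, rootedOperator,
    schrodinger_apply, lp.single_apply]
  change ∑ y ∈ binaryTree.neighborFinset x, u y + (V x : ℂ) * u x - z * u x = _
  cases x with
  | nil =>
    rw [sum_binaryTree_nil, Pi.single_eq_same]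
    linear_combination h.root
  | cons i x =>
    rw [sum_binaryTree_cons, Pi.single_eq_of_ne (by simp)]
    linear_combination h.interior i x

theorem exists_rooted_green_vector (n : ℕ) (V : List (Fin 2) → ℝ)
    (hV : ∃ C : ℝ, ∀ x, |truncatePotential n V x| ≤ C) {ζ : ℂ} (h : ζ ∈ openHalfDisc) :
    ∃ u : EllTwo (List (Fin 2)), rootedOperator (truncatePotential n V) hV u -
      spectralParameter ζ • u = lp.single 2 [] (1 : ℂ) ∧ u [] = treeGreen n V 0 ζ / √2 := by
  obtain ⟨u, hu, hu0⟩ := exists_isTreeSolution n V h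
  exact ⟨⟨u, hu.memℓp⟩, hu.rootedOperator_eq hV, hu0⟩

/-- The truncation of a potential on the Cayley tree, in both copies of the rooted tree. -/
def truncateCayley (n : ℕ) (V : CayleyVertex → ℝ) : CayleyVertex → ℝ :=
  Sum.elim (truncatePotential n fun x => V (Sum.inl x)) (truncatePotential n fun x => V (Sum.inr x))

theorem neighborFinset_cayleyTree (x : CayleyVertex) :
    cayleyTree.neighborFinset x = cayleyNeighbors x := by
  ext y
  rw [SimpleGraph.mem_neighborFinset, mem_cayleyNeighbors]

/-- Use a·uL on the first copy and b·uR on the second. The edge between the roots affects only the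
equations at its two ends, and these are `h1` and `h2`. -/
theorem cayley_green_vector_eq {VL VR : List (Fin 2) → ℝ} {z : ℂ} {uL uR : List (Fin 2) → ℂ}
    (hL : IsTreeSolution VL z uL) (hR : IsTreeSolution VR z uR) {a b : ℂ}
    (h1 : a + b * uR [] = 1) (h2 : b + a * uL [] = 0)
    (hV : ∃ C : ℝ, ∀ x, |Sum.elim VL VR x| ≤ C) :
    ∃ u : EllTwo CayleyVertex, treeOperator (Sum.elim VL VR) hV u - z • u =
      lp.single 2 (Sum.inl []) (1 : ℂ) ∧ u (Sum.inl []) = a * uL [] := by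
  set u : CayleyVertex → ℂ := Sum.elim (fun x => a * uL x) (fun x => b * uR x) with hu
  have hmem : Memℓp u 2 := by
    rw [memℓp_two_iff]
    refine summable_of_injective_cover (fun _ => by positivity) Sum.inl_injective Sum.inr_injective
      (fun x => by cases x <;> simp) ?_ ?_
    · simp only [hu, Sum.elim_inl, norm_mul, mul_pow]
      exact ((memℓp_two_iff _).1 hL.memℓp).mul_left _
    · simp only [hu, Sum.elim_inr, norm_mul, mul_pow]
      exact ((memℓp_two_iff _).1 hR.memℓp).mul_left _
  refine ⟨⟨u, hmem⟩, ?_, rfl⟩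
  ext x
  rw [lp.coeFn_sub, Pi.sub_apply, lp.coeFn_smul, Pi.smul_apply, smul_eq_mul, treeOperator,
    schrodinger_apply, lp.single_apply, neighborFinset_cayleyTree]
  change ∑ y ∈ cayleyNeighbors x, u y + ((Sum.elim VL VR x : ℝ) : ℂ) * u x - z * u x = _
  have ne : ∀ (i k : Fin 2) (x : List (Fin 2)), k :: i :: x ≠ x := fun i k x h => by
    have := congrArg List.length h
    simp only [List.length_cons] at this
    omega
  rcases x with x | x
  · cases x with
    | nil =>
      have e : ∑ y ∈ cayleyNeighbors (Sum.inl []), u y = a * uL [0] + a * uL [1] + b * uR [] := by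
        rw [cayleyNeighbors, Finset.sum_insert (by simp), Finset.sum_insert (by simp)]
        simp [hu, add_assoc]
      rw [e, Pi.single_eq_same]
      simp only [hu, Sum.elim_inl]
      linear_combination a * hL.root + h1
    | cons i x =>
      have e : ∑ y ∈ cayleyNeighbors (Sum.inl (i :: x)), u y =
          a * uL (0 :: i :: x) + a * uL (1 :: i :: x) + a * uL x := by
        rw [cayleyNeighbors, Finset.sum_insert (by simp [ne]), Finset.sum_insert (by simp [ne])]
        simp [hu, add_assoc]
      rw [e, Pi.single_eq_of_ne (by simp)]
      simp only [hu, Sum.elim_inl]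
      linear_combination a * hL.interior i x
  · cases x with
    | nil =>
      have e : ∑ y ∈ cayleyNeighbors (Sum.inr []), u y = b * uR [0] + b * uR [1] + a * uL [] := by
        rw [cayleyNeighbors, Finset.sum_insert (by simp), Finset.sum_insert (by simp)]
        simp [hu, add_assoc]
      rw [e, Pi.single_eq_of_ne (by simp)]
      simp only [hu, Sum.elim_inr]
      linear_combination b * hR.root + h2
    | cons i x =>
      have e : ∑ y ∈ cayleyNeighbors (Sum.inr (i :: x)), u y =
          b * uR (0 :: i :: x) + b * uR (1 :: i :: x) + b * uR x := by
        rw [cayleyNeighbors, Finset.sum_insert (by simp [ne]), Finset.sum_insert (by simp [ne])]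
        simp [hu, add_assoc]
      rw [e, Pi.single_eq_of_ne (by simp)]
      simp only [hu, Sum.elim_inr]
      linear_combination b * hR.interior i x

theorem exists_cayley_green_vector (n : ℕ) (V : CayleyVertex → ℝ)
    (hV : ∃ C : ℝ, ∀ x, |truncateCayley (n + 1) V x| ≤ C) {ζ : ℂ} (h : ζ ∈ openHalfDisc) :
    ∃ u : EllTwo CayleyVertex, treeOperator (truncateCayley (n + 1) V) hV u -
      spectralParameter ζ • u = lp.single 2 (Sum.inl []) (1 : ℂ) ∧
      u (Sum.inl []) = cayleyGreen n V 0 ζ / √2 := by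
  obtain ⟨uL, hL, hL0⟩ := exists_isTreeSolution (n + 1) (fun x => V (Sum.inl x)) h
  obtain ⟨uR, hR, hR0⟩ := exists_isTreeSolution (n + 1) (fun x => V (Sum.inr x)) h
  have key := treeGreen_mul_denominator n (fun x => V (Sum.inl x)) h
  have pL := treeGreen_im_pos (n + 1) (fun x => V (Sum.inl x)) h
  have pR := treeGreen_im_pos (n + 1) (fun x => V (Sum.inr x)) h
  set ML := treeGreen (n + 1) (fun x => V (Sum.inl x)) 0 ζ
  set MR := treeGreen (n + 1) (fun x => V (Sum.inr x)) 0 ζ with hMR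
  set D : ℂ := ζ⁻¹ + ζ + V (Sum.inl []) / √2 -
    (treeGreen n (childFunction (fun x => V (Sum.inl x)) 0) 0 ζ +
      treeGreen n (childFunction (fun x => V (Sum.inl x)) 1) 0 ζ) / 2 with hD
  have eG : cayleyGreen n V 0 ζ = (D - MR / 2)⁻¹ := by
    rw [hD, hMR, cayleyGreen, schurStep]
    congr 1
    push_cast
    ring
  have ML0 : ML ≠ 0 := fun h0 => by rw [h0] at pL; simp at pL
  have hDi : D = ML⁻¹ := eq_inv_of_mul_eq_one_right key
  -- D = ML⁻¹ has negative imaginary part and MR positive, so they cannot cancel.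
  have hne : D - MR / 2 ≠ 0 := by
    intro h0
    have := congrArg im h0
    rw [hDi, sub_im, inv_im, div_ofNat_im, zero_im, neg_div] at this
    have : 0 < ML.im / normSq ML := div_pos pL (normSq_pos.2 ML0)
    linarith
  have s2 := sq_ofReal_sqrt_two
  have s0 := ofReal_sqrt_two_ne_zero
  rw [hDi] at eG hne
  have hne2 : 2 - ML * MR ≠ 0 := by
    intro h0
    apply hne
    field_simp
    linear_combination h0
  -- The coefficients a and b solving the 2 × 2 system with root values ML/√2 and MR/√2.
  have h1 : 2 / (2 - ML * MR) + -(2 / (2 - ML * MR)) * (ML / √2) * uR [] = 1 := by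
    rw [hR0]
    field_simp
    rw [s2]
    ring
  have h2 : -(2 / (2 - ML * MR)) * (ML / √2) + 2 / (2 - ML * MR) * uL [] = 0 := by
    rw [hL0]; ring
  obtain ⟨u, hu, hu0⟩ := cayley_green_vector_eq hL hR h1 h2 hV
  refine ⟨u, hu, ?_⟩
  rw [hu0, hL0, eG]
  field_simp

end GreenVectors

/-! ### Spectral measures: mass, weak convergence, Poisson integrals. -/

noncomputable section SpectralMeasures

open Filter Topology

variable {E : Type*} [NormedAddCommGroup E] [InnerProductSpace ℂ E] [CompleteSpace E]

theorem abs_le_norm_of_mem_spectrum {H : E →L[ℂ] E} {x : ℝ} (hx : x ∈ spectrum ℝ H) :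
    |x| ≤ ‖H‖ := by
  have h := spectrum.subset_closedBall_norm_mul (𝕜 := ℝ) H hx
  rw [mem_closedBall_zero_iff, Real.norm_eq_abs] at h
  refine h.trans (mul_le_of_le_one_right (norm_nonneg _) ?_)
  exact ContinuousLinearMap.norm_id_le

theorem cfc_eq_one_of_eqOn {H : E →L[ℂ] E} (hH : IsSelfAdjoint H) {f : ℝ → ℝ} {R : ℝ}
    (hR : ‖H‖ ≤ R) (hf : ∀ x ∈ Icc (-R) R, f x = 1) : cfc f H = 1 := by
  rw [← cfc_one ℝ H]
  refine cfc_congr fun x hx => ?_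
  exact hf x (abs_le.1 ((abs_le_norm_of_mem_spectrum hx).trans hR))

theorem spectralFunctional_apply (H : E →L[ℂ] E) (ψ : E) (f : CompactlySupportedContinuousMap ℝ ℝ) :
    spectralFunctional H ψ f = (inner ℂ ψ ((cfc (f : ℝ → ℝ) H : E →L[ℂ] E) ψ)).re := rfl

/-- A continuous cutoff function. -/
theorem exists_cutoff (R : ℝ) : ∃ χ : CompactlySupportedContinuousMap ℝ ℝ,
    (∀ x ∈ Icc (-R) R, χ x = 1) ∧ (∀ x, 0 ≤ χ x ∧ χ x ≤ 1) ∧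
      tsupport χ ⊆ Icc (-(R + 1)) (R + 1) := by
  obtain ⟨f, h1, h0, hc, h01⟩ := exists_continuous_one_zero_of_isCompact
    (isCompact_Icc (a := -R) (b := R)) (isOpen_Ioo (a := -(R + 1)) (b := R + 1)).isClosed_compl
    (by
      rw [disjoint_compl_right_iff_subset]
      exact Icc_subset_Ioo (by linarith) (by linarith))
  refine ⟨⟨f, hc⟩, fun x hx => h1 hx, fun x => h01 x, ?_⟩
  refine closure_minimal (fun x hx => ?_) isClosed_Icc
  by_contra hn
  exact hx (h0 fun hx' => hn (Ioo_subset_Icc_self hx'))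

variable {H : E →L[ℂ] E} (hH : IsSelfAdjoint H) (ψ : E)

theorem spectralFunctional_of_eq_one (hH : IsSelfAdjoint H) {R : ℝ} (hR : ‖H‖ ≤ R)
    {χ : CompactlySupportedContinuousMap ℝ ℝ} (hχ : ∀ x ∈ Icc (-R) R, χ x = 1) :
    spectralFunctional H ψ χ = ‖ψ‖ ^ 2 := by
  rw [spectralFunctional_apply, cfc_eq_one_of_eqOn hH hR hχ, one_apply_eq_self,
    inner_self_eq_norm_sq_to_K]
  norm_cast

theorem spectralMeasure_univ_le (hH : IsSelfAdjoint H) :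
    spectralMeasure H ψ univ ≤ ENNReal.ofReal (‖ψ‖ ^ 2) := by
  have hmono : Monotone fun n : ℕ => Icc (-(n : ℝ)) n := fun m n h =>
    Icc_subset_Icc (by simpa using h) (by exact_mod_cast h)
  have hU : ⋃ n : ℕ, Icc (-(n : ℝ)) n = univ := by
    refine eq_univ_of_forall fun x => mem_iUnion.2 ?_
    obtain ⟨n, hn⟩ := exists_nat_ge |x|
    exact ⟨n, abs_le.1 hn⟩
  have hlim := tendsto_measure_iUnion_atTop (μ := spectralMeasure H ψ) hmono
  rw [hU] at hlim
  refine le_of_tendsto hlim ?_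
  filter_upwards [eventually_ge_atTop ⌈‖H‖⌉₊] with n hn
  have hnR : ‖H‖ ≤ n := Nat.ceil_le.1 hn
  obtain ⟨χ, h1, h01, -⟩ := exists_cutoff (n : ℝ)
  refine (RealRMK.rieszMeasure_le_of_eq_one (spectralFunctional H ψ) (fun x => (h01 x).1)
    isCompact_Icc h1).trans ?_
  rw [spectralFunctional_of_eq_one ψ hH hnR h1]

theorem isFiniteMeasure_spectralMeasure (hH : IsSelfAdjoint H) :
    IsFiniteMeasure (spectralMeasure H ψ) :=
  ⟨(spectralMeasure_univ_le ψ hH).trans_lt ENNReal.ofReal_lt_top⟩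

/-- A cutoff equal to 1 on the spectrum shows that the interval already has mass at least ‖ψ‖², the
upper bound for the total mass. -/
theorem spectralMeasure_compl_eq_zero (hH : IsSelfAdjoint H) {R : ℝ} (hR : ‖H‖ ≤ R) :
    spectralMeasure H ψ (Icc (-(R + 1)) (R + 1))ᶜ = 0 := by
  have := isFiniteMeasure_spectralMeasure ψ hH
  rw [measure_compl measurableSet_Icc (measure_ne_top _ _), tsub_eq_zero_iff_le]
  obtain ⟨χ, h1, h01, hs⟩ := exists_cutoff R
  refine (spectralMeasure_univ_le ψ hH).trans ?_
  rw [← spectralFunctional_of_eq_one ψ hH hR h1]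
  exact RealRMK.le_rieszMeasure_tsupport_subset (spectralFunctional H ψ) h01 hs

theorem ae_mem_Icc_spectralMeasure (hH : IsSelfAdjoint H) {R : ℝ} (hR : ‖H‖ ≤ R) :
    ∀ᵐ x ∂(spectralMeasure H ψ), x ∈ Icc (-(R + 1)) (R + 1) := by
  rw [ae_iff]
  exact spectralMeasure_compl_eq_zero ψ hH hR

/-- The representing property is known only for compactly supported functions. Multiplying f by a
cutoff changes neither the integral nor the functional calculus. -/
theorem integral_spectralMeasure (hH : IsSelfAdjoint H) {f : ℝ → ℝ} (hf : Continuous f) :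
    ∫ x, f x ∂(spectralMeasure H ψ) = (inner ℂ ψ ((cfc f H : E →L[ℂ] E) ψ)).re := by
  obtain ⟨χ, h1, h01, hs⟩ := exists_cutoff (‖H‖ + 1)
  have hcs : HasCompactSupport (fun x => χ x * f x) := χ.hasCompactSupport.mul_right
  set g : CompactlySupportedContinuousMap ℝ ℝ := ⟨⟨fun x => χ x * f x, by fun_prop⟩, hcs⟩ with hg
  have e1 : ∫ x, f x ∂(spectralMeasure H ψ) = ∫ x, g x ∂(spectralMeasure H ψ) := by
    refine integral_congr_ae ?_
    filter_upwards [ae_mem_Icc_spectralMeasure ψ hH le_rfl] with x hx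
    change f x = χ x * f x
    rw [h1 x hx, one_mul]
  rw [e1, spectralMeasure, RealRMK.integral_rieszMeasure, spectralFunctional_apply]
  congr 3
  refine cfc_congr fun x hx => ?_
  change χ x * f x = f x
  rw [h1 x, one_mul]
  have := abs_le.1 (abs_le_norm_of_mem_spectrum hx)
  exact ⟨by linarith [this.1], by linarith [this.2]⟩

theorem integrable_spectralMeasure (hH : IsSelfAdjoint H) {f : ℝ → ℝ} (hf : Continuous f) :
    Integrable f (spectralMeasure H ψ) := by
  have := isFiniteMeasure_spectralMeasure ψ hH
  obtain ⟨C, hC⟩ := (isCompact_Icc (a := -(‖H‖ + 1)) (b := ‖H‖ + 1)).exists_bound_of_continuousOn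
    hf.continuousOn
  refine Integrable.of_bound hf.aestronglyMeasurable C ?_
  filter_upwards [ae_mem_Icc_spectralMeasure ψ hH le_rfl] with x hx using hC x hx

/-- Weak convergence of spectral measures under strong convergence of operators. -/
theorem tendsto_integral_spectralMeasure (hH : IsSelfAdjoint H) {Hn : ℕ → E →L[ℂ] E}
    (hHn : ∀ n, IsSelfAdjoint (Hn n)) {R : ℝ} (hR : ‖H‖ ≤ R) (hRn : ∀ n, ‖Hn n‖ ≤ R)
    (hlim : ∀ u, Tendsto (fun n => Hn n u) atTop (𝓝 (H u))) {f : ℝ → ℝ} (hf : Continuous f) :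
    Tendsto (fun n => ∫ x, f x ∂(spectralMeasure (Hn n) ψ)) atTop
      (𝓝 (∫ x, f x ∂(spectralMeasure H ψ))) := by
  -- Products of strongly convergent operators converge strongly thanks to the uniform bound R on
  -- the norms.
  have hpow : ∀ (k : ℕ) (u : E), Tendsto (fun n => (Hn n ^ k) u) atTop (𝓝 ((H ^ k) u)) := by
    intro k
    induction k with
    | zero => intro u; simp
    | succ k ih =>
      intro u
      simp only [pow_succ', mul_apply_eq_comp]
      have a := hlim ((H ^ k) u)
      have b : Tendsto (fun n => Hn n ((Hn n ^ k) u - (H ^ k) u)) atTop (𝓝 0) := by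
        have hz : Tendsto (fun n => R * ‖(Hn n ^ k) u - (H ^ k) u‖) atTop (𝓝 0) := by
          have := (tendsto_iff_norm_sub_tendsto_zero.1 (ih u)).const_mul R
          simpa using this
        refine squeeze_zero_norm (fun n => ?_) hz
        refine ((Hn n).le_opNorm _).trans ?_
        gcongr
        exact hRn n
      have := a.add b
      simpa using this
  have hpoly : ∀ p : Polynomial ℝ, Tendsto (fun n => (Polynomial.aeval (Hn n) p) ψ) atTop
      (𝓝 ((Polynomial.aeval H p) ψ)) := by
    intro p
    induction p using Polynomial.induction_on' with
    | add p q hp hq =>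
      simp only [map_add, add_apply]
      exact hp.add hq
    | monomial k a =>
      simp only [Polynomial.aeval_monomial, mul_apply_eq_comp,
        Algebra.algebraMap_eq_smul_one, smul_apply,
        one_apply_eq_self]
      exact (hpow k ψ).const_smul a
  have hpi : ∀ p : Polynomial ℝ, Tendsto (fun n => ∫ x, p.eval x ∂(spectralMeasure (Hn n) ψ)) atTop
      (𝓝 (∫ x, p.eval x ∂(spectralMeasure H ψ))) := by
    intro p
    rw [integral_spectralMeasure ψ hH p.continuous, cfc_polynomial p H hH]
    simp_rw [fun n => integral_spectralMeasure ψ (hHn n) p.continuous,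
      fun n => cfc_polynomial p (Hn n) (hHn n)]
    exact (Complex.continuous_re.tendsto _).comp (tendsto_const_nhds.inner (hpoly p))
  have happrox : ∀ (T : E →L[ℂ] E), IsSelfAdjoint T → ‖T‖ ≤ R → ∀ (p : Polynomial ℝ) (δ : ℝ),
      0 ≤ δ → (∀ x ∈ Icc (-(R + 1)) (R + 1), |p.eval x - f x| ≤ δ) →
      |∫ x, p.eval x ∂(spectralMeasure T ψ) - ∫ x, f x ∂(spectralMeasure T ψ)| ≤ δ * ‖ψ‖ ^ 2 := by
    intro T hT hTR p δ hδ hp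
    have := isFiniteMeasure_spectralMeasure ψ hT
    rw [← integral_sub (integrable_spectralMeasure ψ hT p.continuous)
      (integrable_spectralMeasure ψ hT hf)]
    have h := norm_integral_le_of_norm_le_const (μ := spectralMeasure T ψ) (C := δ)
      (f := fun x => p.eval x - f x)
      ((ae_mem_Icc_spectralMeasure ψ hT hTR).mono fun x hx => hp x hx)
    refine h.trans ?_
    gcongr
    rw [measureReal_def]
    refine ENNReal.toReal_le_of_le_ofReal (by positivity) (spectralMeasure_univ_le ψ hT)
  rw [Metric.tendsto_atTop]
  intro ε hε
  -- Weierstrass approximation on an interval carrying all the measures: the two approximation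
  -- errors and the polynomial limit each cost at most ε/4.
  have hδ : 0 < ε / (4 * (‖ψ‖ ^ 2 + 1)) := by positivity
  obtain ⟨p, hp⟩ := exists_polynomial_near_of_continuousOn (-(R + 1)) (R + 1) f hf.continuousOn _ hδ
  obtain ⟨N, hN⟩ := Metric.tendsto_atTop.1 (hpi p) (ε / 4) (by positivity)
  refine ⟨N, fun n hn => ?_⟩
  have a := happrox H hH hR p _ hδ.le fun x hx => (hp x hx).le
  have b := happrox (Hn n) (hHn n) (hRn n) p _ hδ.le fun x hx => (hp x hx).le
  have c := hN n hn
  have d : ε / (4 * (‖ψ‖ ^ 2 + 1)) * ‖ψ‖ ^ 2 ≤ ε / 4 := by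
    rw [div_mul_eq_mul_div, div_le_div_iff₀ (by positivity) (by positivity)]
    nlinarith [sq_nonneg ‖ψ‖]
  rw [Real.dist_eq] at c ⊢
  rw [abs_le] at a b
  rw [abs_lt] at c ⊢
  constructor <;> linarith [a.1, a.2, b.1, b.2, c.1, c.2]

/-- The Poisson integral of a spectral measure is the imaginary part of the Green's function. -/
theorem integral_poisson_spectralMeasure (hH : IsSelfAdjoint H) {l y : ℝ} (hy : 0 < y) {u : E}
    (hu : H u - (l + y * Complex.I : ℂ) • u = ψ) :
    ∫ x, y / ((x - l) ^ 2 + y ^ 2) ∂(spectralMeasure H ψ) = (inner ℂ ψ u).im := by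
  have hpos : ∀ x : ℝ, 0 < (x - l) ^ 2 + y ^ 2 := fun x => by positivity
  have hcont : Continuous fun x : ℝ => y / ((x - l) ^ 2 + y ^ 2) :=
    continuous_const.div (by fun_prop) fun x => (hpos x).ne'
  rw [integral_spectralMeasure ψ hH hcont]
  set z : ℂ := l + y * Complex.I with hz
  set P : E →L[ℂ] E := cfc (fun x : ℝ => y / ((x - l) ^ 2 + y ^ 2)) H with hP
  have hsym : ∀ v w : E, inner ℂ (H v) w = inner ℂ v (H w) := fun v w => by
    rw [← ContinuousLinearMap.adjoint_inner_right, hH.adjoint_eq]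
  have hprod : ∀ v : E, P (H (H v) - (2 * l : ℂ) • H v + (l ^ 2 + y ^ 2 : ℂ) • v) = (y : ℂ) • v := by
    intro v
    set q : Polynomial ℝ := (Polynomial.X - Polynomial.C l) ^ 2 + Polynomial.C (y ^ 2) with hq
    have e1 : cfc (fun x : ℝ => y / ((x - l) ^ 2 + y ^ 2)) H * cfc (fun x => q.eval x) H =
        cfc (fun _ : ℝ => y) H := by
      rw [← cfc_mul _ _ H hcont.continuousOn q.continuous.continuousOn]
      refine cfc_congr fun x _ => ?_
      simp only [hq, Polynomial.eval_add, Polynomial.eval_pow, Polynomial.eval_sub,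
        Polynomial.eval_X, Polynomial.eval_C]
      exact div_mul_cancel₀ _ (hpos x).ne'
    rw [cfc_polynomial q H hH, cfc_const y H] at e1
    have e2 := congrArg (fun T : E →L[ℂ] E => T v) e1
    simp only [mul_apply_eq_comp, Algebra.algebraMap_eq_smul_one,
      smul_apply, one_apply_eq_self] at e2
    have e3 : (Polynomial.aeval H q) v =
        H (H v) - (2 * l : ℂ) • H v + (l ^ 2 + y ^ 2 : ℂ) • v := by
      have hr : ∀ (r : ℝ) (w : E), r • w = (r : ℂ) • w := fun r w => rfl
      have e4 : Polynomial.aeval H q = (H - l • (1 : E →L[ℂ] E)) * (H - l • (1 : E →L[ℂ] E)) +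
          (y ^ 2) • (1 : E →L[ℂ] E) := by
        rw [hq, map_add, map_pow, map_sub, Polynomial.aeval_X, Polynomial.aeval_C,
          Polynomial.aeval_C, Algebra.algebraMap_eq_smul_one, Algebra.algebraMap_eq_smul_one, pow_two]
      rw [e4]
      change H (H v - l • v) - l • (H v - l • v) + (y ^ 2) • v = _
      rw [hr, hr, hr, map_sub, map_smul]
      push_cast
      module
    rw [e3] at e2
    exact e2
  -- P is y((H - z̄)(H - z))⁻¹ and ψ = (H - z)u.
  have hψ2 : P (H ψ - (starRingEnd ℂ z) • ψ) = (y : ℂ) • u := by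
    rw [← hprod u, ← hu]
    congr 1
    have : starRingEnd ℂ z = l - y * Complex.I := by
      rw [hz]; simp; ring
    rw [this, map_sub, map_smul, hz]
    have hI : (Complex.I) ^ 2 = -1 := Complex.I_sq
    have : (l ^ 2 + y ^ 2 : ℂ) = (l - y * Complex.I) * (l + y * Complex.I) := by
      linear_combination ((y : ℂ) ^ 2) * hI
    rw [this]
    module
  have hcomm : ∀ v, P (H v) = H (P v) := by
    intro v
    have : Commute P H := by
      have h := cfc_commute_cfc (fun x : ℝ => y / ((x - l) ^ 2 + y ^ 2)) id H
      rwa [cfc_id ℝ H hH] at h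
    exact congrArg (fun T : E →L[ℂ] E => T v) this.eq
  have key : inner ℂ ψ (P ψ) = (y : ℂ) * inner ℂ u u := by
    have h1 : inner ℂ ψ (P ψ) = inner ℂ u (P (H ψ - (starRingEnd ℂ z) • ψ)) := by
      nth_rewrite 1 [← hu]
      rw [inner_sub_left, inner_smul_left, hsym, map_sub, map_smul, inner_sub_right,
        inner_smul_right, hcomm]
    rw [h1, hψ2, inner_smul_right]
  -- Both sides of the claim equal y‖u‖²: the left by `key`, the right because ⟨Hu, u⟩ is real and
  -- Im z̄ = -y.
  have h2 : inner ℂ ψ u = inner ℂ (H u) u - (starRingEnd ℂ z) * inner ℂ u u := by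
    rw [← hu, inner_sub_left, inner_smul_left]
  have h3 : (inner ℂ (H u) u).im = 0 := by
    have : starRingEnd ℂ (inner ℂ (H u) u) = inner ℂ (H u) u := by
      rw [inner_conj_symm, hsym]
    exact Complex.conj_eq_iff_im.1 this
  have h4 : (inner ℂ u u : ℂ).im = 0 := inner_self_im (𝕜 := ℂ) u
  rw [key, h2, Complex.sub_im, h3, Complex.mul_im, h4, Complex.re_ofReal_mul]
  simp [hz]

end SpectralMeasures

/-! ### From boundary values of the Green's function to the variational inequality. -/

noncomputable section BoundaryValues

open Filter Topology

theorem lintegral_poisson_eq {f : ℝ → ℝ} {x y : ℝ} (hy : 0 < y) :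
    ∫⁻ l, ENNReal.ofReal (f l) * ENNReal.ofReal (y / ((x - l) ^ 2 + y ^ 2)) =
      ∫⁻ s, ENNReal.ofReal (f (x + y * s)) * ENNReal.ofReal ((1 + s ^ 2)⁻¹) := by
  have hinj : InjOn (fun s : ℝ => x + y * s) univ := fun a _ b _ h => by
    have h' : x + y * a = x + y * b := h
    exact mul_left_cancel₀ hy.ne' (by linarith)
  have himg : (fun s : ℝ => x + y * s) '' univ = univ := by
    refine eq_univ_of_forall fun l => ⟨(l - x) / y, trivial, ?_⟩
    field_simp
    ring
  have h := lintegral_image_eq_lintegral_abs_deriv_mul (s := univ) (f := fun s : ℝ => x + y * s)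
    (f' := fun _ => y) MeasurableSet.univ
    (fun s _ => by
      have := ((hasDerivAt_id s).const_mul y).const_add x
      simp only [mul_one] at this
      exact this.hasDerivWithinAt) hinj
    (fun l => ENNReal.ofReal (f l) * ENNReal.ofReal (y / ((x - l) ^ 2 + y ^ 2)))
  rw [himg] at h
  simp only [Measure.restrict_univ] at h
  rw [h]
  refine lintegral_congr fun s => ?_
  rw [abs_of_pos hy, mul_left_comm, ← ENNReal.ofReal_mul hy.le]
  congr 2
  have : (1 : ℝ) + s ^ 2 ≠ 0 := by positivity
  have : (x - (x + y * s)) ^ 2 + y ^ 2 ≠ 0 := by positivity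
  field_simp
  ring

theorem lintegral_inv_one_add_sq :
    ∫⁻ s : ℝ, ENNReal.ofReal ((1 + s ^ 2)⁻¹) = ENNReal.ofReal Real.pi := by
  rw [← integral_univ_inv_one_add_sq, ofReal_integral_eq_lintegral_ofReal integrable_inv_one_add_sq
    (ae_of_all _ fun s => by positivity)]

/-- Boundary values of the Poisson integral of a measure, integrated against a test function, are
dominated by the measure. -/
theorem lintegral_poisson_boundary_le {σ : Measure ℝ} [IsFiniteMeasure σ] {f : ℝ → ℝ}
    (hf : Continuous f) {B : ℝ} (hB : ∀ x, f x ≤ B) {g : ℝ → ℝ} {J : Set ℝ}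
    (hJ : MeasurableSet J)
    (hg : ∀ l ∈ J, Tendsto (fun y => ∫ x, y / ((x - l) ^ 2 + y ^ 2) ∂σ) (𝓝[>] 0) (𝓝 (g l))) :
    ∫⁻ l in J, ENNReal.ofReal (f l) * ENNReal.ofReal (g l) ≤
      ENNReal.ofReal Real.pi * ∫⁻ x, ENNReal.ofReal (f x) ∂σ := by
  set Y : ℕ → ℝ := fun n => 1 / ((n : ℝ) + 1) with hY
  have hYpos : ∀ n, 0 < Y n := fun n => by positivity
  have hY0 : Tendsto Y atTop (𝓝 0) := tendsto_one_div_add_atTop_nhds_zero_nat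
  have hYt : Tendsto Y atTop (𝓝[>] 0) :=
    tendsto_nhdsWithin_iff.2 ⟨hY0, Eventually.of_forall hYpos⟩
  set P : ℕ → ℝ → ℝ → ℝ := fun n l x => Y n / ((x - l) ^ 2 + Y n ^ 2) with hP
  have hden : ∀ n (l x : ℝ), 0 < (x - l) ^ 2 + Y n ^ 2 := fun n l x => by
    have := hYpos n; positivity
  have hPc : ∀ n, Continuous fun p : ℝ × ℝ => P n p.1 p.2 := fun n =>
    continuous_const.div (by fun_prop) fun p => (hden n p.1 p.2).ne'
  have hP0 : ∀ n l x, 0 ≤ P n l x := fun n l x => div_nonneg (hYpos n).le (hden n l x).le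
  have hPi : ∀ n l, ENNReal.ofReal (∫ x, P n l x ∂σ) = ∫⁻ x, ENNReal.ofReal (P n l x) ∂σ := by
    intro n l
    refine ofReal_integral_eq_lintegral_ofReal ?_ (ae_of_all _ fun x => hP0 n l x)
    refine Integrable.of_bound ((hPc n).comp (Continuous.prodMk_right l)).aestronglyMeasurable
      (1 / Y n) (ae_of_all _ fun x => ?_)
    rw [Real.norm_of_nonneg (hP0 n l x), div_le_div_iff₀ (hden n l x) (hYpos n)]
    nlinarith [sq_nonneg (x - l)]
  have hmeas : ∀ n, Measurable fun p : ℝ × ℝ =>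
      ENNReal.ofReal (f p.1) * ENNReal.ofReal (P n p.1 p.2) := fun n =>
    ((hf.comp continuous_fst).measurable.ennreal_ofReal).mul (hPc n).measurable.ennreal_ofReal
  -- Fatou's lemma as the height tends to 0. Since only an upper bound by σ is wanted, the singular
  -- part of σ needs no separate treatment.
  have step1 : ∫⁻ l in J, ENNReal.ofReal (f l) * ENNReal.ofReal (g l) ≤
      liminf (fun n => ∫⁻ l, ∫⁻ x, ENNReal.ofReal (f l) * ENNReal.ofReal (P n l x) ∂σ) atTop := by
    have e : ∀ l ∈ J, ENNReal.ofReal (f l) * ENNReal.ofReal (g l) =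
        liminf (fun n => ∫⁻ x, ENNReal.ofReal (f l) * ENNReal.ofReal (P n l x) ∂σ) atTop := by
      intro l hl
      refine Tendsto.liminf_eq ?_ |>.symm
      have h1 := ENNReal.Tendsto.const_mul (a := ENNReal.ofReal (f l))
        (ENNReal.tendsto_ofReal ((hg l hl).comp hYt)) (Or.inr ENNReal.ofReal_ne_top)
      refine h1.congr fun n => ?_
      rw [lintegral_const_mul' _ _ ENNReal.ofReal_ne_top]
      congr 1
      exact hPi n l
    rw [setLIntegral_congr_fun hJ e]
    refine (lintegral_liminf_le fun n => (hmeas n).lintegral_prod_right').trans ?_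
    refine liminf_le_liminf (Eventually.of_forall fun n => ?_)
    exact lintegral_mono' Measure.restrict_le_self le_rfl
  refine step1.trans (le_of_eq ?_)
  -- After exchanging the integrals, the inner one is a Cauchy average of f around x, of total
  -- weight π.
  have step2 : ∀ n, ∫⁻ l, ∫⁻ x, ENNReal.ofReal (f l) * ENNReal.ofReal (P n l x) ∂σ =
      ∫⁻ x, (∫⁻ s, ENNReal.ofReal (f (x + Y n * s)) * ENNReal.ofReal ((1 + s ^ 2)⁻¹)) ∂σ := by
    intro n
    rw [lintegral_lintegral_swap (hmeas n).aemeasurable]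
    exact lintegral_congr fun x => lintegral_poisson_eq (hYpos n)
  simp_rw [step2]
  have hinv : Measurable fun s : ℝ => ENNReal.ofReal ((1 + s ^ 2)⁻¹) := by fun_prop
  have inner : ∀ x, Tendsto (fun n => ∫⁻ s, ENNReal.ofReal (f (x + Y n * s)) *
      ENNReal.ofReal ((1 + s ^ 2)⁻¹)) atTop (𝓝 (ENNReal.ofReal Real.pi * ENNReal.ofReal (f x))) := by
    intro x
    rw [mul_comm, ← lintegral_inv_one_add_sq, ← lintegral_const_mul _ hinv]
    refine tendsto_lintegral_filter_of_dominated_convergence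
      (fun s => ENNReal.ofReal B * ENNReal.ofReal ((1 + s ^ 2)⁻¹)) ?_ ?_ ?_ ?_
    · refine Eventually.of_forall fun n => Measurable.mul ?_ hinv
      exact (hf.comp (by fun_prop)).measurable.ennreal_ofReal
    · refine Eventually.of_forall fun n => ae_of_all _ fun s => ?_
      gcongr
      exact hB _
    · rw [lintegral_const_mul _ hinv, lintegral_inv_one_add_sq]
      exact ENNReal.mul_ne_top ENNReal.ofReal_ne_top ENNReal.ofReal_ne_top
    · refine ae_of_all _ fun s => ?_
      refine ENNReal.Tendsto.mul_const (ENNReal.tendsto_ofReal ?_) (Or.inr ENNReal.ofReal_ne_top)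
      have : Tendsto (fun n => x + Y n * s) atTop (𝓝 (x + 0 * s)) :=
        (hY0.mul_const s).const_add x
      rw [zero_mul, add_zero] at this
      exact (hf.tendsto x).comp this
  rw [← lintegral_const_mul _ hf.measurable.ennreal_ofReal]
  refine Tendsto.liminf_eq ?_
  refine tendsto_lintegral_filter_of_dominated_convergence
    (fun _ => ENNReal.ofReal B * ENNReal.ofReal Real.pi) ?_ ?_ ?_ (ae_of_all _ inner)
  · refine Eventually.of_forall fun n => Measurable.lintegral_prod_right' (f := fun p : ℝ × ℝ =>
      ENNReal.ofReal (f (p.1 + Y n * p.2)) * ENNReal.ofReal ((1 + p.2 ^ 2)⁻¹)) ?_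
    exact (hf.comp (by fun_prop)).measurable.ennreal_ofReal.mul (hinv.comp measurable_snd)
  · refine Eventually.of_forall fun n => ae_of_all _ fun x => ?_
    rw [← lintegral_inv_one_add_sq, ← lintegral_const_mul _ hinv]
    refine lintegral_mono fun s => ?_
    gcongr
    exact hB _
  · rw [lintegral_const]
    exact ENNReal.mul_ne_top (ENNReal.mul_ne_top ENNReal.ofReal_ne_top ENNReal.ofReal_ne_top)
      (measure_ne_top _ _)

/-! ### The spectral parameter near the real axis -/

open Complex (I exp normSq)

theorem spectralParameter_im (ζ : ℂ) :
    (spectralParameter ζ).im = -√2 * (ζ⁻¹ + ζ).im := by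
  rw [spectralParameter, ← Complex.ofReal_neg, Complex.im_ofReal_mul, add_comm]

/-- The solutions of the quadratic equation are w and w⁻¹, and Im z > 0 means Im w · (|w|² - 1) < 0.
Hence w or w⁻¹ lies in the upper half disc, according to the sign of Im w. -/
theorem exists_spectralParameter_eq {z : ℂ} (hz : 0 < z.im) :
    ∃ ζ ∈ openHalfDisc, spectralParameter ζ = z := by
  have s2 := sq_ofReal_sqrt_two
  have s0 := ofReal_sqrt_two_ne_zero
  have hsq : (0 : ℝ) < √2 := by positivity
  obtain ⟨s, hs⟩ := IsAlgClosed.exists_pow_nat_eq ((z / (√2 : ℂ)) ^ 2 - 4) (n := 2) (by norm_num)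
  set w : ℂ := (-(z / (√2 : ℂ)) + s) / 2 with hw
  have hquad : w ^ 2 + z / (√2 : ℂ) * w + 1 = 0 := by
    rw [hw]; linear_combination hs / 4
  have w0 : w ≠ 0 := fun h => by rw [h] at hquad; simp at hquad
  have hsum : w + w⁻¹ = -(z / (√2 : ℂ)) := by
    field_simp
    field_simp at hquad
    linear_combination hquad
  have hsp : spectralParameter w = z := by
    rw [spectralParameter, hsum]; field_simp
  have hsp' : spectralParameter w⁻¹ = z := by
    rw [← hsp, spectralParameter, spectralParameter, inv_inv, add_comm]
  have n0 : 0 < normSq w := Complex.normSq_pos.2 w0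
  have him : w.im * (normSq w - 1) < 0 := by
    have h := spectralParameter_im w
    rw [hsp, Complex.add_im, Complex.inv_im] at h
    have h2 : (-w.im / normSq w + w.im) < 0 := by nlinarith
    have h3 : (-w.im / normSq w + w.im) * normSq w = w.im * (normSq w - 1) := by
      field_simp; ring
    rw [← h3]
    exact mul_neg_of_neg_of_pos h2 n0
  have hnn : normSq w = ‖w‖ ^ 2 := Complex.normSq_eq_norm_sq w
  rcases lt_or_ge 0 w.im with hi | hi
  · refine ⟨w, ⟨?_, hi⟩, hsp⟩
    have : normSq w < 1 := by nlinarith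
    nlinarith [norm_nonneg w]
  · have h1 : 1 < normSq w := by nlinarith
    have hi' : w.im < 0 := by nlinarith
    refine ⟨w⁻¹, ⟨?_, ?_⟩, hsp'⟩
    · rw [norm_inv]
      refine inv_lt_one_of_one_lt₀ ?_
      nlinarith [norm_nonneg w]
    · rw [Complex.inv_im]
      exact div_pos (by linarith) n0

/-- With e = exp(iθ), (ζ - e)(ζ - e⁻¹) = -iyζ/√2, and the second factor has modulus at least sin θ
because e⁻¹ lies that far below the real axis. -/
theorem norm_sub_arc_le {θ y : ℝ} (hθ : θ ∈ Ioo 0 Real.pi) (hy : 0 < y) {ζ : ℂ}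
    (hζ : ζ ∈ openHalfDisc)
    (h : spectralParameter ζ = ((-(2 * √2) * Real.cos θ : ℝ) : ℂ) + y * I) :
    ‖ζ - exp (θ * I)‖ ≤ y / Real.sin θ := by
  have s2 := sq_ofReal_sqrt_two
  have s0 := ofReal_sqrt_two_ne_zero
  have hs := Real.sin_pos_of_mem_Ioo hθ
  have h0 : ζ ≠ 0 := fun h' => by have := hζ.2; simp [h'] at this
  set e := exp (θ * I) with he
  have hsum := inv_add_self_arc θ
  rw [← he] at hsum
  have e0 : e ≠ 0 := Complex.exp_ne_zero _
  have hcos : (2 * Real.cos θ : ℝ) = (2 : ℂ) * Real.cos θ := by push_cast; ring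
  rw [hcos] at hsum
  have hprod : (ζ - e) * (ζ - e⁻¹) = -(y * I * ζ) / √2 := by
    have hee : e * e⁻¹ = 1 := mul_inv_cancel₀ e0
    have h' : (ζ + ζ⁻¹) = 2 * Real.cos θ - y * I / √2 := by
      rw [spectralParameter] at h
      push_cast at h
      field_simp
      have : (√2 : ℂ) * (ζ + ζ⁻¹) = 2 * √2 * Real.cos θ - y * I := by
        push_cast
        linear_combination -h
      field_simp at this
      linear_combination this
    have h3 : ζ * (ζ + ζ⁻¹) = ζ ^ 2 + 1 := by field_simp
    rw [h'] at h3
    linear_combination hee - ζ * hsum - h3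
  have hlow : Real.sin θ ≤ ‖ζ - e⁻¹‖ := by
    have e1 : (e⁻¹).im = -Real.sin θ := by
      rw [he, ← Complex.exp_neg, ← neg_mul, ← Complex.ofReal_neg, Complex.exp_ofReal_mul_I_im,
        Real.sin_neg]
    have := Complex.abs_im_le_norm (ζ - e⁻¹)
    rw [Complex.sub_im, e1] at this
    have := le_abs_self (ζ.im - -Real.sin θ)
    linarith [hζ.2]
  rw [le_div_iff₀ hs]
  have hs2 : (1 : ℝ) ≤ √2 := by
    rw [show (1 : ℝ) = √1 by simp]
    exact Real.sqrt_le_sqrt (by norm_num)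
  calc ‖ζ - e‖ * Real.sin θ ≤ ‖ζ - e‖ * ‖ζ - e⁻¹‖ := by gcongr
    _ = y * ‖ζ‖ / √2 := by
        rw [← norm_mul, hprod, norm_div, norm_neg, norm_mul, norm_mul, Complex.norm_I,
          Complex.norm_real, Complex.norm_real, Real.norm_of_nonneg hy.le,
          Real.norm_of_nonneg (by positivity : (0 : ℝ) ≤ √2), mul_one]
    _ ≤ y * 1 / 1 := by
        gcongr
        exact hζ.1.le
    _ = y := by ring

/-! ### The entropy inequality, tested against continuous functions -/

/-- The energy that corresponds to the boundary point `exp (i θ)`. -/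
def arcEnergy (θ : ℝ) : ℝ := -(2 * √2) * Real.cos θ

theorem hasDerivAt_arcEnergy (θ : ℝ) : HasDerivAt arcEnergy (2 * √2 * Real.sin θ) θ := by
  have := (Real.hasDerivAt_cos θ).const_mul (-(2 * √2))
  convert! this using 1
  ring

theorem injOn_arcEnergy : InjOn arcEnergy (Ioo 0 Real.pi) := fun a ha b hb h => by
  have h' : Real.cos a = Real.cos b := by
    unfold arcEnergy at h
    exact mul_left_cancel₀ (by simp) h
  exact Real.injOn_cos (Ioo_subset_Icc_self ha) (Ioo_subset_Icc_self hb) h'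

theorem image_arcEnergy : arcEnergy '' Ioo 0 Real.pi = Ioo (-(2 * √2)) (2 * √2) := by
  have h2 : (0 : ℝ) < 2 * √2 := by positivity
  ext l
  constructor
  · rintro ⟨θ, hθ, rfl⟩
    have h1 : Real.cos θ < 1 := by
      have := Real.cos_lt_cos_of_nonneg_of_le_pi le_rfl hθ.2.le hθ.1
      rwa [Real.cos_zero] at this
    have h3 : -1 < Real.cos θ := by
      have := Real.cos_lt_cos_of_nonneg_of_le_pi hθ.1.le le_rfl hθ.2
      rwa [Real.cos_pi] at this
    unfold arcEnergy
    constructor <;> nlinarith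
  · intro hl
    have a1 : -1 < -l / (2 * √2) := by rw [lt_div_iff₀ h2]; linarith [hl.2]
    have a2 : -l / (2 * √2) < 1 := by rw [div_lt_iff₀ h2]; linarith [hl.1]
    refine ⟨Real.arccos (-l / (2 * √2)), ⟨Real.arccos_pos.2 a2, ?_⟩, ?_⟩
    · refine lt_of_le_of_ne (Real.arccos_le_pi _) fun h => ?_
      have := Real.arccos_eq_pi.1 h
      linarith
    · rw [arcEnergy, Real.cos_arccos a1.le a2.le]
      field_simp

variable {E : Type*} [NormedAddCommGroup E] [InnerProductSpace ℂ E] [CompleteSpace E]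

/-- The function `S`, divided by `√2`, is the Green's function of `H` at the vector `ψ`. -/
def IsGreenFunction (H : E →L[ℂ] E) (ψ : E) (S : ℂ → ℂ) : Prop :=
  ∀ ζ ∈ openHalfDisc, ∃ u : E, H u - spectralParameter ζ • u = ψ ∧ inner ℂ ψ u = S ζ / (√2 : ℂ)

variable {k : ℝ} {S : ℝ → ℂ → ℂ}

/-- As the energy descends vertically to the real axis, ζ tends to exp(iθ) by `norm_sub_arc_le`, and
S 0 is continuous there. -/
theorem IsGreenFunction.tendsto_poisson {H : E →L[ℂ] E} (hH : IsSelfAdjoint H) {ψ : E}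
    (hS : HerglotzFamily k S) (hG : IsGreenFunction H ψ (S 0)) {θ : ℝ} (hθ : θ ∈ Ioo 0 Real.pi) :
    Tendsto (fun y => ∫ x, y / ((x - arcEnergy θ) ^ 2 + y ^ 2) ∂(spectralMeasure H ψ)) (𝓝[>] 0)
      (𝓝 ((S 0 (exp (θ * I))).im / √2)) := by
  have hex : ∀ y : ℝ, ∃ ζ : ℂ, 0 < y →
      ζ ∈ openHalfDisc ∧ spectralParameter ζ = (arcEnergy θ : ℂ) + y * I := by
    intro y
    by_cases hy : 0 < y
    · obtain ⟨ζ, h1, h2⟩ := exists_spectralParameter_eq (z := (arcEnergy θ : ℂ) + y * I)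
        (by simpa using hy)
      exact ⟨ζ, fun _ => ⟨h1, h2⟩⟩
    · exact ⟨0, fun h => absurd h hy⟩
  choose Z hZ using hex
  have hs := Real.sin_pos_of_mem_Ioo hθ
  have hZt : Tendsto Z (𝓝[>] 0) (𝓝 (exp (θ * I))) := by
    rw [tendsto_iff_norm_sub_tendsto_zero]
    have hz : Tendsto (fun y : ℝ => y / Real.sin θ) (𝓝[>] 0) (𝓝 0) := by
      have : Tendsto (fun y : ℝ => y / Real.sin θ) (𝓝 0) (𝓝 (0 / Real.sin θ)) :=
        tendsto_id.div_const _
      rw [zero_div] at this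
      exact this.mono_left nhdsWithin_le_nhds
    refine squeeze_zero' (Eventually.of_forall fun _ => norm_nonneg _) ?_ hz
    filter_upwards [self_mem_nhdsWithin] with y hy
    exact norm_sub_arc_le hθ hy (hZ y hy).1 (hZ y hy).2
  have hSt := ((Complex.continuous_im.tendsto _).comp
    ((hS.continuousAt_arc θ hθ).tendsto.comp hZt)).div_const √2
  refine hSt.congr' ?_
  filter_upwards [self_mem_nhdsWithin] with y hy
  obtain ⟨u, hu, hu2⟩ := hG _ (hZ y hy).1
  rw [(hZ y hy).2] at hu
  rw [integral_poisson_spectralMeasure ψ hH hy hu, hu2, Complex.div_ofReal_im]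
  rfl

/-- The boundary density is Im S/√2 up to π, and the change of variables to θ contributes the
Jacobian 2√2 sin θ. -/
theorem IsGreenFunction.lintegral_arc_le {H : E →L[ℂ] E} (hH : IsSelfAdjoint H) {ψ : E}
    (hS : HerglotzFamily k S) (hG : IsGreenFunction H ψ (S 0)) {f : ℝ → ℝ} (hf : Continuous f)
    (hf0 : ∀ x, 0 ≤ f x) {B : ℝ} (hB : ∀ x, f x ≤ B) :
    ∫⁻ θ in Ioo 0 Real.pi,
      ENNReal.ofReal (f (arcEnergy θ) * (2 * (S 0 (exp (θ * I))).im * Real.sin θ)) ≤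
      ENNReal.ofReal (Real.pi * ∫ x, f x ∂(spectralMeasure H ψ)) := by
  have := isFiniteMeasure_spectralMeasure ψ hH
  set g : ℝ → ℝ := fun l => (S 0 (exp (Real.arccos (-l / (2 * √2)) * I))).im / √2 with hg
  have hgθ : ∀ θ ∈ Ioo 0 Real.pi, g (arcEnergy θ) = (S 0 (exp (θ * I))).im / √2 := by
    intro θ hθ
    have : -arcEnergy θ / (2 * √2) = Real.cos θ := by
      unfold arcEnergy; field_simp
    simp only [hg]
    rw [this, Real.arccos_cos hθ.1.le hθ.2.le]
  have key := lintegral_poisson_boundary_le (σ := spectralMeasure H ψ) hf hB (g := g)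
    (J := Ioo (-(2 * √2)) (2 * √2)) measurableSet_Ioo (fun l hl => by
      rw [← image_arcEnergy] at hl
      obtain ⟨θ, hθ, rfl⟩ := hl
      rw [hgθ θ hθ]
      exact hG.tendsto_poisson hH hS hθ)
  rw [← image_arcEnergy, lintegral_image_eq_lintegral_abs_deriv_mul measurableSet_Ioo
    (fun θ _ => (hasDerivAt_arcEnergy θ).hasDerivWithinAt) injOn_arcEnergy,
    ← ofReal_integral_eq_lintegral_ofReal (integrable_spectralMeasure ψ hH hf)
      (ae_of_all _ hf0), ← ENNReal.ofReal_mul Real.pi_pos.le] at key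
  refine le_trans (le_of_eq ?_) key
  refine setLIntegral_congr_fun measurableSet_Ioo fun θ hθ => ?_
  have hs := Real.sin_pos_of_mem_Ioo hθ
  rw [hgθ θ hθ, abs_of_nonneg (by positivity), ← ENNReal.ofReal_mul (hf0 _),
    ← ENNReal.ofReal_mul (by positivity)]
  congr 1
  field_simp

/-- The variational form of the entropy bound. -/
theorem IsGreenFunction.entropy_le {H : E →L[ℂ] E} (hH : IsSelfAdjoint H) {ψ : E}
    (hS : HerglotzFamily k S) (hG : IsGreenFunction H ψ (S 0)) {f : ℝ → ℝ} (hf : Continuous f)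
    {η B : ℝ} (hη : 0 < η) (hfη : ∀ x, η ≤ f x) (hB : ∀ x, f x ≤ B) :
    arcEntropy (S 0) + 2 / Real.pi * ∫ θ in (0 : ℝ)..Real.pi,
      Real.log (f (arcEnergy θ)) * Real.sin θ ^ 2 ≤ ∫ x, f x ∂(spectralMeasure H ψ) - 1 := by
  have hpi := Real.pi_pos
  have hf0 : ∀ x, 0 ≤ f x := fun x => hη.le.trans (hfη x)
  have hlint := hG.lintegral_arc_le hH hS hf hf0 hB
  set F : ℝ → ℝ := fun θ => f (arcEnergy θ) * (2 * (S 0 (exp (θ * I))).im * Real.sin θ) with hF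
  have hcE : Continuous arcEnergy := by unfold arcEnergy; fun_prop
  have hFc : ContinuousOn F (Ioo 0 Real.pi) := by
    refine ((hf.comp hcE).continuousOn).mul (ContinuousOn.mul (continuousOn_const.mul ?_)
      (by fun_prop))
    exact Complex.continuous_im.comp_continuousOn hS.continuousOn_arc
  have hF0 : ∀ θ ∈ Ioo 0 Real.pi, 0 ≤ F θ := fun θ hθ => by
    have := (hS.im_arc_pos zero_mem_Icc_zero_one hθ).le
    have := (Real.sin_pos_of_mem_Ioo hθ).le
    have := hf0 (arcEnergy θ)
    simp only [hF]
    positivity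
  have hFm := hFc.aestronglyMeasurable (μ := volume) measurableSet_Ioo
  have hF0' : 0 ≤ᵐ[volume.restrict (Ioo 0 Real.pi)] F :=
    (ae_restrict_mem measurableSet_Ioo).mono hF0
  have hFi : Integrable F (volume.restrict (Ioo 0 Real.pi)) := by
    refine ⟨hFm, ?_⟩
    rw [hasFiniteIntegral_iff_ofReal hF0']
    exact hlint.trans_lt ENNReal.ofReal_lt_top
  have hFle : ∫ θ in (0 : ℝ)..Real.pi, F θ ≤ Real.pi * ∫ x, f x ∂(spectralMeasure H ψ) := by
    rw [intervalIntegral.integral_of_le hpi.le, integral_Ioc_eq_integral_Ioo,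
      integral_eq_lintegral_of_nonneg_ae hF0' hFm]
    exact ENNReal.toReal_le_of_le_ofReal
      (mul_nonneg hpi.le (integral_nonneg fun x => hf0 x)) hlint
  have hFii : IntervalIntegrable F volume 0 Real.pi := by
    rw [intervalIntegrable_iff_integrableOn_Ioo_of_le hpi.le]
    exact hFi
  have i1 := hS.intervalIntegrable_log_im
  have i2 : IntervalIntegrable (fun θ => Real.log (f (arcEnergy θ)) * Real.sin θ ^ 2)
      volume 0 Real.pi := by
    refine Continuous.intervalIntegrable (Continuous.mul ?_ (by fun_prop)) _ _
    exact (hf.comp hcE).log fun θ => (hη.trans_le (hfη _)).ne'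
  have i3 : IntervalIntegrable (fun θ => Real.sin θ ^ 2) volume 0 Real.pi :=
    Continuous.intervalIntegrable (by fun_prop) _ _
  -- Pointwise this is log x ≤ x - 1 at x = (Im S / sin θ) f, the relative density times the test
  -- function.
  have main : ∫ θ in (0 : ℝ)..Real.pi,
      (Real.log ((S 0 (exp (θ * I))).im / Real.sin θ) * Real.sin θ ^ 2 +
        Real.log (f (arcEnergy θ)) * Real.sin θ ^ 2) ≤
      ∫ θ in (0 : ℝ)..Real.pi, (2⁻¹ * F θ - Real.sin θ ^ 2) := by
    refine intervalIntegral.integral_mono_on_of_le_Ioo hpi.le (i1.add i2)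
      ((hFii.const_mul _).sub i3) fun θ hθ => ?_
    have s0 := Real.sin_pos_of_mem_Ioo hθ
    have a := hS.im_arc_pos zero_mem_Icc_zero_one hθ
    have b : 0 < f (arcEnergy θ) := hη.trans_le (hfη _)
    rw [← add_mul, ← Real.log_mul (div_pos a s0).ne' b.ne']
    have hl := Real.log_le_sub_one_of_pos (mul_pos (div_pos a s0) b)
    calc _ ≤ ((S 0 (exp (θ * I))).im / Real.sin θ * f (arcEnergy θ) - 1) * Real.sin θ ^ 2 := by
          gcongr
      _ = _ := by simp only [hF]; field_simp
  rw [intervalIntegral.integral_add i1 i2, intervalIntegral.integral_sub (hFii.const_mul _) i3,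
    intervalIntegral.integral_const_mul] at main
  have e := two_div_pi_mul_integral_sin_sq
  have hp2 : (0 : ℝ) < 2 / Real.pi := by positivity
  rw [arcEntropy, ← mul_add]
  refine (mul_le_mul_of_nonneg_left main hp2.le).trans ?_
  rw [mul_sub, e]
  have : 2 / Real.pi * (2⁻¹ * ∫ θ in (0 : ℝ)..Real.pi, F θ) ≤
      2 / Real.pi * (2⁻¹ * (Real.pi * ∫ x, f x ∂(spectralMeasure H ψ))) := by gcongr
  have e2 : 2 / Real.pi * (2⁻¹ * (Real.pi * ∫ x, f x ∂(spectralMeasure H ψ))) =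
      ∫ x, f x ∂(spectralMeasure H ψ) := by field_simp
  linarith

end BoundaryValues

/-! ### From the variational inequality to the entropy of the absolutely continuous part. -/

noncomputable section Variational

open Filter Topology

/-! ### The reference measure -/

theorem freeDensity_pos {l : ℝ} (hl : l ∈ Ioo (-(2 * √2)) (2 * √2)) : 0 < freeDensity l := by
  have h : 0 < 8 - l ^ 2 := by
    have : (2 * √2) ^ 2 = 8 := by rw [mul_pow, Real.sq_sqrt zero_le_two]; norm_num
    nlinarith [hl.1, hl.2]
  exact mul_pos (inv_pos.2 (by positivity)) (Real.sqrt_pos.2 h)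

theorem continuous_freeDensity : Continuous freeDensity := by
  unfold freeDensity; fun_prop

theorem freeDensity_nonneg (l : ℝ) : 0 ≤ freeDensity l := by
  unfold freeDensity; positivity

theorem freeMeasure_eq_restrict_Ioo : freeMeasure =
    (volume.restrict (Ioo (-(2 * √2)) (2 * √2))).withDensity
      fun l => ENNReal.ofReal (freeDensity l) := by
  rw [freeMeasure, Measure.restrict_congr_set Ioo_ae_eq_Icc.symm]

theorem freeMeasure_absolutelyContinuous :
    freeMeasure ≪ volume.restrict (Ioo (-(2 * √2)) (2 * √2)) := by
  rw [freeMeasure_eq_restrict_Ioo]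
  exact withDensity_absolutelyContinuous _ _

theorem freeDensity_arcEnergy {θ : ℝ} (hθ : θ ∈ Ioo 0 Real.pi) :
    2 * √2 * Real.sin θ * freeDensity (arcEnergy θ) = 2 / Real.pi * Real.sin θ ^ 2 := by
  have hs := Real.sin_pos_of_mem_Ioo hθ
  have h : 8 - arcEnergy θ ^ 2 = (2 * √2 * Real.sin θ) ^ 2 := by
    rw [arcEnergy, mul_pow, mul_pow, neg_sq, mul_pow, Real.sq_sqrt zero_le_two, Real.sin_sq]
    ring
  rw [freeDensity, h, Real.sqrt_sq (by positivity)]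
  have : √2 ^ 2 = 2 := Real.sq_sqrt zero_le_two
  field_simp
  rw [this]; ring

theorem integral_freeMeasure (F : ℝ → ℝ) : ∫ l, F l ∂freeMeasure =
    2 / Real.pi * ∫ θ in (0 : ℝ)..Real.pi, F (arcEnergy θ) * Real.sin θ ^ 2 := by
  rw [freeMeasure_eq_restrict_Ioo, integral_withDensity_eq_integral_toReal_smul
    continuous_freeDensity.measurable.ennreal_ofReal (ae_of_all _ fun _ => ENNReal.ofReal_lt_top),
    ← image_arcEnergy, integral_image_eq_integral_abs_deriv_smul measurableSet_Ioo
    (fun θ _ => (hasDerivAt_arcEnergy θ).hasDerivWithinAt) injOn_arcEnergy,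
    ← intervalIntegral.integral_const_mul, intervalIntegral.integral_of_le Real.pi_pos.le,
    integral_Ioc_eq_integral_Ioo]
  refine setIntegral_congr_fun measurableSet_Ioo fun θ hθ => ?_
  have hs := Real.sin_pos_of_mem_Ioo hθ
  have := freeDensity_arcEnergy hθ
  rw [ENNReal.toReal_ofReal (freeDensity_nonneg _), abs_of_nonneg (by positivity), smul_eq_mul,
    smul_eq_mul, ← mul_assoc, this]
  ring

instance isProbabilityMeasure_freeMeasure : IsProbabilityMeasure freeMeasure := by
  have hfin : IsFiniteMeasure freeMeasure := by
    refine isFiniteMeasure_withDensity_ofReal ?_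
    exact (continuous_freeDensity.integrableOn_Icc).2
  have h := integral_freeMeasure fun _ => 1
  simp only [one_mul, integral_const, smul_eq_mul, mul_one] at h
  rw [two_div_pi_mul_integral_sin_sq, measureReal_def] at h
  exact ⟨(ENNReal.toReal_eq_one_iff _).1 h⟩

/-! ### From continuous to measurable test functions -/

variable {σ : Measure ℝ} {s : ℝ}

/-- The entropy of `freeMeasure` relative to `σ` is at least `s`, in variational form. -/
def VariationalEntropyBound (σ : Measure ℝ) (s : ℝ) : Prop :=
  ∀ f : ℝ → ℝ, Continuous f → ∀ η B : ℝ, 0 < η → (∀ x, η ≤ f x) → (∀ x, f x ≤ B) →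
    s + ∫ l, Real.log (f l) ∂freeMeasure ≤ ∫ x, f x ∂σ - 1

theorem integrable_log_of_bounds {μ : Measure ℝ} [IsFiniteMeasure μ] {f : ℝ → ℝ}
    (hf : Measurable f) {η B : ℝ} (hη : 0 < η) (hfη : ∀ x, η ≤ f x) (hB : ∀ x, f x ≤ B) :
    Integrable (fun x => Real.log (f x)) μ := by
  refine Integrable.of_bound hf.log.aestronglyMeasurable (|Real.log η| + |Real.log B|)
    (ae_of_all _ fun x => ?_)
  have h1 := Real.log_le_log hη (hfη x)
  have h2 := Real.log_le_log (hη.trans_le (hfη x)) (hB x)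
  rw [Real.norm_eq_abs, abs_le]
  constructor
  · linarith [neg_abs_le (Real.log η), abs_nonneg (Real.log B)]
  · linarith [le_abs_self (Real.log B), abs_nonneg (Real.log η)]

theorem log_sub_log_le {a b η : ℝ} (hη : 0 < η) (ha : η ≤ a) (hb : η ≤ b) :
    Real.log a - Real.log b ≤ |a - b| / η := by
  have ha0 := hη.trans_le ha
  have hb0 := hη.trans_le hb
  rw [← Real.log_div ha0.ne' hb0.ne']
  refine (Real.log_le_sub_one_of_pos (div_pos ha0 hb0)).trans ?_
  calc a / b - 1 = (a - b) / b := by field_simp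
    _ ≤ |a - b| / b := by gcongr; exact le_abs_self _
    _ ≤ |a - b| / η := by gcongr

/-- Approximate f by a continuous function in L¹ of both measures at once and clamp it to [η, B].
Clamping does not increase the distance to f, and the logarithm is Lipschitz with constant 1/η above
η. -/
theorem VariationalEntropyBound.measurable [IsFiniteMeasure σ] (h : VariationalEntropyBound σ s)
    {f : ℝ → ℝ} (hf : Measurable f) {η B : ℝ} (hη : 0 < η) (hfη : ∀ x, η ≤ f x)
    (hB : ∀ x, f x ≤ B) :
    s + ∫ l, Real.log (f l) ∂freeMeasure ≤ ∫ x, f x ∂σ - 1 := by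
  have hfi : ∀ (μ : Measure ℝ) [IsFiniteMeasure μ], Integrable f μ := fun μ _ =>
    Integrable.of_bound hf.aestronglyMeasurable B (ae_of_all _ fun x => by
      rw [Real.norm_of_nonneg (hη.le.trans (hfη x))]; exact hB x)
  have hηB : η ≤ B := (hfη 0).trans (hB 0)
  refine le_of_forall_pos_le_add fun ε hε => ?_
  set δ := ε / (1 + 1 / η) with hδ
  have hδ0 : 0 < δ := by positivity
  obtain ⟨g, hg, hgi⟩ := (hfi (σ + freeMeasure)).exists_boundedContinuous_integral_sub_le hδ0
  set g' : ℝ → ℝ := fun x => max η (min (g x) B) with hg'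
  have hg'c : Continuous g' := by fun_prop
  have hg'η : ∀ x, η ≤ g' x := fun x => le_max_left _ _
  have hg'B : ∀ x, g' x ≤ B := fun x => max_le hηB (min_le_right _ _)
  have hg'i : ∀ (μ : Measure ℝ) [IsFiniteMeasure μ], Integrable g' μ := fun μ _ =>
    Integrable.of_bound hg'c.aestronglyMeasurable B (ae_of_all _ fun x => by
      rw [Real.norm_of_nonneg (hη.le.trans (hg'η x))]; exact hg'B x)
  have habs : ∀ x, |f x - g' x| ≤ ‖f x - g x‖ := by
    intro x
    have e : f x = max η (min (f x) B) := by rw [min_eq_left (hB x), max_eq_right (hfη x)]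
    calc |f x - g' x| = |max η (min (f x) B) - max η (min (g x) B)| := by rw [← e]
      _ ≤ |min (f x) B - min (g x) B| := by
        have := abs_max_sub_max_le_abs (min (f x) B) (min (g x) B) η
        rwa [max_comm η, max_comm η]
      _ ≤ |f x - g x| := by
        have := abs_min_sub_min_le_max (f x) B (g x) B
        simpa using this
      _ = _ := (Real.norm_eq_abs _).symm
  have hdi : Integrable (fun x => ‖f x - g x‖) (σ + freeMeasure) :=
    ((hfi (σ + freeMeasure)).sub hgi).norm
  have hds : ∫ x, |f x - g' x| ∂(σ + freeMeasure) ≤ δ :=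
    (integral_mono ((hfi _).sub (hg'i _)).abs hdi habs).trans hg
  have hd : ∀ (μ : Measure ℝ) [IsFiniteMeasure μ], Integrable (fun x => |f x - g' x|) μ :=
    fun μ _ => ((hfi μ).sub (hg'i μ)).abs
  rw [integral_add_measure (hd _) (hd _)] at hds
  have n1 : 0 ≤ ∫ x, |f x - g' x| ∂σ := integral_nonneg fun x => abs_nonneg _
  have n2 : 0 ≤ ∫ x, |f x - g' x| ∂freeMeasure := integral_nonneg fun x => abs_nonneg _
  have b1 : ∫ x, g' x ∂σ ≤ ∫ x, f x ∂σ + δ := by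
    have e : ∫ x, (g' x - f x) ∂σ ≤ ∫ x, |f x - g' x| ∂σ :=
      integral_mono ((hg'i _).sub (hfi _)) ((hfi _).sub (hg'i _)).abs fun x => by
        simp only
        rw [abs_sub_comm]; exact le_abs_self _
    rw [integral_sub (hg'i _) (hfi _)] at e
    linarith
  have b2 : ∫ x, Real.log (f x) ∂freeMeasure ≤ ∫ x, Real.log (g' x) ∂freeMeasure + δ / η := by
    have l1 := integrable_log_of_bounds (μ := freeMeasure) hf hη hfη hB
    have l2 := integrable_log_of_bounds (μ := freeMeasure) hg'c.measurable hη hg'η hg'B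
    have e : ∫ x, (Real.log (f x) - Real.log (g' x)) ∂freeMeasure ≤
        ∫ x, |f x - g' x| / η ∂freeMeasure :=
      integral_mono (l1.sub l2) (((hfi _).sub (hg'i _)).abs.div_const _) fun x =>
        log_sub_log_le hη (hfη x) (hg'η x)
    rw [integral_sub l1 l2, integral_div] at e
    have : (∫ x, |f x - g' x| ∂freeMeasure) / η ≤ δ / η := by
      gcongr; linarith
    linarith
  have key := h g' hg'c η B hη hg'η hg'B
  have : δ + δ / η = ε := by rw [hδ]; field_simp
  linarith

/-! ### The entropy of the absolutely continuous part -/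

/-- The density of the absolutely continuous part of `σ` relative to `freeMeasure`. -/
def relativeDensity (σ : Measure ℝ) (l : ℝ) : ℝ≥0∞ :=
  σ.rnDeriv volume l / ENNReal.ofReal (freeDensity l)

theorem measurable_relativeDensity : Measurable (relativeDensity σ) :=
  (Measure.measurable_rnDeriv _ _).div continuous_freeDensity.measurable.ennreal_ofReal

theorem ofReal_freeDensity_mul_relativeDensity {l : ℝ} (hl : l ∈ Ioo (-(2 * √2)) (2 * √2)) :
    ENNReal.ofReal (freeDensity l) * relativeDensity σ l = σ.rnDeriv volume l := by
  refine ENNReal.mul_div_cancel ?_ ENNReal.ofReal_ne_top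
  simpa using freeDensity_pos hl

theorem lintegral_relativeDensity_le :
    ∫⁻ l, relativeDensity σ l ∂freeMeasure ≤ σ univ := by
  rw [freeMeasure_eq_restrict_Ioo, lintegral_withDensity_eq_lintegral_mul _
    continuous_freeDensity.measurable.ennreal_ofReal measurable_relativeDensity]
  calc _ = ∫⁻ l in Ioo (-(2 * √2)) (2 * √2), σ.rnDeriv volume l :=
        setLIntegral_congr_fun measurableSet_Ioo fun l hl =>
          ofReal_freeDensity_mul_relativeDensity hl
    _ ≤ σ (Ioo (-(2 * √2)) (2 * √2)) := Measure.setLIntegral_rnDeriv_le _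
    _ ≤ _ := measure_mono (subset_univ _)

theorem relativeDensity_lt_top [IsFiniteMeasure σ] :
    ∀ᵐ l ∂freeMeasure, relativeDensity σ l < ⊤ :=
  ae_lt_top measurable_relativeDensity
    (lintegral_relativeDensity_le.trans_lt (measure_lt_top σ _)).ne

theorem integrable_relativeDensity [IsFiniteMeasure σ] :
    Integrable (fun l => (relativeDensity σ l).toReal) freeMeasure :=
  integrable_toReal_of_lintegral_ne_top measurable_relativeDensity.aemeasurable
    (lintegral_relativeDensity_le.trans_lt (measure_lt_top σ _)).ne

theorem integrable_log_relativeDensity_add [IsFiniteMeasure σ] {δ : ℝ} (hδ : 0 < δ) :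
    Integrable (fun l => Real.log ((relativeDensity σ l).toReal + δ)) freeMeasure := by
  refine Integrable.mono' (g := fun l => |Real.log δ| + ((relativeDensity σ l).toReal + δ))
    ((integrable_const _).add (integrable_relativeDensity.add (integrable_const _)))
    ((measurable_relativeDensity.ennreal_toReal.add_const δ).log).aestronglyMeasurable
    (ae_of_all _ fun l => ?_)
  have h0 : 0 ≤ (relativeDensity σ l).toReal := ENNReal.toReal_nonneg
  have h1 := Real.log_le_log hδ (by linarith : δ ≤ (relativeDensity σ l).toReal + δ)
  have h2 := Real.log_le_sub_one_of_pos (by linarith : 0 < (relativeDensity σ l).toReal + δ)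
  rw [Real.norm_eq_abs, abs_le]
  constructor
  · linarith [neg_abs_le (Real.log δ)]
  · linarith [abs_nonneg (Real.log δ)]

/-- The optimal test function is 1/ρ. Taking 1/(ρ + δ) keeps it bounded, and restricting it to a set
K avoiding the singular part of σ, with a floor η → 0, makes that part invisible. Then ∫ q dσ = ∫
ρ/(ρ + δ) dw ≤ 1. -/
theorem VariationalEntropyBound.le_integral_log [IsFiniteMeasure σ]
    (h : VariationalEntropyBound σ s) {δ : ℝ} (hδ : 0 < δ) :
    s ≤ ∫ l, Real.log ((relativeDensity σ l).toReal + δ) ∂freeMeasure := by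
  set J := Ioo (-(2 * √2)) (2 * √2) with hJ
  set r : ℝ → ℝ := fun l => (relativeDensity σ l).toReal with hr
  have hr0 : ∀ l, 0 ≤ r l := fun l => ENNReal.toReal_nonneg
  have hrm : Measurable r := measurable_relativeDensity.ennreal_toReal
  obtain ⟨N, hN, hNs, hNv⟩ := Measure.mutuallySingular_singularPart σ volume
  set K := J ∩ N with hK
  have hKm : MeasurableSet K := measurableSet_Ioo.inter hN
  set q : ℝ → ℝ := K.indicator fun l => 1 / (r l + δ) with hq
  have hqm : Measurable q := (measurable_const.div (hrm.add_const δ)).indicator hKm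
  have hq0 : ∀ l, 0 ≤ q l := fun l => indicator_nonneg (fun l _ => by
    have := hr0 l; positivity) l
  have hqB : ∀ l, q l ≤ 1 / δ := fun l => by
    by_cases hl : l ∈ K
    · rw [hq, indicator_of_mem hl]
      exact one_div_le_one_div_of_le hδ (by linarith [hr0 l])
    · rw [hq, indicator_of_notMem hl]
      positivity
  have hqi : Integrable q σ := Integrable.of_bound hqm.aestronglyMeasurable (1 / δ)
    (ae_of_all _ fun x => by rw [Real.norm_of_nonneg (hq0 x)]; exact hqB x)
  have hqσ : ∫ l, q l ∂σ ≤ 1 := by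
    rw [integral_eq_lintegral_of_nonneg_ae (ae_of_all _ hq0) hqm.aestronglyMeasurable]
    refine ENNReal.toReal_le_of_le_ofReal zero_le_one ?_
    have e1 : (fun l => ENNReal.ofReal (q l)) =
        K.indicator fun l => ENNReal.ofReal (1 / (r l + δ)) := by
      ext l
      by_cases hl : l ∈ K <;> simp [hq, hl]
    rw [e1, lintegral_indicator hKm]
    have e2 : σ.restrict K = (volume.restrict K).withDensity (σ.rnDeriv volume) := by
      conv_lhs => rw [Measure.haveLebesgueDecomposition_add σ volume]
      rw [Measure.restrict_add, restrict_withDensity hKm]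
      have : (σ.singularPart volume).restrict K = 0 :=
        Measure.restrict_eq_zero.2 (measure_mono_null inter_subset_right hNs)
      rw [this, zero_add]
    have hm : Measurable fun l => ENNReal.ofReal (1 / (r l + δ)) :=
      (measurable_const.div (hrm.add_const δ)).ennreal_ofReal
    rw [e2, lintegral_withDensity_eq_lintegral_mul _ (Measure.measurable_rnDeriv _ _) hm]
    have hw : ENNReal.ofReal 1 = ∫⁻ l in J, ENNReal.ofReal (freeDensity l) := by
      have : freeMeasure univ = 1 := measure_univ
      rw [freeMeasure_eq_restrict_Ioo, withDensity_apply _ MeasurableSet.univ,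
        Measure.restrict_univ] at this
      rw [ENNReal.ofReal_one, ← this]
    rw [hw]
    refine le_trans ?_ (lintegral_mono_set (inter_subset_left : K ⊆ J))
    refine lintegral_mono_ae ?_
    have hfin : ∀ᵐ l ∂(volume.restrict K), σ.rnDeriv volume l < ⊤ :=
      ae_restrict_of_ae (Measure.rnDeriv_lt_top σ volume)
    filter_upwards [hfin, ae_restrict_mem hKm] with l hl hlK
    have hD := freeDensity_pos hlK.1
    have hrl : σ.rnDeriv volume l = ENNReal.ofReal (freeDensity l * r l) := by
      rw [ENNReal.ofReal_mul hD.le, hr]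
      simp only
      rw [ENNReal.ofReal_toReal, ofReal_freeDensity_mul_relativeDensity hlK.1]
      refine ENNReal.div_ne_top hl.ne ?_
      simpa using hD
    simp only [Pi.mul_apply]
    have := hr0 l
    rw [hrl, ← ENNReal.ofReal_mul (by positivity)]
    refine ENNReal.ofReal_le_ofReal ?_
    rw [mul_one_div, div_le_iff₀ (by positivity)]
    nlinarith
  have hKae : ∀ᵐ l ∂freeMeasure, l ∈ K := by
    refine freeMeasure_absolutelyContinuous.ae_le ?_
    have h2 : ∀ᵐ l ∂(volume.restrict J), l ∈ N := by
      refine ae_restrict_of_ae ?_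
      rw [ae_iff]; exact hNv
    filter_upwards [h2, ae_restrict_mem measurableSet_Ioo] with l h1 h2 using ⟨h2, h1⟩
  have main : ∀ η : ℝ, 0 < η →
      s - ∫ l, Real.log (r l + δ) ∂freeMeasure ≤ η * σ.real univ := by
    intro η hη
    have hvar := h.measurable (f := fun l => q l + η) (hqm.add_const η) (B := 1 / δ + η) hη
      (fun l => by linarith [hq0 l]) (fun l => by linarith [hqB l])
    rw [integral_add hqi (integrable_const _), integral_const, smul_eq_mul] at hvar
    have hlog : -∫ l, Real.log (r l + δ) ∂freeMeasure ≤
        ∫ l, Real.log (q l + η) ∂freeMeasure := by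
      rw [← integral_neg]
      refine integral_mono_ae (integrable_log_relativeDensity_add hδ).neg
        (integrable_log_of_bounds (hqm.add_const η) hη (fun l => by linarith [hq0 l])
          (B := 1 / δ + η) (fun l => by linarith [hqB l])) ?_
      filter_upwards [hKae] with l hl
      have hp : 0 < r l + δ := by linarith [hr0 l]
      have e : q l = (r l + δ)⁻¹ := by rw [hq, indicator_of_mem hl, one_div]
      rw [← Real.log_inv, e]
      exact Real.log_le_log (inv_pos.2 hp) (by linarith)
    nlinarith
  have lim : Tendsto (fun η : ℝ => η * σ.real univ) (𝓝[>] 0) (𝓝 (0 * σ.real univ)) :=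
    (tendsto_id.mul_const _).mono_left nhdsWithin_le_nhds
  have := ge_of_tendsto lim (by
    filter_upwards [self_mem_nhdsWithin] with η hη using main η hη)
  linarith

/-- The entropy `∫ ln ρ dw` of a measure with relative density `ρ`. -/
def measureEntropy (σ : Measure ℝ) : EReal :=
  ((∫⁻ l, (ENNReal.log (relativeDensity σ l)).toENNReal ∂freeMeasure : ℝ≥0∞) : EReal) -
    ((∫⁻ l, (-ENNReal.log (relativeDensity σ l)).toENNReal ∂freeMeasure : ℝ≥0∞) : EReal)

theorem toENNReal_log_le (x : ℝ≥0∞) : (ENNReal.log x).toENNReal ≤ x := by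
  rcases le_or_gt x 1 with h | h
  · rw [EReal.toENNReal_of_nonpos (by simpa using h)]; exact zero_le
  · rcases eq_or_ne x ⊤ with rfl | hx
    · exact le_top
    · lift x to NNReal using hx
      have hx1 : (1 : ℝ) < x := by exact_mod_cast h
      rw [← ENNReal.ofReal_coe_nnreal, ENNReal.log_ofReal_of_pos (by linarith),
        EReal.real_coe_toENNReal]
      refine ENNReal.ofReal_le_ofReal ?_
      linarith [Real.log_le_sub_one_of_pos (by linarith : (0 : ℝ) < x)]

theorem ofReal_log_add_le {x : ℝ≥0∞} (hx : x ≠ ⊤) {δ : ℝ} (hδ : 0 < δ) :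
    ENNReal.ofReal (Real.log (x.toReal + δ)) ≤ (ENNReal.log x).toENNReal + ENNReal.ofReal δ := by
  have h0 : 0 ≤ x.toReal := ENNReal.toReal_nonneg
  rcases le_or_gt x.toReal 1 with h | h
  · refine le_trans (ENNReal.ofReal_le_ofReal ?_) le_add_self
    linarith [Real.log_le_sub_one_of_pos (by linarith : 0 < x.toReal + δ)]
  · have e : (ENNReal.log x).toENNReal = ENNReal.ofReal (Real.log x.toReal) := by
      conv_lhs => rw [← ENNReal.ofReal_toReal hx]
      rw [ENNReal.log_ofReal_of_pos (by linarith), EReal.real_coe_toENNReal]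
    rw [e, ← ENNReal.ofReal_add (Real.log_nonneg h.le) hδ.le]
    refine ENNReal.ofReal_le_ofReal ?_
    have := log_sub_log_le (a := x.toReal + δ) (b := x.toReal) one_pos (by linarith) h.le
    rw [add_sub_cancel_left, abs_of_pos hδ] at this
    linarith

theorem tendsto_ofReal_neg_log_add {x : ℝ≥0∞} (hx : x ≠ ⊤) :
    Tendsto (fun n : ℕ => ENNReal.ofReal (-Real.log (x.toReal + 1 / ((n : ℝ) + 1)))) atTop
      (𝓝 (-ENNReal.log x).toENNReal) := by
  have hd : Tendsto (fun n : ℕ => x + ENNReal.ofReal (1 / ((n : ℝ) + 1))) atTop (𝓝 x) := by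
    have := (ENNReal.tendsto_ofReal tendsto_one_div_add_atTop_nhds_zero_nat).const_add x
    simpa using this
  have hc := ((EReal.continuous_toENNReal.comp (continuous_neg.comp
    ENNReal.continuous_log)).tendsto x).comp hd
  refine hc.congr fun n => ?_
  have hpos : (0 : ℝ) < 1 / ((n : ℝ) + 1) := by positivity
  have h0 : 0 ≤ x.toReal := ENNReal.toReal_nonneg
  simp only [Function.comp_apply]
  have e : x + ENNReal.ofReal (1 / ((n : ℝ) + 1)) =
      ENNReal.ofReal (x.toReal + 1 / ((n : ℝ) + 1)) := by
    rw [ENNReal.ofReal_add h0 hpos.le, ENNReal.ofReal_toReal hx]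
  rw [e, ENNReal.log_ofReal_of_pos (by linarith), ← EReal.coe_neg, EReal.real_coe_toENNReal]

/-- Since log⁺(ρ + δ) ≤ log⁺ρ + δ, the preceding bound controls the negative part of log(ρ + δ) by P
+ δ - s. Fatou's lemma along δ = 1/(n + 1) gives N ≤ P - s. -/
theorem VariationalEntropyBound.lintegral_neg_log_le [IsFiniteMeasure σ]
    (h : VariationalEntropyBound σ s) :
    ∫⁻ l, (ENNReal.log (relativeDensity σ l)).toENNReal ∂freeMeasure < ⊤ ∧
    ∫⁻ l, (-ENNReal.log (relativeDensity σ l)).toENNReal ∂freeMeasure < ⊤ ∧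
    s ≤ (∫⁻ l, (ENNReal.log (relativeDensity σ l)).toENNReal ∂freeMeasure).toReal -
      (∫⁻ l, (-ENNReal.log (relativeDensity σ l)).toENNReal ∂freeMeasure).toReal := by
  set P := ∫⁻ l, (ENNReal.log (relativeDensity σ l)).toENNReal ∂freeMeasure with hP
  set N := ∫⁻ l, (-ENNReal.log (relativeDensity σ l)).toENNReal ∂freeMeasure with hN
  have hPtop : P < ⊤ := ((lintegral_mono fun l => toENNReal_log_le _).trans
    lintegral_relativeDensity_le).trans_lt (measure_lt_top σ _)
  have step : ∀ δ : ℝ, 0 < δ →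
      ∫⁻ l, ENNReal.ofReal (-Real.log ((relativeDensity σ l).toReal + δ)) ∂freeMeasure ≤
        ENNReal.ofReal (P.toReal + δ - s) ∧ 0 ≤ P.toReal + δ - s := by
    intro δ hδ
    have hi := integrable_log_relativeDensity_add (σ := σ) hδ
    have hs := h.le_integral_log hδ
    rw [integral_eq_lintegral_pos_part_sub_lintegral_neg_part hi] at hs
    have hNδ : ∫⁻ l, ENNReal.ofReal (-Real.log ((relativeDensity σ l).toReal + δ)) ∂freeMeasure
        < ⊤ := by
      refine lt_of_le_of_lt (lintegral_mono fun l => ?_) hi.2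
      rw [← ofReal_norm]
      exact ENNReal.ofReal_le_ofReal (neg_le_abs _)
    have hPδ : (∫⁻ l, ENNReal.ofReal (Real.log ((relativeDensity σ l).toReal + δ))
        ∂freeMeasure).toReal ≤ P.toReal + δ := by
      have : ∫⁻ l, ENNReal.ofReal (Real.log ((relativeDensity σ l).toReal + δ)) ∂freeMeasure ≤
          P + ENNReal.ofReal δ := by
        calc _ ≤ ∫⁻ l, ((ENNReal.log (relativeDensity σ l)).toENNReal + ENNReal.ofReal δ)
              ∂freeMeasure := lintegral_mono_ae (relativeDensity_lt_top.mono fun l hl =>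
                ofReal_log_add_le hl.ne hδ)
          _ = _ := by
            rw [lintegral_add_right _ measurable_const, lintegral_const, measure_univ, mul_one]
      have h2 := ENNReal.toReal_mono (ENNReal.add_ne_top.2 ⟨hPtop.ne, ENNReal.ofReal_ne_top⟩) this
      rwa [ENNReal.toReal_add hPtop.ne ENNReal.ofReal_ne_top, ENNReal.toReal_ofReal hδ.le] at h2
    have hle : (∫⁻ l, ENNReal.ofReal (-Real.log ((relativeDensity σ l).toReal + δ))
        ∂freeMeasure).toReal ≤ P.toReal + δ - s := by linarith
    have hnn : 0 ≤ P.toReal + δ - s := ENNReal.toReal_nonneg.trans hle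
    exact ⟨(ENNReal.le_ofReal_iff_toReal_le hNδ.ne hnn).2 hle, hnn⟩
  have hpos : ∀ n : ℕ, (0 : ℝ) < 1 / ((n : ℝ) + 1) := fun n => by positivity
  have hlim : Tendsto (fun n : ℕ => P.toReal + 1 / ((n : ℝ) + 1) - s) atTop (𝓝 (P.toReal - s)) := by
    have := (tendsto_one_div_add_atTop_nhds_zero_nat (𝕜 := ℝ)).const_add P.toReal |>.sub_const s
    simpa using this
  have hnn : 0 ≤ P.toReal - s :=
    ge_of_tendsto hlim (Eventually.of_forall fun n => (step _ (hpos n)).2)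
  have hNle : N ≤ ENNReal.ofReal (P.toReal - s) := by
    calc N = ∫⁻ l, liminf (fun n : ℕ => ENNReal.ofReal (-Real.log ((relativeDensity σ l).toReal +
          1 / ((n : ℝ) + 1)))) atTop ∂freeMeasure :=
          lintegral_congr_ae (relativeDensity_lt_top.mono fun l hl =>
            (tendsto_ofReal_neg_log_add hl.ne).liminf_eq.symm)
      _ ≤ liminf (fun n : ℕ => ∫⁻ l, ENNReal.ofReal (-Real.log ((relativeDensity σ l).toReal +
          1 / ((n : ℝ) + 1))) ∂freeMeasure) atTop := lintegral_liminf_le fun n =>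
            ((measurable_relativeDensity.ennreal_toReal.add_const _).log.neg).ennreal_ofReal
      _ ≤ liminf (fun n : ℕ => ENNReal.ofReal (P.toReal + 1 / ((n : ℝ) + 1) - s)) atTop :=
          liminf_le_liminf (Eventually.of_forall fun n => (step _ (hpos n)).1)
      _ = _ := (ENNReal.tendsto_ofReal hlim).liminf_eq
  refine ⟨hPtop, hNle.trans_lt ENNReal.ofReal_lt_top, ?_⟩
  have := ENNReal.toReal_le_of_le_ofReal hnn hNle
  linarith

theorem VariationalEntropyBound.le_measureEntropy [IsFiniteMeasure σ]
    (h : VariationalEntropyBound σ s) : (s : EReal) ≤ measureEntropy σ := by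
  obtain ⟨hP, hN, hs⟩ := h.lintegral_neg_log_le
  have e : ∀ x : ℝ≥0∞, x < ⊤ → (x : EReal) = ((x.toReal : ℝ) : EReal) := fun x hx =>
    (EReal.coe_ennreal_toReal hx.ne).symm
  rw [measureEntropy, e _ hP, e _ hN, ← EReal.coe_sub]
  exact_mod_cast hs

/-- A measure of finite entropy has an absolutely continuous part of full support. -/
theorem VariationalEntropyBound.subset_support [IsFiniteMeasure σ]
    (h : VariationalEntropyBound σ s) :
    Icc (-(2 * √2)) (2 * √2) ⊆ (acPart σ).support := by
  -- Where the density vanishes, -log ρ is +∞, which a finite negative part allows only on a null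
  -- set.
  have hpos : ∀ᵐ l ∂freeMeasure, 0 < σ.rnDeriv volume l := by
    have hN := h.lintegral_neg_log_le.2.1
    have hm : Measurable fun l => (-ENNReal.log (relativeDensity σ l)).toENNReal :=
      (EReal.continuous_toENNReal.comp (continuous_neg.comp
        ENNReal.continuous_log)).measurable.comp measurable_relativeDensity
    filter_upwards [ae_lt_top hm hN.ne] with l hl
    rw [pos_iff_ne_zero]
    intro h0
    rw [relativeDensity, h0, ENNReal.zero_div, ENNReal.log_zero, EReal.neg_bot,
      EReal.toENNReal_top] at hl
    exact lt_irrefl _ hl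
  have hpos' : ∀ᵐ l ∂(volume.restrict (Ioo (-(2 * √2)) (2 * √2))), 0 < σ.rnDeriv volume l := by
    rw [freeMeasure_eq_restrict_Ioo, ae_withDensity_iff
      continuous_freeDensity.measurable.ennreal_ofReal] at hpos
    filter_upwards [hpos, ae_restrict_mem measurableSet_Ioo] with l h1 h2
    exact h1 (by simpa using freeDensity_pos h2)
  have hne : (-(2 * √2) : ℝ) ≠ 2 * √2 := by
    have : (0 : ℝ) < √2 := by positivity
    intro h; linarith
  rw [← closure_Ioo hne]
  refine closure_minimal (fun l hl => ?_) Measure.isClosed_support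
  rw [Measure.mem_support_iff_forall]
  intro U hU
  obtain ⟨O, hOU, hO, hlO⟩ := mem_nhds_iff.1 (Filter.inter_mem hU (Ioo_mem_nhds hl.1 hl.2))
  refine lt_of_lt_of_le ?_ (measure_mono (hOU.trans inter_subset_left))
  rw [acPart, withDensity_apply _ hO.measurableSet, lintegral_pos_iff_support
    (Measure.measurable_rnDeriv _ _)]
  have hfull : ∀ᵐ l ∂(volume.restrict O), l ∈ Function.support (σ.rnDeriv volume) :=
    (ae_restrict_of_ae_restrict_of_subset (hOU.trans inter_subset_right) hpos').mono
      fun l hl => hl.ne'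
  have hvol : 0 < (volume.restrict O) univ := by
    rw [Measure.restrict_apply_univ]
    exact hO.measure_pos volume ⟨l, hlO⟩
  have e : (volume.restrict O) (Function.support (σ.rnDeriv volume)) = (volume.restrict O) univ :=
    measure_congr (eventuallyEq_univ.2 hfull)
  rwa [e]

end Variational

/-! ### Measures of binary cylinders and the integral of the path sum. -/

noncomputable section Coding

/-! ### Binary cylinders -/

theorem measurable_binaryDigit (n : ℕ) : Measurable fun t => binaryDigit t n := by
  refine Measurable.ite (measurableSet_singleton 1) measurable_const ?_
  exact (measurable_of_countable (Fin.ofNat 2)).comp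
    (Nat.measurable_floor.comp (measurable_id.mul_const _))

theorem ofDigits_binaryDigit {t : ℝ} (ht : t ∈ Icc 0 1) : Real.ofDigits (binaryDigit t) = t := by
  by_cases h : t = 1
  · have e : binaryDigit t = fun _ => ⟨2 - 1, Nat.sub_one_lt_of_lt one_lt_two⟩ := by
      ext n; simp [binaryDigit, h]
    rw [e, Real.ofDigits_const_last_eq_one' one_lt_two, h]
  · have e : binaryDigit t = Real.digits t 2 := by
      ext n; simp [binaryDigit, h]
    rw [e, Real.ofDigits_digits one_lt_two ⟨ht.1, lt_of_le_of_ne ht.2 h⟩]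

theorem binaryDigit_eq_of_pathVertex_eq {t u : ℝ} {n : ℕ} (h : pathVertex t n = pathVertex u n) :
    ∀ i < n, binaryDigit t i = binaryDigit u i := by
  induction n with
  | zero => intro i hi; omega
  | succ n ih =>
    obtain ⟨h1, h2⟩ := List.cons.inj h
    intro i hi
    rcases Nat.lt_succ_iff_lt_or_eq.1 hi with hi | rfl
    · exact ih h2 i hi
    · exact h1

/-- The points whose path passes through the vertex `x`. -/
def pathCylinder (x : List (Fin 2)) : Set ℝ := {t | pathVertex t x.length = x}

theorem pathCylinder_nil : pathCylinder [] = univ := by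
  ext t; simp [pathCylinder, pathVertex]

theorem pathCylinder_cons (i : Fin 2) (x : List (Fin 2)) :
    pathCylinder (i :: x) = pathCylinder x ∩ {t | binaryDigit t x.length = i} := by
  ext t
  simp [pathCylinder, pathVertex, and_comm]

theorem measurableSet_pathCylinder (x : List (Fin 2)) : MeasurableSet (pathCylinder x) := by
  induction x with
  | nil => rw [pathCylinder_nil]; exact MeasurableSet.univ
  | cons i x ih =>
    rw [pathCylinder_cons]
    exact ih.inter (measurable_binaryDigit _ (measurableSet_singleton i))

theorem pathCylinder_eq_union (x : List (Fin 2)) :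
    pathCylinder x = pathCylinder (0 :: x) ∪ pathCylinder (1 :: x) := by
  rw [pathCylinder_cons, pathCylinder_cons, ← inter_union_distrib_left, eq_comm, inter_eq_left]
  intro t _
  rcases Fin.exists_fin_two.1 ⟨binaryDigit t x.length, rfl⟩ with h | h
  · exact Or.inl h
  · exact Or.inr h

theorem disjoint_pathCylinder (x : List (Fin 2)) :
    Disjoint (pathCylinder (0 :: x)) (pathCylinder (1 :: x)) := by
  rw [Set.disjoint_left, pathCylinder_cons, pathCylinder_cons]
  rintro t ⟨_, h0⟩ ⟨_, h1⟩
  rw [mem_ofPred_eq] at h0 h1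
  rw [h0] at h1
  exact absurd h1 (by decide)

/-- Points with the same first n digits are within 2⁻ⁿ of each other, so the diameter bounds the
measure and the endpoints of the cylinder never matter. -/
theorem volume_pathCylinder_inter_le (x : List (Fin 2)) :
    volume (pathCylinder x ∩ Icc 0 1) ≤ ENNReal.ofReal ((1 / 2) ^ x.length) := by
  refine (Real.volume_le_diam _).trans (Metric.ediam_le fun t ht u hu => ?_)
  rw [edist_dist]
  refine ENNReal.ofReal_le_ofReal ?_
  rw [Real.dist_eq, ← ofDigits_binaryDigit ht.2, ← ofDigits_binaryDigit hu.2]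
  have := Real.abs_ofDigits_sub_ofDigits_le (binaryDigit_eq_of_pathVertex_eq
    ((show pathVertex t x.length = x from ht.1).trans
      (show pathVertex u x.length = x from hu.1).symm))
  simpa using this

/-- The weight of a cylinder is the measure of the part of `A` that lies in it. -/
theorem isCylinderWeight_restrict {A : Set ℝ} (hA01 : A ⊆ Icc 0 1) :
    IsCylinderWeight fun x => (volume.restrict A).real (pathCylinder x) := by
  have : IsFiniteMeasure (volume.restrict A) :=
    ⟨by rw [Measure.restrict_apply_univ]; exact (measure_mono hA01).trans_lt measure_Icc_lt_top⟩
  refine ⟨fun x => measureReal_nonneg, fun x => ?_, fun x => ?_⟩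
  · rw [pathCylinder_eq_union x]
    exact measureReal_union (disjoint_pathCylinder x) (measurableSet_pathCylinder _)
  · refine ENNReal.toReal_le_of_le_ofReal (by positivity) ?_
    rw [Measure.restrict_apply (measurableSet_pathCylinder x)]
    exact (measure_mono (inter_subset_inter_right _ hA01)).trans (volume_pathCylinder_inter_le x)

theorem measurable_pathVertex (n : ℕ) : Measurable[_, ⊤] fun t => pathVertex t n := by
  induction n with
  | zero => exact measurable_const
  | succ n ih =>
    refine @measurable_to_countable' _ _ ⊤ _ _ _ fun x => ?_
    cases x with
    | nil => convert MeasurableSet.empty; ext t; simp [pathVertex]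
    | cons i x =>
      have : (fun t => pathVertex t (n + 1)) ⁻¹' {i :: x} =
          (fun t => binaryDigit t n) ⁻¹' {i} ∩ (fun t => pathVertex t n) ⁻¹' {x} := by
        ext t; simp [pathVertex]
      rw [this]
      exact (measurable_binaryDigit n (measurableSet_singleton i)).inter (ih trivial)

theorem measurable_sq_potential (V : List (Fin 2) → ℝ) (n : ℕ) :
    Measurable fun t => ENNReal.ofReal (V (pathVertex t n) ^ 2) := by
  have : Measurable[⊤] fun x : List (Fin 2) => ENNReal.ofReal (V x ^ 2) := measurable_from_top
  exact this.comp (measurable_pathVertex n)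

/-- Integrating the number of visits of paths to each vertex. The induction descends from the root
by appending letters at the end of the word, so it must be stated for the subtree of words ending in
s. -/
theorem ofReal_weightedSquares (m : Measure ℝ) [IsFiniteMeasure m] (V : List (Fin 2) → ℝ) (n : ℕ)
    (s : List (Fin 2)) :
    ENNReal.ofReal (weightedSquares n (fun x => V (x ++ s)) fun x => m.real (pathCylinder (x ++ s))) =
      ∫⁻ t in pathCylinder s, ∑ k ∈ Finset.range n,
        ENNReal.ofReal (V (pathVertex t (s.length + k)) ^ 2) ∂m := by
  induction n generalizing s with
  | zero => simp [weightedSquares]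
  | succ n ih =>
    have hc : ∀ (F : List (Fin 2) → ℝ) i, childFunction (fun x => F (x ++ s)) i =
        fun x => F (x ++ i :: s) := fun F i => by
      ext x; simp [childFunction]
    have hμ := fun i => hc (fun x => m.real (pathCylinder x)) i
    have hnn : ∀ i : Fin 2, 0 ≤ weightedSquares n (fun x => V (x ++ i :: s))
        fun x => m.real (pathCylinder (x ++ i :: s)) :=
      fun i => weightedSquares_nonneg _ _ _ fun x => measureReal_nonneg
    rw [weightedSquares, hc, hc, hμ, hμ, ENNReal.ofReal_add
      (mul_nonneg (sq_nonneg _) measureReal_nonneg) (add_nonneg (hnn 0) (hnn 1)),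
      ENNReal.ofReal_add (hnn 0) (hnn 1), ih, ih]
    -- The term k = 0 is the vertex s itself, constant on its cylinder; the others split over the
    -- two children of s.
    simp_rw [Finset.sum_range_succ' _ n]
    rw [lintegral_add_left (Finset.measurable_fun_sum _ fun k _ => measurable_sq_potential V _),
      add_comm]
    congr 1
    · conv_rhs => rw [pathCylinder_eq_union s]
      rw [lintegral_union (measurableSet_pathCylinder _) (disjoint_pathCylinder s)]
      simp only [List.length_cons, add_assoc, add_comm 1]
    · rw [setLIntegral_congr_fun (g := fun _ => ENNReal.ofReal (V s ^ 2))
        (measurableSet_pathCylinder s) (fun t ht => by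
          simp only [add_zero]
          rw [show pathVertex t s.length = s from ht]), lintegral_const,
        Measure.restrict_apply_univ, List.nil_append, ENNReal.ofReal_mul (sq_nonneg _),
        ofReal_measureReal]

theorem weightedSquares_le_pathSum (m : Measure ℝ) [IsFiniteMeasure m] (V : List (Fin 2) → ℝ)
    (hφ : ∫⁻ t, pathSum V t ∂m ≠ ⊤) (n : ℕ) :
    weightedSquares n V (fun x => m.real (pathCylinder x)) ≤ (∫⁻ t, pathSum V t ∂m).toReal := by
  rw [← ENNReal.ofReal_le_iff_le_toReal hφ]
  have h := ofReal_weightedSquares m V n []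
  simp only [List.append_nil, pathCylinder_nil, Measure.restrict_univ, List.length_nil,
    zero_add] at h
  rw [h]
  exact lintegral_mono fun t => ENNReal.sum_le_tsum _

end Coding

/-! ### Removal of the cutoff and conclusion. -/

noncomputable section Main

open Filter Topology

section Limit

variable {E : Type*} [NormedAddCommGroup E] [InnerProductSpace ℂ E] [CompleteSpace E]

/-- The entropy bound passes to strong limits of operators with a uniform lower bound. -/
theorem variationalEntropyBound_of_tendsto {H : E →L[ℂ] E} {Hn : ℕ → E →L[ℂ] E} {ψ : E} {k s R : ℝ}
    {S : ℕ → ℝ → ℂ → ℂ} (hH : IsSelfAdjoint H) (hHn : ∀ n, IsSelfAdjoint (Hn n)) (hR : ‖H‖ ≤ R)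
    (hRn : ∀ n, ‖Hn n‖ ≤ R) (hlim : ∀ u, Tendsto (fun n => Hn n u) atTop (𝓝 (H u)))
    (hS : ∀ n, HerglotzFamily k (S n)) (hG : ∀ n, IsGreenFunction (Hn n) ψ (S n 0))
    (hs : ∀ n, s ≤ arcEntropy (S n 0)) :
    VariationalEntropyBound (spectralMeasure H ψ) s := by
  intro f hf η B hη hfη hB
  refine ge_of_tendsto ((tendsto_integral_spectralMeasure ψ hH hHn hR hRn hlim hf).sub_const 1)
    (Eventually.of_forall fun n => ?_)
  have := (hG n).entropy_le (hHn n) (hS n) hf hη hfη hB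
  rw [integral_freeMeasure]
  linarith [hs n]

theorem VariationalEntropyBound.subset_acSpectrum {H : E →L[ℂ] E} {ψ : E} {s : ℝ}
    (hH : IsSelfAdjoint H) (h : VariationalEntropyBound (spectralMeasure H ψ) s) :
    Icc (-(2 * √2)) (2 * √2) ⊆ acSpectrum H := by
  have := isFiniteMeasure_spectralMeasure ψ hH
  exact h.subset_support.trans ((subset_iUnion (fun φ => (acPart (spectralMeasure H φ)).support)
    ψ).trans subset_closure)

end Limit

section Schrodinger

variable {W : Type*}

theorem variationalEntropyBound_schrodinger (G : SimpleGraph W) [G.LocallyFinite]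
    (hd : ∃ d : ℕ, ∀ x, G.degree x ≤ d) (V : W → ℝ) (hV : ∃ C : ℝ, ∀ x, |V x| ≤ C)
    (Vn : ℕ → W → ℝ) {C : ℝ} (hC : ∀ x, |V x| ≤ C) (hCn : ∀ n x, |Vn n x| ≤ C)
    (hlim : ∀ x, Tendsto (fun n => Vn n x) atTop (𝓝 (V x))) {ψ : EllTwo W}
    {k s : ℝ} {S : ℕ → ℝ → ℂ → ℂ} (hS : ∀ n, HerglotzFamily k (S n))
    (hG : ∀ n, IsGreenFunction (schrodinger G hd (Vn n) ⟨C, hCn n⟩) ψ (S n 0))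
    (hs : ∀ n, s ≤ arcEntropy (S n 0)) :
    VariationalEntropyBound (spectralMeasure (schrodinger G hd V hV) ψ) s := by
  obtain ⟨d, hdd⟩ := id hd
  refine variationalEntropyBound_of_tendsto (isSelfAdjoint_schrodinger G hd V hV)
    (fun n => isSelfAdjoint_schrodinger G hd _ _) (norm_schrodinger_le G hd V hV hdd hC)
    (fun n => norm_schrodinger_le G hd _ _ hdd (hCn n))
    (tendsto_schrodinger G hd V hV Vn (fun n => ⟨C, hCn n⟩) (C := C + C) (fun n x => ?_) hlim)
    hS hG hs
  exact (abs_sub _ _).trans (add_le_add (hCn n x) (hC x))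

theorem abs_truncatePotential_le (n : ℕ) {V : List (Fin 2) → ℝ} {C : ℝ} (hC : ∀ x, |V x| ≤ C)
    (x : List (Fin 2)) : |truncatePotential n V x| ≤ C := by
  rw [truncatePotential]
  split_ifs
  · exact hC x
  · rw [abs_zero]; exact (abs_nonneg _).trans (hC x)

theorem tendsto_truncatePotential (V : List (Fin 2) → ℝ) (x : List (Fin 2)) :
    Tendsto (fun n => truncatePotential n V x) atTop (𝓝 (V x)) := by
  refine tendsto_const_nhds.congr' ?_
  filter_upwards [eventually_gt_atTop x.length] with n hn
  rw [truncatePotential, if_pos hn]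

theorem variationalEntropyBound_rooted (V : List (Fin 2) → ℝ) (hV : ∃ C : ℝ, ∀ x, |V x| ≤ C) {s : ℝ}
    (hs : ∀ n, s ≤ arcEntropy (treeGreen n V 0)) : VariationalEntropyBound (rootMeasure V hV) s := by
  obtain ⟨C, hC⟩ := id hV
  refine variationalEntropyBound_schrodinger binaryTree binaryTree_degree_le V hV
    (fun n => truncatePotential n V) hC (fun n => abs_truncatePotential_le n hC)
    (tendsto_truncatePotential V) (fun n => herglotzFamily_treeGreen n V) (fun n ζ hζ => ?_) hs
  obtain ⟨u, hu, hu0⟩ := exists_rooted_green_vector n V ⟨C, abs_truncatePotential_le n hC⟩ hζ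
  exact ⟨u, hu, by rw [inner_single_one, hu0]⟩

theorem variationalEntropyBound_cayley (V : CayleyVertex → ℝ) (hV : ∃ C : ℝ, ∀ x, |V x| ≤ C) {s : ℝ}
    (hs : ∀ n, s ≤ arcEntropy (cayleyGreen n V 0)) :
    VariationalEntropyBound (spectralMeasure (treeOperator V hV) (lp.single 2 (Sum.inl []) 1)) s := by
  obtain ⟨C, hC⟩ := id hV
  have hCn : ∀ n x, |truncateCayley (n + 1) V x| ≤ C := by
    rintro n (x | x)
    · exact abs_truncatePotential_le (n + 1) (fun x => hC (Sum.inl x)) x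
    · exact abs_truncatePotential_le (n + 1) (fun x => hC (Sum.inr x)) x
  have hlim : ∀ x, Tendsto (fun n => truncateCayley (n + 1) V x) atTop (𝓝 (V x)) := by
    rintro (x | x)
    · exact (tendsto_truncatePotential (fun x => V (Sum.inl x)) x).comp (tendsto_add_atTop_nat 1)
    · exact (tendsto_truncatePotential (fun x => V (Sum.inr x)) x).comp (tendsto_add_atTop_nat 1)
  -- Cutoff depth n + 1 in both copies matches `cayleyGreen n`: the children of O are expanded to
  -- depth n, the opposite root to depth n + 1.
  refine variationalEntropyBound_schrodinger cayleyTree ⟨3, fun x => (cayleyTree_degree x).le⟩ V hV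
    (fun n => truncateCayley (n + 1) V) hC hCn hlim (fun n => herglotzFamily_cayleyGreen n V)
    (fun n ζ hζ => ?_) hs
  obtain ⟨u, hu, hu0⟩ := exists_cayley_green_vector n V ⟨C, hCn n⟩ hζ
  exact ⟨u, hu, by rw [inner_single_one, hu0]⟩

end Schrodinger

end Main

theorem mainTheorem2 (V : CayleyVertex → ℝ) (hV : ∃ C : ℝ, ∀ x, |V x| ≤ C)
    (A : Set ℝ) (hA : NullMeasurableSet A volume) (hA01 : A ⊆ Icc 0 1) (hApos : 0 < volume A)
    (hφ : ∫⁻ t in A, pathSum (fun x => V (Sum.inl x)) t < ⊤) :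
    ((-(1 / (4 * (volume A).toReal)) * (∫⁻ t in A, pathSum (fun x => V (Sum.inl x)) t).toReal
          + Real.log (volume A).toReal : ℝ) : EReal)
        ≤ entropyAtRoot (fun x => V (Sum.inl x)) (hV.imp fun _ h x => h (Sum.inl x)) ∧
      Icc (-(2 * √2)) (2 * √2) ⊆ acSpectrum (rootedOperator (fun x => V (Sum.inl x)) (hV.imp fun _ h x => h (Sum.inl x))) ∧
      Icc (-(2 * √2)) (2 * √2) ⊆ acSpectrum (treeOperator V hV) := by
  have hfin : volume A < ⊤ := (measure_mono hA01).trans_lt measure_Icc_lt_top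
  have : IsFiniteMeasure (volume.restrict A) := ⟨by rwa [Measure.restrict_apply_univ]⟩
  set m := volume.restrict A with hm
  set μ : List (Fin 2) → ℝ := fun x => m.real (pathCylinder x) with hμdef
  have hμ : IsCylinderWeight μ := isCylinderWeight_restrict hA01
  have hμ0 : μ [] = (volume A).toReal := by
    simp only [hμdef, hm, pathCylinder_nil, measureReal_def, Measure.restrict_apply_univ]
  have hpos : 0 < μ [] := by rw [hμ0]; exact ENNReal.toReal_pos hApos.ne' hfin.ne
  -- Bounding the truncated sums by the full integral of φ makes the entropy bound independent of
  -- the cutoff.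
  have hle : ∀ n, -(1 / (4 * μ [])) * (∫⁻ t, pathSum (fun x => V (Sum.inl x)) t ∂m).toReal ≤
      -(1 / (4 * μ [])) * weightedSquares n (fun x => V (Sum.inl x)) μ := fun n =>
    mul_le_mul_of_nonpos_left (weightedSquares_le_pathSum m _ hφ.ne n)
      (neg_nonpos.2 (by positivity))
  have hVL : ∃ C : ℝ, ∀ x, |(fun x => V (Sum.inl x)) x| ≤ C := hV.imp fun _ h x => h (Sum.inl x)
  rw [← hμ0]
  have hroot := variationalEntropyBound_rooted (fun x => V (Sum.inl x)) hVL fun n =>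
    (add_le_add_left (hle n) (Real.log (μ []))).trans (treeGreen_entropy_bound hμ hpos)
  -- The loss 1/2 is harmless, since any finite bound yields the spectral inclusion.
  have hcayley := variationalEntropyBound_cayley V hV fun n =>
    (sub_le_sub_right (add_le_add_left (hle (n + 1)) (Real.log (μ []))) (1 / 2)).trans
      (cayley_entropy_bound n V hμ hpos)
  have hsa := isSelfAdjoint_schrodinger binaryTree binaryTree_degree_le
    (fun x => V (Sum.inl x)) hVL
  have : IsFiniteMeasure (rootMeasure (fun x => V (Sum.inl x)) hVL) :=
    isFiniteMeasure_spectralMeasure _ hsa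
  -- `measureEntropy` of the root measure unfolds to `entropyAtRoot`.
  exact ⟨hroot.le_measureEntropy, VariationalEntropyBound.subset_acSpectrum hsa hroot,
    hcayley.subset_acSpectrum (isSelfAdjoint_schrodinger _ _ _ _)⟩
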